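/- Let $d\ge 2$, $N\ge 1$, $A,B\in\mathbb C^{N,N}$ and $S\in\mathbb R^{d,d}$ be such that $A$ and $B$ are simultaneously diagonalizable (there is an invertible $Y\in\mathbb C^{N,N}$ with $Y^{-1}AY$ and $Y^{-1}BY$ diagonal), every eigenvalue of $A$ has positive real part, and $S^{T}=-S$. Write $\rho$ for the spectral radius, $s$ for the spectral abscissa, $|\cdot|$ for the Euclidean and spectral norms, and put $$a_{\min}=\rho(A^{-1})^{-1},\quad a_{\max}=\rho(A),\quad a_0=-s(-A),\quad b_0=-s(-B),\quad \omega_b=-b_0,\quad a_1=\frac{a_{\max}^2}{a_{\min}a_0},\quad \kappa=|Y||Y^{-1}|.$$ For $t>0$ let $$[T(t)v](x)=\int_{\mathbb R^d}H(x,\xi,t)v(\xi)\,d\xi,\qquad H(x,\xi,t)=(4\pi tA)^{-d/2}\exp\!\big(-Bt-(4tA)^{-1}|e^{tS}x-\xi|^2\big),$$ with the principal matrix power, and $T(0)v=v$. Let $C_{ub}$ be the space of bounded uniformly continuous functions $\mathbb R^d\to\mathbb C^N$, let $C_{ub}^1$ be the space of $C^1$ functions $v$ with $v,D_1v,\dots,D_dv\in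 C_{ub}$, and let $$C_{rub}=\{v\in C_{ub}:\ \lim_{t\to0}\sup_x|v(e^{-tS}x)-v(x)|=0\},$$ with the supremum norm. Let $(A_b,\mathcal D(A_b))$ be the infinitesimal generator of $(T(t))_{t\ge 0}$ on $C_{rub}$: $v\in\mathcal D(A_b)$ and $A_bv=w$ mean that $v,w\in C_{rub}$ and $(T(t)v-v)/t\to w$ uniformly on $\mathbb R^d$ as $t\downarrow0$. Let $0<\vartheta<1$ and $\lambda\in\mathbb C$ with $\operatorname{Re}\lambda>\omega_b$. Let $\theta\in C(\mathbb R^d,\mathbb R)$ be a radial weight function of exponential growth rate $\eta\ge0$, that is, $\theta(x)>0$, $\theta(x)$ depends only on $|x|$, and for some $C_\theta>0$ $$\theta(x+y)\le C_\theta\,\theta(x)\,e^{\eta|y|}\qquad\text{for all }x,y\in\mathbb R^d.$$ Suppose that $$\eta^2\le\vartheta\,\frac{a_0(\operatorname{Re}\lambda-\omega_b)}{a_{\max}^2}$$ and that there is $C>0$ with $\theta(x)\ge C$ for all $x$. Let $C_{b,\theta}$ be the space of continuous $v:\mathbb R^d\to\mathbb C^N$ with $\|v\|_{C_{b,\theta}}=\sup_x|\theta(x)v(x)|<\infty$,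 and $C_{b,\theta}^1$ the space of $C^1$ functions $v$ with $v,D_1v,\dots,D_dv\in C_{b,\theta}$. Let $g\in C_{rub}$. Then the resolvent equation $(\lambda I-A_b)v=g$ has a unique solution $v_\star\in\mathcal D(A_b)$, and $v_\star\in C_{rub}\cap C^1_{ub}$. If in addition $g\in C_{b,\theta}$, then $v_\star\in C_{rub}\cap C_{ub}^1\cap C^1_{b,\theta}$ and $$\|v_\star\|_{C_{b,\theta}}\le\frac{C_7}{\operatorname{Re}\lambda-\omega_b}\|g\|_{C_{b,\theta}},\qquad \|D_iv_\star\|_{C_{b,\theta}}\le\frac{C_8}{(\operatorname{Re}\lambda-\omega_b)^{1/2}}\|g\|_{C_{b,\theta}}\quad(i=1,\dots,d),$$ and for every $x\in\mathbb R^d$ $$|v_\star(x)|\le\frac{C_7}{\operatorname{Re}\lambda-\omega_b}\,\frac1{\theta(x)}\,\|g\|_{C_{b,\theta}},\qquad |D_iv_\star(x)|\le\frac{C_8}{(\operatorname{Re}\lambda-\omega_b)^{1/2}}\,\frac1{\theta(x)}\,\|g\|_{C_{b,\theta}}\quad(i=1,\dots,d).$$ The $\lambda$-independent constants are, with $q=\frac{\vartheta}{1-\vartheta}$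 and ${}_2F_1$ the Gauss hypergeometric function (analytically continued to $]-\infty,1[$), $$C_7=\frac{C_\theta\,\kappa\,a_1^{d/2}}{1-\vartheta}\Big({}_2F_1\big(-\tfrac{d-1}2,1;\tfrac12;-q\big)+\pi^{1/2}\tfrac{\Gamma(\frac{d+1}2)}{\Gamma(\frac d2)}\,q^{1/2}\,{}_2F_1\big(-\tfrac{d-2}2,\tfrac32;\tfrac32;-q\big)\Big),$$ $$C_8=\frac{C_\theta\,\kappa\,a_1^{(d+1)/2}\,\Gamma(\frac12)}{a_{\min}^{1/2}(1-\vartheta)^{1/2}}\Big(\tfrac{\Gamma(\frac{d+1}2)}{\Gamma(\frac d2)}\,{}_2F_1\big(-\tfrac d2,\tfrac12;\tfrac12;-q\big)+2\tfrac{\Gamma(\frac{d+2}2)}{\Gamma(\frac12)\Gamma(\frac d2)}\,q^{1/2}\,{}_2F_1\big(-\tfrac{d-1}2,1;\tfrac32;-q\big)\Big).$$ -/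

import Mathlib

open scoped NNReal Topology
open Filter MeasureTheory

noncomputable section

namespace OU

/-- The Euclidean space `ℝ^d`. -/
abbrev Rd (d : ℕ) := EuclideanSpace ℝ (Fin d)

/-- The Hermitian space `ℂ^N`. -/
abbrev CN (N : ℕ) := EuclideanSpace ℂ (Fin N)

/-! ### Matrix quantities -/

/-- `Y` is invertible and diagonalizes both `A` and `B`. -/
def SimDiagonalizable {N : ℕ} (A B Y : Matrix (Fin N) (Fin N) ℂ) : Prop :=
  IsUnit Y ∧ (Y⁻¹ * A * Y).IsDiag ∧ (Y⁻¹ * B * Y).IsDiag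

/-- The spectral radius `ρ(C)` as a real number. -/
def rho {N : ℕ} (C : Matrix (Fin N) (Fin N) ℂ) : ℝ := (spectralRadius ℂ C).toReal

/-- The spectral abscissa `s(C) = max_{z ∈ σ(C)} Re z`. -/
def abscissa {N : ℕ} (C : Matrix (Fin N) (Fin N) ℂ) : ℝ := sSup (Complex.re '' spectrum ℂ C)

/-- `a_min = ρ(A⁻¹)⁻¹`. -/
def aMin {N : ℕ} (A : Matrix (Fin N) (Fin N) ℂ) : ℝ := (rho A⁻¹)⁻¹

/-- `a_max = ρ(A)`. -/
def aMax {N : ℕ} (A : Matrix (Fin N) (Fin N) ℂ) : ℝ := rho A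

/-- `a_0 = -s(-A)`. -/
def aZero {N : ℕ} (A : Matrix (Fin N) (Fin N) ℂ) : ℝ := -abscissa (-A)

/-- `b_0 = -s(-B)`. -/
def bZero {N : ℕ} (B : Matrix (Fin N) (Fin N) ℂ) : ℝ := -abscissa (-B)

/-- `ω_b = -b_0`. -/
def omegaB {N : ℕ} (B : Matrix (Fin N) (Fin N) ℂ) : ℝ := -bZero B

/-- `a_1 = a_max² / (a_min a_0)`. -/
def aOne {N : ℕ} (A : Matrix (Fin N) (Fin N) ℂ) : ℝ := aMax A ^ 2 / (aMin A * aZero A)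

/-- The spectral norm of a matrix. -/
def specNorm {N : ℕ} (C : Matrix (Fin N) (Fin N) ℂ) : ℝ :=
  ‖Matrix.toEuclideanCLM (n := Fin N) (𝕜 := ℂ) C‖

/-- The condition number `|Y| |Y⁻¹|` in the spectral norm. -/
def cond {N : ℕ} (Y : Matrix (Fin N) (Fin N) ℂ) : ℝ := specNorm Y * specNorm Y⁻¹

open scoped Classical in
/-- The principal power `M ^ s` of a diagonalizable matrix: the value at `M` of any polynomial
which agrees with `z ↦ z ^ s` (principal branch) on the eigenvalues of `M`.  Thus
`(Y * diag(μ) * Y⁻¹) ^ s = Y * diag(μ ^ s) * Y⁻¹`. -/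
def matCPow {N : ℕ} (M : Matrix (Fin N) (Fin N) ℂ) (s : ℂ) : Matrix (Fin N) (Fin N) ℂ :=
  Polynomial.aeval M
    (Lagrange.interpolate M.charpoly.roots.toFinset (fun z : ℂ => z) (fun z : ℂ => z ^ s))

/-! ### The Ornstein-Uhlenbeck semigroup -/

/-- `rot S t x = e^{tS} x`. -/
def rot {d : ℕ} (S : Matrix (Fin d) (Fin d) ℝ) (t : ℝ) (x : Rd d) : Rd d :=
  WithLp.toLp 2 ((NormedSpace.exp (t • S)).mulVec x.ofLp)

/-- The heat kernel matrix
`H(x,ξ,t) = (4πtA)^{-d/2} exp(-Bt - (4tA)⁻¹ |e^{tS}x - ξ|²)`. -/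
def heatKernel {d N : ℕ} (A B : Matrix (Fin N) (Fin N) ℂ) (S : Matrix (Fin d) (Fin d) ℝ)
    (x ξ : Rd d) (t : ℝ) : Matrix (Fin N) (Fin N) ℂ :=
  matCPow ((4 * Real.pi * t : ℂ) • A) (-(d : ℂ) / 2) *
    NormedSpace.exp (-((t : ℂ) • B) -
      ((‖rot S t x - ξ‖ ^ 2 : ℝ) : ℂ) • ((4 * t : ℂ) • A)⁻¹)

/-- The operators `T(t)`: `[T(t)v](x) = ∫ H(x,ξ,t) v(ξ) dξ` for `t > 0` and `T(0)v = v`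
(only `t ≥ 0` is relevant). -/
def semigroup {d N : ℕ} (A B : Matrix (Fin N) (Fin N) ℂ) (S : Matrix (Fin d) (Fin d) ℝ)
    (t : ℝ) (v : Rd d → CN N) (x : Rd d) : CN N :=
  if 0 < t then ∫ ξ : Rd d, WithLp.toLp 2 ((heatKernel A B S x ξ t).mulVec (v ξ).ofLp)
  else v x

/-! ### Function spaces -/

/-- `v ∈ C_b(ℝ^d, ℂ^N)`. -/
def MemCb {d N : ℕ} (v : Rd d → CN N) : Prop :=
  Continuous v ∧ ∃ M : ℝ, ∀ x, ‖v x‖ ≤ M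

/-- `v ∈ C_ub(ℝ^d, ℂ^N)`. -/
def MemCub {d N : ℕ} (v : Rd d → CN N) : Prop :=
  MemCb v ∧ UniformContinuous v

/-- `v ∈ C_rub(ℝ^d, ℂ^N)`: moreover `sup_x |v(e^{-tS}x) - v(x)| → 0` as `t → 0`. -/
def MemCrub {d N : ℕ} (S : Matrix (Fin d) (Fin d) ℝ) (v : Rd d → CN N) : Prop :=
  MemCub v ∧ TendstoUniformly (fun (t : ℝ) (x : Rd d) => v (rot S (-t) x)) v (𝓝 0)

/-- The partial derivative `D_i v`. -/
def partialD {d N : ℕ} (i : Fin d) (v : Rd d → CN N) (x : Rd d) : CN N :=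
  fderiv ℝ v x (EuclideanSpace.single i 1)

/-- `v ∈ C^1_ub(ℝ^d, ℂ^N)`. -/
def MemC1ub {d N : ℕ} (v : Rd d → CN N) : Prop :=
  ContDiff ℝ 1 v ∧ MemCub v ∧ ∀ i, MemCub (partialD i v)

/-- `v ∈ C_{b,θ}(ℝ^d, ℂ^N)`. -/
def MemCbW {d N : ℕ} (θ : Rd d → ℝ) (v : Rd d → CN N) : Prop :=
  Continuous v ∧ BddAbove (Set.range fun x => ‖θ x • v x‖)

/-- `v ∈ C^1_{b,θ}(ℝ^d, ℂ^N)`. -/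
def MemC1bW {d N : ℕ} (θ : Rd d → ℝ) (v : Rd d → CN N) : Prop :=
  ContDiff ℝ 1 v ∧ MemCbW θ v ∧ ∀ i, MemCbW θ (partialD i v)

/-- The norm `sup_x |θ(x) v(x)|` of `C_{b,θ}(ℝ^d, ℂ^N)`. -/
def normCbW {d N : ℕ} (θ : Rd d → ℝ) (v : Rd d → CN N) : ℝ :=
  ⨆ x, ‖θ x • v x‖

/-- `θ` is a radial weight function of exponential growth rate `η`, with constant `Cθ` in the
growth estimate. -/
structure IsRadialWeight {d : ℕ} (θ : Rd d → ℝ) (η Cθ : ℝ) : Prop where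
  continuous : Continuous θ
  rate_nonneg : 0 ≤ η
  pos : ∀ x, 0 < θ x
  const_pos : 0 < Cθ
  growth : ∀ x y, θ (x + y) ≤ Cθ * θ x * Real.exp (η * ‖y‖)
  radial : ∃ φ : ℝ≥0 → ℝ, ∀ x, θ x = φ ‖x‖₊

/-! ### The generator and the resolvent equation -/

/-- The graph of the infinitesimal generator `A_b` of `T(t)` in `C_rub`: `v ∈ D(A_b)` and
`A_b v = w`, i.e. `(T(t)v - v)/t → w` in the sup norm as `t ↓ 0`, with `v, w ∈ C_rub`. -/
def GeneratorGraph {d N : ℕ} (A B : Matrix (Fin N) (Fin N) ℂ) (S : Matrix (Fin d) (Fin d) ℝ)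
    (v w : Rd d → CN N) : Prop :=
  MemCrub S v ∧ MemCrub S w ∧
    TendstoUniformly (fun (t : ℝ) (x : Rd d) => t⁻¹ • (semigroup A B S t v x - v x)) w (𝓝[>] 0)

/-- `v ∈ D(A_b)` and `(λ I - A_b) v = g`. -/
def SolvesResolvent {d N : ℕ} (A B : Matrix (Fin N) (Fin N) ℂ) (S : Matrix (Fin d) (Fin d) ℝ)
    (lam : ℂ) (g v : Rd d → CN N) : Prop :=
  ∃ w, GeneratorGraph A B S v w ∧ ∀ x, lam • v x - w x = g x

/-! ### The constants -/

/-- The Gauss hypergeometric function `₂F₁(a, b; c; z)` for real `z < 1`: the hypergeometric series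
if `|z| < 1`, and its analytic continuation
`(1 - z)^{-b} ₂F₁(c - a, b; c; z / (z - 1))` (Pfaff's formula) if `z ≤ -1`. -/
def hyp2F1 (a b c z : ℝ) : ℝ :=
  if |z| < 1 then ordinaryHypergeometric a b c z
  else (1 - z) ^ (-b) * ordinaryHypergeometric (c - a) b c (z / (z - 1))

/-- The constant `C_7`. -/
def constC7 (d : ℕ) {N : ℕ} (A Y : Matrix (Fin N) (Fin N) ℂ) (ϑ Cθ : ℝ) : ℝ :=
  Cθ * cond Y * aOne A ^ ((d : ℝ) / 2) * (1 / (1 - ϑ)) *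
    (hyp2F1 (-((d : ℝ) - 1) / 2) 1 (1 / 2) (-(ϑ / (1 - ϑ))) +
      Real.pi ^ ((1 : ℝ) / 2) * (Real.Gamma (((d : ℝ) + 1) / 2) / Real.Gamma ((d : ℝ) / 2)) *
        (ϑ / (1 - ϑ)) ^ ((1 : ℝ) / 2) *
        hyp2F1 (-((d : ℝ) - 2) / 2) (3 / 2) (3 / 2) (-(ϑ / (1 - ϑ))))

/-- The constant `C_8`. -/
def constC8 (d : ℕ) {N : ℕ} (A Y : Matrix (Fin N) (Fin N) ℂ) (ϑ Cθ : ℝ) : ℝ :=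
  Cθ * cond Y * aOne A ^ (((d : ℝ) + 1) / 2) *
    (Real.Gamma (1 / 2) / aMin A ^ ((1 : ℝ) / 2)) * (1 / (1 - ϑ)) ^ ((1 : ℝ) / 2) *
    (Real.Gamma (((d : ℝ) + 1) / 2) / Real.Gamma ((d : ℝ) / 2) *
        hyp2F1 (-(d : ℝ) / 2) (1 / 2) (1 / 2) (-(ϑ / (1 - ϑ))) +
      2 * (Real.Gamma (((d : ℝ) + 2) / 2) / (Real.Gamma (1 / 2) * Real.Gamma ((d : ℝ) / 2))) *
        (ϑ / (1 - ϑ)) ^ ((1 : ℝ) / 2) *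
        hyp2F1 (-((d : ℝ) - 1) / 2) 1 (3 / 2) (-(ϑ / (1 - ϑ))))

end OU

end

noncomputable section

namespace OU

/-! Substitute ξ = e^{tS}x - √t y in the kernel integral. Powers, inverses and exponentials of
matrices diagonalized by Y act on eigenvalues, so T(t)f(x) becomes ∑ⱼ Pⱼ e^{-t bⱼ} ∫ G_{aⱼ}(y)
f(e^{tS}x - √t y) dy, where Pⱼ are the spectral projections and G_α is a complex Gaussian of
integral one that does not depend on t (`SpectralData.semigroup_eq`). Thus T(t) averages the rigid
motions of f. The space C_rub consists of the functions on which rigid motions act strongly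
continuously (`MemCrub.exists_crub`, `memCrub_coe`), so these averages are Bochner integrals in the
Banach space `Crub`. Strong continuity is dominated convergence, and the semigroup law follows from
the convolution of Gaussians and their rotation invariance (`heatOp_add`, `expSemigroup_sum`). The
growth type is ω_b.

For such a semigroup the Laplace transform of the orbit of g is the resolvent: it solves the
equation (`ExpSemigroup.tendsto_laplace`), and any solution equals it (`ExpSemigroup.eq_laplace`).
Differentiating in x puts the derivative on the Gaussian at the cost of a factor t^{-1/2}, which is
integrable at 0. The partial derivatives of the resolvent are therefore again Laplace transforms of
averages of rigid motions, and lie in C_rub (`hasFDerivAt_laplace`).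

For the weighted bounds put K = a_max²/a_0 and w = Re λ - ω_b. All the Gaussians have the common
majorant (4π a_min)^{-d/2} exp(-|y|²/(4K)). Radiality of θ and orthogonality of e^{tS} give θ(x) ≤
C_θ θ(e^{tS}x - √t y) e^{η√t|y|}. Expanding the last exponential and integrating term by term in t
and y yields Gamma functions. The growth condition, in the form η²K ≤ ϑw, bounds the result by a
multiple of ∑ 2ⁿ ϑ^{n/2} Γ(r+n/2) Γ(p+n/2)/n! (`lintegral_weight_le`). Its even and odd parts are
Gauss series at ϑ, and Pfaff's transformation moves them to -ϑ/(1-ϑ) (`hasSum_Gamma_mul_Gamma`). The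
choice r = 1, p = d/2 gives C_7, and r = 1/2, p = (d+1)/2 gives C_8. -/

/-- A strongly continuous semigroup of operators of exponential type `ω`. -/
structure ExpSemigroup {X : Type*} [NormedAddCommGroup X] [NormedSpace ℂ X]
    (T : ℝ → X →L[ℂ] X) (M ω : ℝ) : Prop where
  zero : ∀ f, T 0 f = f
  add : ∀ s t, 0 ≤ s → 0 ≤ t → ∀ f, T (s + t) f = T s (T t f)
  bound : ∀ t, 0 ≤ t → ‖T t‖ ≤ M * Real.exp (ω * t)
  cont : ∀ f, Continuous fun t : ℝ => T (max t 0) f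

/-! ### Abstract semigroups: the resolvent as a Laplace transform. -/

section Resolvent

variable {X : Type*} [NormedAddCommGroup X] [NormedSpace ℂ X] {T : ℝ → X →L[ℂ] X} {M ω : ℝ}

/-- The integrand `e^{-λt} T(t) g` of the Laplace transform, frozen for negative `t`. -/
def laplaceOrbit (T : ℝ → X →L[ℂ] X) (lam : ℂ) (g : X) (t : ℝ) : X :=
  Complex.exp (-(lam * t)) • T (max t 0) g

theorem ExpSemigroup.continuous_laplaceOrbit (hT : ExpSemigroup T M ω) (lam : ℂ) (g : X) :
    Continuous (laplaceOrbit T lam g) := by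
  have := hT.cont g
  exact (by fun_prop : Continuous fun t : ℝ => Complex.exp (-(lam * t))).smul this

theorem ExpSemigroup.norm_laplaceOrbit_le (hT : ExpSemigroup T M ω) (lam : ℂ) (g : X) {t : ℝ}
    (ht : 0 ≤ t) : ‖laplaceOrbit T lam g t‖ ≤ M * ‖g‖ * Real.exp (-(lam.re - ω) * t) := by
  rw [laplaceOrbit, norm_smul, max_eq_left ht, Complex.norm_exp]
  have h1 : (-(lam * t)).re = -(lam.re * t) := by simp
  rw [h1]
  calc Real.exp (-(lam.re * t)) * ‖T t g‖
      ≤ Real.exp (-(lam.re * t)) * (M * Real.exp (ω * t) * ‖g‖) := by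
        gcongr
        exact (T t).le_of_opNorm_le (hT.bound t ht) g
    _ = M * ‖g‖ * (Real.exp (-(lam.re * t)) * Real.exp (ω * t)) := by ring
    _ = _ := by rw [← Real.exp_add]; congr 2; ring

theorem ExpSemigroup.integrableOn_laplaceOrbit (hT : ExpSemigroup T M ω) {lam : ℂ}
    (hlam : ω < lam.re) (g : X) : IntegrableOn (laplaceOrbit T lam g) (Set.Ioi 0) := by
  refine Integrable.mono' (g := fun t => M * ‖g‖ * Real.exp (-(lam.re - ω) * t))
    ((integrableOn_exp_mul_Ioi (by linarith) 0).const_mul _)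
    (hT.continuous_laplaceOrbit lam g).aestronglyMeasurable ?_
  exact (ae_restrict_mem measurableSet_Ioi).mono fun t ht => hT.norm_laplaceOrbit_le lam g (le_of_lt ht)

theorem ExpSemigroup.tendsto_laplaceOrbit (hT : ExpSemigroup T M ω) {lam : ℂ}
    (hlam : ω < lam.re) (g : X) : Tendsto (laplaceOrbit T lam g) atTop (𝓝 0) := by
  refine squeeze_zero_norm' ((eventually_ge_atTop 0).mono fun t ht =>
    hT.norm_laplaceOrbit_le lam g ht) ?_
  have h : Tendsto (fun t : ℝ => -(lam.re - ω) * t) atTop atBot :=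
    tendsto_id.const_mul_atTop_of_neg (by linarith)
  simpa using (Real.tendsto_exp_atBot.comp h).const_mul (M * ‖g‖)

variable [NormedSpace ℝ X] [IsScalarTower ℝ ℂ X] [CompleteSpace X]

/-- The Laplace transform of a semigroup. -/
def laplace (T : ℝ → X →L[ℂ] X) (lam : ℂ) (g : X) : X :=
  ∫ t in Set.Ioi (0 : ℝ), laplaceOrbit T lam g t

/-- Applying T(h) shifts the time variable, which leaves e^{λh} times the tail integral over (h, ∞).
-/
theorem ExpSemigroup.apply_laplace (hT : ExpSemigroup T M ω) {lam : ℂ}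
    (hlam : ω < lam.re) (g : X) {h : ℝ} (hh : 0 ≤ h) :
    T h (laplace T lam g) = Complex.exp (lam * h) •
      (laplace T lam g - ∫ t in (0 : ℝ)..h, laplaceOrbit T lam g t) := by
  have hint := hT.integrableOn_laplaceOrbit hlam g
  have h1 : T h (laplace T lam g) =
      ∫ t in Set.Ioi (0 : ℝ), Complex.exp (lam * h) • laplaceOrbit T lam g (t + h) := by
    rw [laplace, ← ContinuousLinearMap.integral_comp_comm _ hint]
    refine setIntegral_congr_fun measurableSet_Ioi fun t ht => ?_
    have ht : 0 ≤ t := le_of_lt ht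
    simp only [laplaceOrbit, max_eq_left ht, max_eq_left (add_nonneg ht hh), map_smul, smul_smul,
      ← Complex.exp_add]
    rw [add_comm t h, hT.add h t hh ht]
    congr 2
    push_cast
    ring
  have h2 : laplace T lam g - ∫ t in (0 : ℝ)..h, laplaceOrbit T lam g t =
      ∫ t in Set.Ioi h, laplaceOrbit T lam g t := by
    rw [laplace, sub_eq_iff_eq_add', intervalIntegral.integral_interval_add_Ioi hint
      (hint.mono_set (Set.Ioi_subset_Ioi hh))]
  rw [h1, h2, integral_smul]
  congr 1
  rw [← integral_indicator measurableSet_Ioi, ← integral_indicator measurableSet_Ioi]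
  conv_rhs => rw [← integral_add_right_eq_self _ h]
  congr 1 with t
  simp [Set.indicator_apply]

/-- By `apply_laplace`, h ↦ T(h)v agrees for h ≥ 0 with a function that is differentiable at 0,
whose derivative follows from the product rule and the fundamental theorem of calculus. -/
theorem ExpSemigroup.tendsto_laplace (hT : ExpSemigroup T M ω) {lam : ℂ}
    (hlam : ω < lam.re) (g : X) :
    Tendsto (fun h : ℝ => (h⁻¹ : ℝ) • (T h (laplace T lam g) - laplace T lam g)) (𝓝[>] 0)
      (𝓝 (lam • laplace T lam g - g)) := by
  set v := laplace T lam g with hv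
  set φ := laplaceOrbit T lam g with hφ
  have hφc : Continuous φ := hT.continuous_laplaceOrbit lam g
  have hφ0 : φ 0 = g := by simp [hφ, laplaceOrbit, hT.zero]
  have hd1 : HasDerivAt (fun h : ℝ => ∫ t in (0 : ℝ)..h, φ t) (φ 0) 0 :=
    intervalIntegral.integral_hasDerivAt_right (hφc.intervalIntegrable _ _)
      (hφc.stronglyMeasurableAtFilter _ _) hφc.continuousAt
  have hd2 : HasDerivAt (fun h : ℝ => Complex.exp (lam * h)) lam 0 := by
    have h0 : HasDerivAt (fun h : ℝ => lam * (h : ℂ)) lam 0 := by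
      simpa using (Complex.ofRealCLM.hasDerivAt (x := 0)).const_mul lam
    simpa using h0.cexp
  have hd3 : HasDerivAt (fun h : ℝ => Complex.exp (lam * h) • (v - ∫ t in (0 : ℝ)..h, φ t))
      (lam • v - g) 0 := by
    have := hd2.smul (hd1.const_sub v)
    simp only [Complex.ofReal_zero, mul_zero, Complex.exp_zero, one_smul,
      intervalIntegral.integral_same, sub_zero, hφ0] at this
    exact this.congr_deriv (by abel)
  have h4 := hd3.hasDerivWithinAt (s := Set.Ioi 0)
  rw [hasDerivWithinAt_iff_tendsto_slope' (by simp)] at h4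
  refine h4.congr' ?_
  filter_upwards [self_mem_nhdsWithin] with h hh
  rw [slope_def_module, hT.apply_laplace hlam g (le_of_lt hh), ← hv, ← hφ]
  simp

/-- The orbit e^{-λt}T(t)u has right derivative -e^{-λt}T(t)g and decays at infinity; integrating
over (0, ∞) recovers u. -/
theorem ExpSemigroup.eq_laplace (hT : ExpSemigroup T M ω) {lam : ℂ}
    (hlam : ω < lam.re) (g u : X)
    (hu : Tendsto (fun h : ℝ => (h⁻¹ : ℝ) • (T h u - u)) (𝓝[>] 0) (𝓝 (lam • u - g))) :
    u = laplace T lam g := by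
  -- The generator limit is one-sided, so only a right derivative is available; with continuity of
  -- the orbit this suffices for the fundamental theorem.
  have hder : ∀ t, 0 < t → HasDerivWithinAt (laplaceOrbit T lam u) (-laplaceOrbit T lam g t)
      (Set.Ioi t) t := by
    intro t ht
    have h1 : HasDerivWithinAt (fun s : ℝ => T (max s 0) u) (T t (lam • u - g)) (Set.Ioi t) t := by
      rw [hasDerivWithinAt_iff_tendsto_slope' (by simp)]
      have h2 : Tendsto (fun s : ℝ => s - t) (𝓝[>] t) (𝓝[>] 0) := by
        refine tendsto_nhdsWithin_of_tendsto_nhds_of_eventually_within _ ?_ ?_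
        · have : Tendsto (fun s : ℝ => s - t) (𝓝 t) (𝓝 (t - t)) :=
            (continuous_id.sub continuous_const).tendsto t
          rw [sub_self] at this
          exact this.mono_left nhdsWithin_le_nhds
        · filter_upwards [self_mem_nhdsWithin] with s hs
          simpa using hs
      refine (((T t).continuous.tendsto _).comp (hu.comp h2)).congr' ?_
      filter_upwards [self_mem_nhdsWithin] with s hs
      have hs : t < s := hs
      simp only [Function.comp, slope_def_module, max_eq_left ht.le, max_eq_left (ht.trans hs).le]
      have h3 := hT.add t (s - t) ht.le (sub_nonneg.2 hs.le) u
      rw [add_sub_cancel] at h3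
      rw [h3, ← map_sub]
      exact ((T t).restrictScalars ℝ).map_smul _ _
    have h0 : HasDerivAt (fun h : ℝ => Complex.exp (-(lam * h)))
        (Complex.exp (-(lam * t)) * (-lam)) t := by
      have : HasDerivAt (fun h : ℝ => -(lam * (h : ℂ))) (-lam) t := by
        have := ((Complex.ofRealCLM.hasDerivAt (x := t)).const_mul lam).neg
        rw [Complex.ofRealCLM_apply, Complex.ofReal_one, mul_one] at this
        exact this
      exact this.cexp
    refine (h0.hasDerivWithinAt.smul h1).congr_deriv ?_
    simp only [laplaceOrbit, max_eq_left ht.le, map_sub, map_smul]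
    module
  have hcu := hT.continuous_laplaceOrbit lam u
  have hcg := hT.continuous_laplaceOrbit lam g
  have hint : ∀ b : ℝ, 0 ≤ b → ∫ t in (0 : ℝ)..b, -laplaceOrbit T lam g t =
      laplaceOrbit T lam u b - u := by
    intro b hb
    rw [intervalIntegral.integral_eq_sub_of_hasDeriv_right hcu.continuousOn
      (fun t ht => hder t (by simpa [hb] using ht.1)) (hcg.neg.intervalIntegrable _ _)]
    simp [laplaceOrbit, hT.zero]
  have hlim1 := intervalIntegral_tendsto_integral_Ioi 0 (hT.integrableOn_laplaceOrbit hlam g)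
    tendsto_id
  have hlim2 : Tendsto (fun b : ℝ => ∫ t in (0 : ℝ)..b, laplaceOrbit T lam g t) atTop
      (𝓝 (u - 0)) := by
    refine ((tendsto_const_nhds (x := u)).sub (hT.tendsto_laplaceOrbit hlam u)).congr' ?_
    filter_upwards [eventually_ge_atTop 0] with b hb
    have := hint b hb
    rw [intervalIntegral.integral_neg] at this
    rw [← neg_sub, ← this, neg_neg]
  rw [sub_zero] at hlim2
  exact tendsto_nhds_unique hlim2 hlim1

end Resolvent

/-! ### Pochhammer symbols, Gauss series and Pfaff's transformation. -/

section Hypergeometric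

theorem hasSum_of_eq {f g : ℕ → ℝ} {a b : ℝ} (h : HasSum f a) (hf : ∀ n, g n = f n)
    (hab : b = a) : HasSum g b := by
  rw [funext hf, hab]; exact h

/-- The Pochhammer symbol `(a)_n = a (a + 1) ⋯ (a + n - 1)`. -/
def poch (a : ℝ) (n : ℕ) : ℝ := (ascPochhammer ℝ n).eval a

theorem poch_zero (a : ℝ) : poch a 0 = 1 := by simp [poch]

theorem poch_succ (a : ℝ) (n : ℕ) : poch a (n + 1) = poch a n * (a + n) :=
  ascPochhammer_succ_eval n a

theorem poch_succ_left (a : ℝ) (n : ℕ) : poch a (n + 1) = a * poch (a + 1) n := by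
  simp [poch, ascPochhammer_succ_left]

theorem poch_pos {a : ℝ} (ha : 0 < a) (n : ℕ) : 0 < poch a n := ascPochhammer_pos n a ha

theorem poch_add (a : ℝ) (k m : ℕ) : poch a (k + m) = poch a k * poch (a + k) m := by
  induction m with
  | zero => simp [poch_zero]
  | succ m ih => rw [← add_assoc, poch_succ, ih, poch_succ]; push_cast; ring

theorem abs_poch_le (a : ℝ) (n : ℕ) : |poch a n| ≤ poch (|a| + 1) n := by
  induction n with
  | zero => simp [poch_zero]
  | succ n ih =>
    rw [poch_succ, poch_succ, abs_mul]
    have h1 : |a + n| ≤ |a| + 1 + n := by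
      refine (abs_add_le _ _).trans ?_
      rw [Nat.abs_cast]
      linarith
    have h2 := (poch_pos (by positivity : 0 < |a| + 1) n).le
    gcongr

theorem Gamma_add_natCast_eq_poch {x : ℝ} (hx : 0 < x) (k : ℕ) :
    Real.Gamma (x + k) = poch x k * Real.Gamma x := by
  induction k with
  | zero => simp [poch_zero]
  | succ k ih =>
    have : x + ((k + 1 : ℕ) : ℝ) = (x + k) + 1 := by push_cast; ring
    rw [this, Real.Gamma_add_one (by positivity), ih, poch_succ]
    ring

theorem factorial_two_mul_eq_poch (k : ℕ) :
    ((2 * k).factorial : ℝ) = 4 ^ k * k.factorial * poch (1 / 2) k := by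
  induction k with
  | zero => simp [poch_zero]
  | succ k ih =>
    rw [show 2 * (k + 1) = 2 * k + 1 + 1 by ring, Nat.factorial_succ, Nat.factorial_succ,
      Nat.factorial_succ, poch_succ]
    push_cast
    rw [ih]
    ring

theorem factorial_two_mul_add_one_eq_poch (k : ℕ) :
    ((2 * k + 1).factorial : ℝ) = 4 ^ k * k.factorial * poch (3 / 2) k := by
  induction k with
  | zero => simp [poch_zero]
  | succ k ih =>
    rw [show 2 * (k + 1) + 1 = 2 * k + 1 + 1 + 1 by ring, Nat.factorial_succ, Nat.factorial_succ,
      Nat.factorial_succ k, poch_succ]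
    push_cast
    rw [ih]
    ring

/-- The Chu-Vandermonde identity. -/
theorem sum_choose_mul_poch (n : ℕ) (a c : ℝ) :
    ∑ k ∈ Finset.range (n + 1), (n.choose k : ℝ) * ((-1) ^ k * poch a k * poch (c + k) (n - k)) =
      poch (c - a) n := by
  induction n generalizing c with
  | zero => simp [poch_zero]
  | succ n ih =>
    -- Pascal's rule splits the sum in two; term by term the halves share the factor (c+1+k)_{n-k}
    -- and combine through (c+k) - (a+k) = c - a.
    have := Finset.sum_choose_succ_mul
      (fun k l => ((-1) ^ k * poch a k * poch (c + k) l : ℝ)) n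
    rw [this, poch_succ_left, show c - a + 1 = (c + 1) - a by ring, ← ih (c + 1), Finset.mul_sum,
      ← Finset.sum_add_distrib]
    refine Finset.sum_congr rfl fun k hk => ?_
    have hk : k ≤ n := Nat.lt_succ_iff.1 (Finset.mem_range.1 hk)
    rw [Nat.succ_sub hk, poch_succ_left, poch_succ, pow_succ]
    push_cast
    rw [show c + (k : ℝ) + 1 = c + 1 + k by ring, show c + ((k : ℝ) + 1) = c + 1 + k by ring]
    ring

/-- The binomial series. -/
theorem hasSum_poch_div_factorial (b : ℝ) {x : ℝ} (hx : |x| < 1) :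
    HasSum (fun m : ℕ => poch b m / m.factorial * x ^ m) (1 / (1 - x) ^ b) := by
  have h := (Real.one_div_one_sub_rpow_hasFPowerSeriesOnBall_zero b).hasSum (y := x)
    (by simpa [← ofReal_norm] using hx)
  rw [zero_add] at h
  refine hasSum_of_eq h (fun m => ?_) rfl
  rw [FormalMultilinearSeries.ofScalars_apply_eq, ← Ring.multichoose_eq, poch,
    ← Polynomial.ascPochhammer_smeval_eq_eval, ← Ring.factorial_nsmul_multichoose_eq_ascPochhammer,
    nsmul_eq_mul, smul_eq_mul]
  field_simp

/-- The parameter a may be a nonpositive integer, which the radius formula excludes; |(a)_n| ≤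
(|a|+1)_n gives a majorant with positive parameters and radius one. -/
theorem summable_hypergeometric (a b c : ℝ) (hb : 0 < b) (hc : 0 < c) {x : ℝ} (hx : |x| < 1) :
    Summable fun n : ℕ => |poch a n| * poch b n / (poch c n * n.factorial) * |x| ^ n := by
  have hrad := ordinaryHypergeometricSeries_radius_eq_one (𝔸 := ℝ) (|a| + 1) b c (fun k => by
    have : (0 : ℝ) ≤ k := k.cast_nonneg
    have := abs_nonneg a
    refine ⟨?_, ?_, ?_⟩ <;> linarith)
  have hs := (ordinaryHypergeometricSeries ℝ (|a| + 1) b c).summable_norm_apply (x := x)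
    (by rw [hrad]; simpa [← ofReal_norm] using hx)
  refine Summable.of_nonneg_of_le (fun n => ?_) (fun n => ?_) hs
  · have := poch_pos hb n
    have := poch_pos hc n
    positivity
  · have hb := poch_pos hb n
    have hc := poch_pos hc n
    have ha := poch_pos (by positivity : 0 < |a| + 1) n
    have h := abs_poch_le a n
    rw [ordinaryHypergeometricSeries_apply_eq]
    change _ ≤ ‖((n.factorial : ℝ)⁻¹ * poch (|a| + 1) n * poch b n * (poch c n)⁻¹) • x ^ n‖
    have e : (0 : ℝ) < (n.factorial : ℝ)⁻¹ * poch (|a| + 1) n * poch b n * (poch c n)⁻¹ := by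
      have : (0 : ℝ) < n.factorial := by positivity
      exact mul_pos (mul_pos (mul_pos (inv_pos.2 this) ha) hb) (inv_pos.2 hc)
    rw [norm_smul, norm_pow, Real.norm_eq_abs, Real.norm_eq_abs, abs_of_pos e]
    refine mul_le_mul_of_nonneg_right ?_ (by positivity)
    calc |poch a n| * poch b n / (poch c n * n.factorial)
        ≤ poch (|a| + 1) n * poch b n / (poch c n * n.factorial) := by gcongr
      _ = _ := by field_simp

theorem hasSum_ordinaryHypergeometric (a b c : ℝ) (hb : 0 < b) (hc : 0 < c) {x : ℝ}
    (hx : |x| < 1) :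
    HasSum (fun n : ℕ => poch a n * poch b n / (poch c n * n.factorial) * x ^ n)
      (ordinaryHypergeometric a b c x) := by
  have h1 : Summable (fun n : ℕ => poch a n * poch b n / (poch c n * n.factorial) * x ^ n) := by
    refine Summable.of_norm_bounded (summable_hypergeometric a b c hb hc hx) fun n => ?_
    have hb := poch_pos hb n
    have hc := poch_pos hc n
    rw [norm_mul, norm_pow, norm_div, norm_mul, Real.norm_eq_abs, Real.norm_eq_abs,
      Real.norm_eq_abs, Real.norm_eq_abs, abs_of_pos hb, abs_of_pos (by positivity : 0 < poch c n * _)]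
  convert h1.hasSum using 1
  rw [ordinaryHypergeometric_eq_tsum]
  refine tsum_congr fun n => ?_
  simp only [poch, smul_eq_mul]
  field_simp

/-- Pfaff's transformation. -/
theorem pfaff_transformation (a b c : ℝ) (hb : 0 < b) (hc : 0 < c) {t : ℝ} (ht0 : 0 ≤ t)
    (ht : t < 1 / 2) :
    HasSum (fun n : ℕ => poch (c - a) n * poch b n / (poch c n * n.factorial) * t ^ n)
      ((1 / (1 - t)) ^ b * ordinaryHypergeometric a b c (-(t / (1 - t)))) := by
  have h1t : 0 < 1 - t := by linarith
  have hq : |-(t / (1 - t))| < 1 := by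
    rw [abs_neg, abs_of_nonneg (by positivity), div_lt_one h1t]; linarith
  -- Expanding (1-t)^{-b-k} by the binomial series turns the k-th term at -t/(1-t) into the k-th row
  -- of F. The double series converges absolutely because t < 1/2 makes |t/(1-t)| < 1.
  set F : ℕ × ℕ → ℝ := fun p => poch a p.1 * poch b (p.1 + p.2) /
    (poch c p.1 * p.1.factorial * p.2.factorial) * (-1) ^ p.1 * t ^ (p.1 + p.2) with hF
  have hrow : ∀ k : ℕ, HasSum (fun m => F (k, m)) ((1 / (1 - t)) ^ b *
      (poch a k * poch b k / (poch c k * k.factorial) * (-(t / (1 - t))) ^ k)) := by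
    intro k
    have h := (hasSum_poch_div_factorial (b + k) (x := t) (by rw [abs_of_nonneg ht0]; linarith)).mul_left
      (poch a k * poch b k / (poch c k * k.factorial) * (-1) ^ k * t ^ k)
    have hc := poch_pos hc k
    refine hasSum_of_eq h (fun m => ?_) ?_
    · simp only [hF, poch_add b k m, pow_add]
      field_simp
    · rw [Real.rpow_add h1t, Real.rpow_natCast, Real.div_rpow zero_le_one h1t.le, Real.one_rpow,
        neg_pow, div_pow]
      field_simp
  have hrow' : ∀ k : ℕ, HasSum (fun m => ‖F (k, m)‖) ((1 / (1 - t)) ^ b *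
      (|poch a k| * poch b k / (poch c k * k.factorial) * |(-(t / (1 - t)))| ^ k)) := by
    intro k
    have h := (hasSum_poch_div_factorial (b + k) (x := t) (by rw [abs_of_nonneg ht0]; linarith)).mul_left
      (|poch a k| * poch b k / (poch c k * k.factorial) * t ^ k)
    have hc := poch_pos hc k
    refine hasSum_of_eq h (fun m => ?_) ?_
    · have hb := poch_pos hb k
      have hb' := poch_pos (by positivity : 0 < b + k) m
      simp only [hF, poch_add b k m, pow_add, norm_mul, norm_div, norm_pow, Real.norm_eq_abs,
        abs_neg, abs_one, one_pow, abs_of_pos hb, abs_of_pos hb', abs_of_pos hc, Nat.abs_cast,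
        abs_of_nonneg ht0]
      field_simp
    · rw [Real.rpow_add h1t, Real.rpow_natCast, Real.div_rpow zero_le_one h1t.le, Real.one_rpow,
        abs_neg, abs_of_nonneg (by positivity : 0 ≤ t / (1 - t)), div_pow]
      field_simp
  have hsum : Summable F := by
    refine Summable.of_norm ?_
    rw [summable_prod_of_nonneg fun _ => norm_nonneg _]
    refine ⟨fun k => (hrow' k).summable, ?_⟩
    simp only [fun k => (hrow' k).tsum_eq]
    exact (summable_hypergeometric a b c hb hc hq).mul_left _
  have hval : HasSum F ((1 / (1 - t)) ^ b * ordinaryHypergeometric a b c (-(t / (1 - t)))) := by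
    have h1 := (hasSum_ordinaryHypergeometric a b c hb hc hq).mul_left ((1 / (1 - t)) ^ b)
    have h2 := hsum.hasSum.prod_fiberwise hrow
    rw [h1.unique h2]
    exact hsum.hasSum
  -- Regrouped by total degree k + m = n, the coefficient of tⁿ is a Chu-Vandermonde sum.
  rw [← Finset.HasAntidiagonal.sigmaAntidiagonalEquivProd.hasSum_iff] at hval
  refine hasSum_of_eq (hval.sigma (fun n => (hasSum_fintype _))) (fun n => ?_) rfl
  have hcn := poch_pos hc n
  rw [Finset.univ_eq_attach]
  change _ = ∑ x ∈ (Finset.HasAntidiagonal.antidiagonal n).attach, F x.1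
  rw [Finset.sum_attach _ (fun p => F p), Finset.Nat.sum_antidiagonal_eq_sum_range_succ_mk,
    ← sum_choose_mul_poch n a c, Finset.sum_mul, Finset.sum_div, Finset.sum_mul]
  refine Finset.sum_congr rfl fun k hk => ?_
  have hk : k ≤ n := Nat.lt_succ_iff.1 (Finset.mem_range.1 hk)
  have h4 := poch_add c k (n - k)
  have h5 := Nat.cast_choose ℝ hk
  have hck := poch_pos hc k
  have hck' := poch_pos (by positivity : 0 < c + k) (n - k)
  rw [Nat.add_sub_cancel' hk] at h4
  simp only [hF, Nat.add_sub_cancel' hk]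
  rw [h4, h5]
  field_simp

/-- For t < 1/2 the argument lies in the unit disc and this is Pfaff's theorem; for t ≥ 1/2 the
continuation is defined by Pfaff's formula, and the prefactors cancel. -/
theorem hasSum_hyp2F1 (a b c : ℝ) (hb : 0 < b) (hc : 0 < c) {t : ℝ} (ht0 : 0 ≤ t) (ht : t < 1) :
    HasSum (fun n : ℕ => poch (c - a) n * poch b n / (poch c n * n.factorial) * t ^ n)
      ((1 / (1 - t)) ^ b * hyp2F1 a b c (-(t / (1 - t)))) := by
  have h1t : 0 < 1 - t := by linarith
  unfold hyp2F1
  split_ifs with h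
  · refine pfaff_transformation a b c hb hc ht0 ?_
    rw [abs_neg, abs_of_nonneg (by positivity), div_lt_one h1t] at h
    linarith
  · have e1 : 1 - -(t / (1 - t)) = 1 / (1 - t) := by field_simp; ring
    have e2 : -(t / (1 - t)) / (-(t / (1 - t)) - 1) = t := by
      rw [show -(t / (1 - t)) - 1 = - (1 / (1 - t)) by linarith]
      field_simp
    rw [e1, e2, ← mul_assoc, ← Real.rpow_add (by positivity), add_neg_cancel, Real.rpow_zero,
      one_mul]
    exact hasSum_ordinaryHypergeometric _ b c hb hc (by rwa [abs_of_nonneg ht0])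

/-- Split by the parity of n. The duplication formulas (2k)! = 4^k k! (1/2)_k and (2k+1)! = 4^k k!
(3/2)_k absorb 2ⁿ and make the two parts Gauss series with c = 1/2 and c = 3/2. -/
theorem hasSum_Gamma_mul_Gamma (p r : ℝ) (hp : 0 < p) (hr : 0 < r) {t : ℝ} (ht0 : 0 < t)
    (ht : t < 1) :
    HasSum (fun n : ℕ => 2 ^ n * t ^ ((n : ℝ) / 2) * Real.Gamma (r + n / 2) *
        Real.Gamma (p + n / 2) / n.factorial)
      (Real.Gamma r * Real.Gamma p *
          ((1 / (1 - t)) ^ r * hyp2F1 (1 / 2 - p) r (1 / 2) (-(t / (1 - t)))) +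
        2 * t ^ ((1 : ℝ) / 2) * Real.Gamma (r + 1 / 2) * Real.Gamma (p + 1 / 2) *
          ((1 / (1 - t)) ^ (r + 1 / 2) *
            hyp2F1 (1 - p) (r + 1 / 2) (3 / 2) (-(t / (1 - t))))) := by
  have he := (hasSum_hyp2F1 (1 / 2 - p) r (1 / 2) hr (by norm_num) ht0.le ht).mul_left
    (Real.Gamma r * Real.Gamma p)
  have ho := (hasSum_hyp2F1 (1 - p) (r + 1 / 2) (3 / 2) (by positivity) (by norm_num) ht0.le
    ht).mul_left (2 * t ^ ((1 : ℝ) / 2) * Real.Gamma (r + 1 / 2) * Real.Gamma (p + 1 / 2))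
  refine HasSum.even_add_odd ?_ ?_
  · refine hasSum_of_eq he (fun k => ?_) rfl
    have e : ((2 * k : ℕ) : ℝ) / 2 = k := by push_cast; ring
    have h1 := poch_pos (by norm_num : (0 : ℝ) < 1 / 2) k
    have h4 : (2 : ℝ) ^ (2 * k) = 4 ^ k := by rw [pow_mul]; norm_num
    rw [e, Gamma_add_natCast_eq_poch hr, Gamma_add_natCast_eq_poch hp, factorial_two_mul_eq_poch,
      Real.rpow_natCast, sub_sub_cancel, h4]
    field_simp
  · refine hasSum_of_eq ho (fun k => ?_) rfl
    have e : ((2 * k + 1 : ℕ) : ℝ) / 2 = 1 / 2 + k := by push_cast; ring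
    have h1 := poch_pos (by norm_num : (0 : ℝ) < 3 / 2) k
    have h4 : (2 : ℝ) ^ (2 * k + 1) = 2 * 4 ^ k := by rw [pow_succ, pow_mul]; norm_num; ring
    rw [e, ← add_assoc, ← add_assoc, Gamma_add_natCast_eq_poch (by positivity),
      Gamma_add_natCast_eq_poch (by positivity), factorial_two_mul_add_one_eq_poch,
      Real.rpow_add ht0, Real.rpow_natCast, show 3 / 2 - (1 - p) = p + 1 / 2 by ring, h4]
    field_simp

end Hypergeometric

/-! ### Gaussian moments and the weighted space-time integral. -/

section GaussianMoments

/-- Integrability is automatic: a non-integrable function has Bochner integral 0 by convention,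
which a positive value rules out. -/
theorem lintegral_ofReal_eq_of_integral_pos {α : Type*} [MeasurableSpace α] {μ : Measure α}
    {f : α → ℝ} {a : ℝ} (hf : 0 ≤ᵐ[μ] f) (h : ∫ x, f x ∂μ = a) (ha : 0 < a) :
    ∫⁻ x, ENNReal.ofReal (f x) ∂μ = ENNReal.ofReal a := by
  have hi : Integrable f μ := by
    by_contra hn
    rw [integral_undef hn] at h
    exact ha.ne h
  rw [← ofReal_integral_eq_lintegral_ofReal hi hf, h]

/-- Polar coordinates reduce this to a one-dimensional Gamma integral; the volume of the unit ball
supplies the remaining Gamma factor. -/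
theorem integral_norm_pow_mul_exp {d : ℕ} (hd : 0 < d) (n : ℕ) {K : ℝ} (hK : 0 < K) :
    ∫ y : Rd d, ‖y‖ ^ n * Real.exp (-‖y‖ ^ 2 / (4 * K)) =
      (4 * K) ^ (((d : ℝ) + n) / 2) * Real.pi ^ ((d : ℝ) / 2) * Real.Gamma (((d : ℝ) + n) / 2) /
        Real.Gamma ((d : ℝ) / 2) := by
  have : Nonempty (Fin d) := ⟨⟨0, hd⟩⟩
  have : Nontrivial (Rd d) := inferInstance
  have hd' : (0 : ℝ) < d := by exact_mod_cast hd
  have h1 := integral_fun_norm_addHaar (volume : Measure (Rd d))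
    (fun s : ℝ => s ^ n * Real.exp (-s ^ 2 / (4 * K)))
  rw [h1, finrank_euclideanSpace_fin]
  have h2 : (volume : Measure (Rd d)).real (Metric.ball 0 1) =
      Real.pi ^ ((d : ℝ) / 2) / Real.Gamma ((d : ℝ) / 2 + 1) := by
    rw [Measure.real, EuclideanSpace.volume_ball, ENNReal.toReal_mul, ENNReal.toReal_ofReal]
    · rw [Fintype.card_fin, Real.sqrt_eq_rpow, ← Real.rpow_natCast, ← Real.rpow_mul Real.pi_pos.le]
      simp
      congr 1
      ring_nf
    · have := Real.Gamma_pos_of_pos (by positivity : (0 : ℝ) < (Fintype.card (Fin d) : ℝ) / 2 + 1)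
      positivity
  have h3 : ∫ s in Set.Ioi (0 : ℝ), s ^ (d - 1) • (s ^ n * Real.exp (-s ^ 2 / (4 * K))) =
      (4 * K) ^ (((d : ℝ) + n) / 2) * (1 / 2) * Real.Gamma (((d : ℝ) + n) / 2) := by
    have hn : (0 : ℝ) ≤ n := n.cast_nonneg
    have h := integral_rpow_mul_exp_neg_mul_rpow (p := 2) (q := (d : ℝ) + n - 1)
      (b := 1 / (4 * K)) two_pos (by linarith) (by positivity)
    have e : ((d : ℝ) + n - 1 + 1) / 2 = ((d : ℝ) + n) / 2 := by ring
    have e' : -((d : ℝ) + n - 1 + 1) / 2 = -(((d : ℝ) + n) / 2) := by ring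
    rw [e', e, Real.rpow_neg (by positivity), one_div (4 * K), Real.inv_rpow (by positivity),
      inv_inv] at h
    rw [← h]
    refine setIntegral_congr_fun measurableSet_Ioi fun s hs => ?_
    have hs : 0 < s := hs
    have e2 : (d : ℝ) + n - 1 = ((d - 1 + n : ℕ) : ℝ) := by
      push_cast [Nat.cast_sub (Nat.one_le_iff_ne_zero.2 hd.ne')]
      ring
    simp only [e2, Real.rpow_natCast, Real.rpow_two, smul_eq_mul, pow_add]
    rw [mul_assoc]
    congr 3
    field_simp
  have hG := Real.Gamma_pos_of_pos (by positivity : (0 : ℝ) < (d : ℝ) / 2)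
  rw [h2, h3, Real.Gamma_add_one (by positivity), nsmul_eq_mul, smul_eq_mul]
  field_simp

theorem lintegral_norm_pow_mul_exp {d : ℕ} (hd : 0 < d) (n : ℕ) {K : ℝ} (hK : 0 < K) :
    ∫⁻ y : Rd d, ENNReal.ofReal (‖y‖ ^ n * Real.exp (-‖y‖ ^ 2 / (4 * K))) =
      ENNReal.ofReal ((4 * K) ^ (((d : ℝ) + n) / 2) * Real.pi ^ ((d : ℝ) / 2) *
        Real.Gamma (((d : ℝ) + n) / 2) / Real.Gamma ((d : ℝ) / 2)) := by
  have hd' : (0 : ℝ) < d := by exact_mod_cast hd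
  refine lintegral_ofReal_eq_of_integral_pos (Eventually.of_forall fun y => by positivity)
    (integral_norm_pow_mul_exp hd n hK) ?_
  have := Real.Gamma_pos_of_pos (by positivity : (0 : ℝ) < (d : ℝ) / 2)
  have := Real.Gamma_pos_of_pos (by positivity : (0 : ℝ) < ((d : ℝ) + n) / 2)
  positivity

theorem integrable_norm_pow_mul_exp {d : ℕ} (hd : 0 < d) (n : ℕ) {K : ℝ} (hK : 0 < K) :
    Integrable fun y : Rd d => ‖y‖ ^ n * Real.exp (-‖y‖ ^ 2 / (4 * K)) := by
  have hd' : (0 : ℝ) < d := by exact_mod_cast hd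
  by_contra hn
  have h := integral_norm_pow_mul_exp hd n hK
  rw [integral_undef hn] at h
  have := Real.Gamma_pos_of_pos (by positivity : (0 : ℝ) < (d : ℝ) / 2)
  have := Real.Gamma_pos_of_pos (by positivity : (0 : ℝ) < ((d : ℝ) + n) / 2)
  have : 0 < (4 * K) ^ (((d : ℝ) + n) / 2) * Real.pi ^ ((d : ℝ) / 2) *
        Real.Gamma (((d : ℝ) + n) / 2) / Real.Gamma ((d : ℝ) / 2) := by positivity
  exact this.ne h

theorem lintegral_rpow_mul_exp_neg {a w : ℝ} (ha : 0 < a) (hw : 0 < w) :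
    ∫⁻ t in Set.Ioi (0 : ℝ), ENNReal.ofReal (t ^ (a - 1) * Real.exp (-(w * t))) =
      ENNReal.ofReal ((1 / w) ^ a * Real.Gamma a) := by
  refine lintegral_ofReal_eq_of_integral_pos ?_ (Real.integral_rpow_mul_exp_neg_mul_Ioi ha hw) ?_
  · filter_upwards [ae_restrict_mem measurableSet_Ioi] with t ht
    have : 0 < t := ht
    positivity
  · have := Real.Gamma_pos_of_pos ha
    positivity

theorem integrableOn_rpow_mul_exp_neg {a w : ℝ} (ha : 0 < a) (hw : 0 < w) :
    IntegrableOn (fun t : ℝ => t ^ (a - 1) * Real.exp (-(w * t))) (Set.Ioi 0) := by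
  by_contra hn
  have h := Real.integral_rpow_mul_exp_neg_mul_Ioi ha hw
  rw [integral_undef hn] at h
  have := Real.Gamma_pos_of_pos ha
  have : 0 < (1 / w) ^ a * Real.Gamma a := by positivity
  exact this.ne h

/-- The growth condition enters only here, as (η²K/w)^{n/2} ≤ ϑ^{n/2}; the factor 2ⁿ comes from
(4K)^{n/2}. -/
theorem weight_coeff_le {d m n : ℕ} (hd : 0 < d) {K w η ϑ r : ℝ} (hK : 0 < K) (hw : 0 < w)
    (hη0 : 0 ≤ η) (hη : η ^ 2 * K ≤ ϑ * w) (hr : 0 < r) :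
    η ^ n / n.factorial * ((1 / w) ^ (r + n / 2) * Real.Gamma (r + n / 2)) *
      ((4 * K) ^ (((d : ℝ) + (m + n : ℕ)) / 2) * Real.pi ^ ((d : ℝ) / 2) *
        Real.Gamma (((d : ℝ) + (m + n : ℕ)) / 2) / Real.Gamma ((d : ℝ) / 2)) ≤
    (1 / w) ^ r * Real.pi ^ ((d : ℝ) / 2) * (4 * K) ^ (((d : ℝ) + m) / 2) /
      Real.Gamma ((d : ℝ) / 2) * (2 ^ n * ϑ ^ ((n : ℝ) / 2) * Real.Gamma (r + n / 2) *
        Real.Gamma (((d : ℝ) + m) / 2 + n / 2) / n.factorial) := by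
  have hd' : (0 : ℝ) < d := by exact_mod_cast hd
  have hG := Real.Gamma_pos_of_pos (by positivity : (0 : ℝ) < (d : ℝ) / 2)
  have hG1 := Real.Gamma_pos_of_pos (by positivity : (0 : ℝ) < r + n / 2)
  have hG2 := Real.Gamma_pos_of_pos (by positivity : (0 : ℝ) < ((d : ℝ) + m) / 2 + n / 2)
  have e1 : ((d : ℝ) + (m + n : ℕ)) / 2 = ((d : ℝ) + m) / 2 + n / 2 := by push_cast; ring
  have e2 : (4 * K) ^ ((n : ℝ) / 2) = 2 ^ n * K ^ ((n : ℝ) / 2) := by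
    rw [Real.mul_rpow (by norm_num) hK.le, show (4 : ℝ) = 2 ^ (2 : ℝ) by norm_num,
      ← Real.rpow_mul (by norm_num), ← Real.rpow_natCast]
    congr 2
    ring
  have e3 : η ^ n = (η ^ 2) ^ ((n : ℝ) / 2) := by
    rw [← Real.rpow_natCast, ← Real.rpow_natCast, ← Real.rpow_mul hη0]
    congr 1
    push_cast
    ring
  have key : η ^ n * (1 / w) ^ ((n : ℝ) / 2) * K ^ ((n : ℝ) / 2) ≤ ϑ ^ ((n : ℝ) / 2) := by
    rw [e3, ← Real.mul_rpow (by positivity) (by positivity),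
      ← Real.mul_rpow (by positivity) (by positivity)]
    refine Real.rpow_le_rpow (by positivity) ?_ (by positivity)
    rw [mul_one_div, div_mul_eq_mul_div, div_le_iff₀ hw]
    exact hη
  rw [e1, Real.rpow_add (by positivity), Real.rpow_add (by positivity), e2]
  calc _ = (1 / w) ^ r * Real.pi ^ ((d : ℝ) / 2) * (4 * K) ^ (((d : ℝ) + m) / 2) /
      Real.Gamma ((d : ℝ) / 2) * (2 ^ n * (η ^ n * (1 / w) ^ ((n : ℝ) / 2) * K ^ ((n : ℝ) / 2)) *
        Real.Gamma (r + n / 2) *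
        Real.Gamma (((d : ℝ) + m) / 2 + n / 2) / n.factorial) := by ring
    _ ≤ _ := by gcongr

/-- Expanding exp(η√t|y|) in powers separates t from y in each term. All terms are nonnegative, so
sums and integrals may be exchanged freely as extended nonnegative quantities. -/
theorem lintegral_weight_le {d m : ℕ} (hd : 0 < d) {K w η ϑ r s : ℝ} (hK : 0 < K) (hw : 0 < w)
    (hη0 : 0 ≤ η) (hη : η ^ 2 * K ≤ ϑ * w) (hϑ : 0 < ϑ) (hr : 0 < r)
    (hs : HasSum (fun n : ℕ => 2 ^ n * ϑ ^ ((n : ℝ) / 2) * Real.Gamma (r + n / 2) *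
        Real.Gamma (((d : ℝ) + m) / 2 + n / 2) / n.factorial) s) :
    ∫⁻ t in Set.Ioi (0 : ℝ), ∫⁻ y : Rd d, ENNReal.ofReal (t ^ (r - 1) * Real.exp (-(w * t)) *
      (‖y‖ ^ m * Real.exp (η * (√t * ‖y‖)) * Real.exp (-‖y‖ ^ 2 / (4 * K)))) ≤
    ENNReal.ofReal ((1 / w) ^ r * Real.pi ^ ((d : ℝ) / 2) * (4 * K) ^ (((d : ℝ) + m) / 2) /
      Real.Gamma ((d : ℝ) / 2) * s) := by
  have hd' : (0 : ℝ) < d := by exact_mod_cast hd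
  set f : ℕ → ℝ → ℝ := fun n t => t ^ (r + n / 2 - 1) * Real.exp (-(w * t)) with hf
  set h : ℕ → Rd d → ℝ := fun n y => ‖y‖ ^ (m + n) * Real.exp (-‖y‖ ^ 2 / (4 * K)) with hh
  have hh0 : ∀ n y, 0 ≤ h n y := fun n y => by positivity
  have hhm : ∀ n, Measurable (h n) := fun n => by fun_prop
  have hfm : ∀ n, Measurable (f n) := fun n => by fun_prop
  have step : ∀ t ∈ Set.Ioi (0 : ℝ), ∫⁻ y : Rd d, ENNReal.ofReal (t ^ (r - 1) *
      Real.exp (-(w * t)) *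
      (‖y‖ ^ m * Real.exp (η * (√t * ‖y‖)) * Real.exp (-‖y‖ ^ 2 / (4 * K)))) =
      ∑' n : ℕ, ENNReal.ofReal (η ^ n / n.factorial) * ENNReal.ofReal (f n t) *
        ENNReal.ofReal (((4 * K) ^ (((d : ℝ) + (m + n : ℕ)) / 2) * Real.pi ^ ((d : ℝ) / 2) *
        Real.Gamma (((d : ℝ) + (m + n : ℕ)) / 2) / Real.Gamma ((d : ℝ) / 2))) := by
    intro t ht
    have ht : 0 < t := ht
    have hf0 : ∀ n, 0 ≤ f n t := fun n => by positivity
    have h1 : ∀ y : Rd d, ENNReal.ofReal (t ^ (r - 1) * Real.exp (-(w * t)) *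
        (‖y‖ ^ m * Real.exp (η * (√t * ‖y‖)) * Real.exp (-‖y‖ ^ 2 / (4 * K)))) =
        ∑' n : ℕ, ENNReal.ofReal (η ^ n / n.factorial * f n t) * ENNReal.ofReal (h n y) := by
      intro y
      have hsum : HasSum (fun n : ℕ => η ^ n / n.factorial * f n t * h n y)
          (t ^ (r - 1) * Real.exp (-(w * t)) *
        (‖y‖ ^ m * Real.exp (η * (√t * ‖y‖)) * Real.exp (-‖y‖ ^ 2 / (4 * K)))) := by
        have := (NormedSpace.expSeries_div_hasSum_exp (η * (√t * ‖y‖))).mul_left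
          (t ^ (r - 1) * Real.exp (-(w * t)) * (‖y‖ ^ m * Real.exp (-‖y‖ ^ 2 / (4 * K))))
        rw [← Real.exp_eq_exp_ℝ] at this
        refine hasSum_of_eq this (fun n => ?_) (by ring)
        have e : r + n / 2 - 1 = (r - 1) + 1 / 2 * n := by ring
        simp only [hf, hh, e]
        rw [Real.rpow_add ht, Real.rpow_mul ht.le, Real.rpow_natCast, ← Real.sqrt_eq_rpow, mul_pow,
          mul_pow, pow_add]
        ring
      rw [← hsum.tsum_eq, ENNReal.ofReal_tsum_of_nonneg
        (fun n => mul_nonneg (mul_nonneg (by positivity) (hf0 n)) (hh0 n y)) hsum.summable]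
      refine tsum_congr fun n => ENNReal.ofReal_mul (mul_nonneg (by positivity) (hf0 n))
    simp_rw [h1]
    rw [lintegral_tsum fun n => ((hhm n).ennreal_ofReal.const_mul _).aemeasurable]
    refine tsum_congr fun n => ?_
    rw [lintegral_const_mul _ (hhm n).ennreal_ofReal, lintegral_norm_pow_mul_exp hd _ hK,
      ENNReal.ofReal_mul (by positivity)]
  rw [setLIntegral_congr_fun measurableSet_Ioi step,
    lintegral_tsum fun n => (((hfm n).ennreal_ofReal.const_mul _).mul_const _).aemeasurable]
  have hG := Real.Gamma_pos_of_pos (by positivity : (0 : ℝ) < (d : ℝ) / 2)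
  have hs' := hs.mul_left ((1 / w) ^ r * Real.pi ^ ((d : ℝ) / 2) * (4 * K) ^ (((d : ℝ) + m) / 2) /
      Real.Gamma ((d : ℝ) / 2))
  rw [← hs'.tsum_eq, ENNReal.ofReal_tsum_of_nonneg _ hs'.summable]
  · refine ENNReal.tsum_le_tsum fun n => ?_
    have hG1 := Real.Gamma_pos_of_pos (by positivity : (0 : ℝ) < r + n / 2)
    rw [lintegral_mul_const _ ((hfm n).ennreal_ofReal.const_mul _),
      lintegral_const_mul _ (hfm n).ennreal_ofReal,
      lintegral_rpow_mul_exp_neg (by positivity) hw, ← ENNReal.ofReal_mul (by positivity),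
      ← ENNReal.ofReal_mul (by positivity)]
    exact ENNReal.ofReal_le_ofReal (weight_coeff_le hd hK hw hη0 hη hr)
  · intro n
    have hG1 := Real.Gamma_pos_of_pos (by positivity : (0 : ℝ) < r + n / 2)
    have hG2 := Real.Gamma_pos_of_pos (by positivity : (0 : ℝ) < ((d : ℝ) + m) / 2 + n / 2)
    positivity

end GaussianMoments

/-! ### Functional calculus and spectral quantities of diagonalizable matrices. -/

section Matrices

variable {N : ℕ}

/-- The algebra homomorphism `c ↦ Y * diag(c) * Y⁻¹`. -/
def conjDiag (Y : Matrix (Fin N) (Fin N) ℂ) (hY : IsUnit Y) :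
    (Fin N → ℂ) →ₐ[ℂ] Matrix (Fin N) (Fin N) ℂ :=
  AlgHom.ofLinearMap
    { toFun := fun c => Y * Matrix.diagonal c * Y⁻¹
      map_add' := fun c c' => by
        rw [← add_mul, ← mul_add, Matrix.diagonal_add]
        rfl
      map_smul' := fun z c => by simp [Matrix.diagonal_smul] }
    (by
      have := (Matrix.isUnit_iff_isUnit_det Y).1 hY
      simp [Matrix.mul_nonsing_inv Y this])
    (fun c c' => by
      have := (Matrix.isUnit_iff_isUnit_det Y).1 hY
      have h : Y * Matrix.diagonal c * Y⁻¹ * (Y * Matrix.diagonal c' * Y⁻¹) =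
          Y * Matrix.diagonal c * (Y⁻¹ * Y) * Matrix.diagonal c' * Y⁻¹ := by
        simp only [mul_assoc]
      simp only [LinearMap.coe_mk, AddHom.coe_mk]
      rw [h, Matrix.nonsing_inv_mul Y this, mul_one, mul_assoc Y (Matrix.diagonal c),
        Matrix.diagonal_mul_diagonal]
      rfl)

theorem conjDiag_apply (Y : Matrix (Fin N) (Fin N) ℂ) (hY : IsUnit Y) (c : Fin N → ℂ) :
    conjDiag Y hY c = Y * Matrix.diagonal c * Y⁻¹ := rfl

theorem eq_conjDiag {A Y : Matrix (Fin N) (Fin N) ℂ} (hY : IsUnit Y)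
    (h : (Y⁻¹ * A * Y).IsDiag) : A = conjDiag Y hY (Y⁻¹ * A * Y).diag := by
  have hd := (Matrix.isUnit_iff_isUnit_det Y).1 hY
  rw [conjDiag_apply, h.diagonal_diag]
  have h1 : Y * (Y⁻¹ * A * Y) * Y⁻¹ = (Y * Y⁻¹) * A * (Y * Y⁻¹) := by simp only [mul_assoc]
  rw [h1, Matrix.mul_nonsing_inv Y hd, one_mul, mul_one]

theorem spectrum_conjDiag (Y : Matrix (Fin N) (Fin N) ℂ) (hY : IsUnit Y) (c : Fin N → ℂ) :
    spectrum ℂ (conjDiag Y hY c) = Set.range c := by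
  rw [conjDiag_apply]
  obtain ⟨u, rfl⟩ := hY
  rw [← Matrix.coe_units_inv, spectrum.units_conjugate, spectrum_diagonal]

theorem inv_conjDiag (Y : Matrix (Fin N) (Fin N) ℂ) (hY : IsUnit Y) (c : Fin N → ℂ)
    (hc : ∀ j, c j ≠ 0) : (conjDiag Y hY c)⁻¹ = conjDiag Y hY c⁻¹ := by
  refine Matrix.inv_eq_right_inv ?_
  rw [← map_mul]
  have : c * c⁻¹ = 1 := by
    ext j
    simp [hc j]
  rw [this, map_one]

theorem exp_conjDiag (Y : Matrix (Fin N) (Fin N) ℂ) (hY : IsUnit Y) (c : Fin N → ℂ) :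
    NormedSpace.exp (conjDiag Y hY c) = conjDiag Y hY fun j => Complex.exp (c j) := by
  rw [conjDiag_apply, Matrix.exp_conj _ _ hY, Matrix.exp_diagonal, conjDiag_apply]
  congr 3
  ext j
  rw [Pi.coe_exp, Complex.exp_eq_exp_ℂ]

/-- A polynomial in Y diag(c) Y⁻¹ acts entrywise on c, and the interpolation nodes, the roots of the
characteristic polynomial, are exactly the entries of c. -/
theorem matCPow_conjDiag (Y : Matrix (Fin N) (Fin N) ℂ) (hY : IsUnit Y) (c : Fin N → ℂ) (s : ℂ) :
    matCPow (conjDiag Y hY c) s = conjDiag Y hY fun j => c j ^ s := by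
  classical
  rw [matCPow, Polynomial.aeval_algHom_apply]
  congr 1
  ext j
  rw [Polynomial.aeval_fn_apply]
  rw [Polynomial.coe_aeval_eq_eval]
  refine Lagrange.eval_interpolate_at_node _ (fun _ _ _ _ h => h) ?_
  rw [Multiset.mem_toFinset, Polynomial.mem_roots (Matrix.charpoly_monic _).ne_zero,
    ← Matrix.mem_spectrum_iff_isRoot_charpoly, spectrum_conjDiag]
  exact ⟨j, rfl⟩

theorem rho_conjDiag_spec (hN : 1 ≤ N) (Y : Matrix (Fin N) (Fin N) ℂ) (hY : IsUnit Y)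
    (c : Fin N → ℂ) :
    (∀ j, ‖c j‖ ≤ rho (conjDiag Y hY c)) ∧ ∃ j, rho (conjDiag Y hY c) = ‖c j‖ := by
  have : Nonempty (Fin N) := ⟨⟨0, hN⟩⟩
  have h1 : spectralRadius ℂ (conjDiag Y hY c) = ⨆ j, (‖c j‖₊ : ENNReal) := by
    rw [spectralRadius, spectrum_conjDiag, iSup_range]
  obtain ⟨j₀, hj₀⟩ := Finite.exists_max fun j => ‖c j‖
  have h2 : spectralRadius ℂ (conjDiag Y hY c) = (‖c j₀‖₊ : ENNReal) := by
    rw [h1]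
    refine le_antisymm (iSup_le fun j => ?_) (le_iSup (fun j => (‖c j‖₊ : ENNReal)) j₀)
    exact ENNReal.coe_le_coe.2 (hj₀ j)
  have h3 : rho (conjDiag Y hY c) = ‖c j₀‖ := by rw [rho, h2]; simp
  exact ⟨fun j => h3 ▸ hj₀ j, j₀, h3⟩

theorem abscissa_conjDiag_spec (hN : 1 ≤ N) (Y : Matrix (Fin N) (Fin N) ℂ) (hY : IsUnit Y)
    (c : Fin N → ℂ) :
    (∀ j, (c j).re ≤ abscissa (conjDiag Y hY c)) ∧
      ∃ j, abscissa (conjDiag Y hY c) = (c j).re := by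
  have : Nonempty (Fin N) := ⟨⟨0, hN⟩⟩
  have hfin : (Complex.re '' Set.range c).Finite := (Set.finite_range c).image _
  have hne : (Complex.re '' Set.range c).Nonempty := (Set.range_nonempty c).image _
  rw [abscissa, spectrum_conjDiag]
  refine ⟨fun j => le_csSup hfin.bddAbove ⟨c j, ⟨j, rfl⟩, rfl⟩, ?_⟩
  obtain ⟨_, ⟨j, rfl⟩, hj⟩ := hne.csSup_mem hfin
  exact ⟨j, hj.symm⟩

/-- The spectral data of a diagonalizable pair: `A` and `B` have eigenvalues `a`, `b` along the
columns of `Y`. -/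
structure SpectralData (A B Y : Matrix (Fin N) (Fin N) ℂ) (a b : Fin N → ℂ) : Prop where
  isUnit : IsUnit Y
  eq_left : A = conjDiag Y isUnit a
  eq_right : B = conjDiag Y isUnit b
  re_pos : ∀ j, 0 < (a j).re
  aMin_pos : 0 < aMin A
  aMax_pos : 0 < aMax A
  aZero_pos : 0 < aZero A
  aMin_le : ∀ j, aMin A ≤ ‖a j‖
  le_aMax : ∀ j, ‖a j‖ ≤ aMax A
  aZero_le : ∀ j, aZero A ≤ (a j).re
  bZero_le : ∀ j, bZero B ≤ (b j).re

theorem exists_spectralData (hN : 1 ≤ N) {A B Y : Matrix (Fin N) (Fin N) ℂ}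
    (h : SimDiagonalizable A B Y) (hA : ∀ z ∈ spectrum ℂ A, 0 < z.re) :
    ∃ a b, SpectralData A B Y a b := by
  obtain ⟨hY, hdA, hdB⟩ := h
  obtain ⟨a, ha⟩ : ∃ a, A = conjDiag Y hY a := ⟨_, eq_conjDiag hY hdA⟩
  obtain ⟨b, hb⟩ : ∃ b, B = conjDiag Y hY b := ⟨_, eq_conjDiag hY hdB⟩
  have hre : ∀ j, 0 < (a j).re := fun j => hA _ (by rw [ha, spectrum_conjDiag]; exact ⟨j, rfl⟩)
  have hne : ∀ j, a j ≠ 0 := fun j h0 => by simpa [h0] using hre j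
  have hnorm : ∀ j, 0 < ‖a j‖ := fun j => norm_pos_iff.2 (hne j)
  obtain ⟨h1, j1, hj1⟩ := rho_conjDiag_spec hN Y hY a
  obtain ⟨h2, j2, hj2⟩ := rho_conjDiag_spec hN Y hY a⁻¹
  obtain ⟨h3, j3, hj3⟩ := abscissa_conjDiag_spec hN Y hY (-a)
  obtain ⟨h4, j4, hj4⟩ := abscissa_conjDiag_spec hN Y hY (-b)
  rw [← inv_conjDiag Y hY a hne, ← ha] at h2 hj2
  rw [← ha] at h1 hj1
  rw [map_neg, ← ha] at h3 hj3
  rw [map_neg, ← hb] at h4 hj4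
  -- The spectral radius of A⁻¹ is the largest 1/|aⱼ|, so a_min is the smallest |aⱼ|.
  have hmin : aMin A = ‖a j2‖ := by rw [aMin, hj2]; simp
  refine ⟨a, b, hY, ha, hb, hre, ?_, ?_, ?_, ?_, h1, ?_, ?_⟩
  · rw [hmin]; exact hnorm _
  · rw [aMax, hj1]; exact hnorm _
  · rw [aZero, hj3]; simpa using hre j3
  · intro j
    rw [hmin]
    have := h2 j
    rw [hj2] at this
    simpa [hnorm] using (inv_le_inv₀ (hnorm j) (hnorm j2)).1 (by simpa using this)
  · intro j
    have := h3 j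
    simp only [Pi.neg_apply, Complex.neg_re] at this
    rw [aZero]
    linarith
  · intro j
    have := h4 j
    simp only [Pi.neg_apply, Complex.neg_re] at this
    rw [bZero]
    linarith

/-- The operator on `ℂ^N` with matrix `Y * diag(c) * Y⁻¹`. -/
def multiplier (Y : Matrix (Fin N) (Fin N) ℂ) (c : Fin N → ℂ) : CN N →L[ℂ] CN N :=
  Matrix.toEuclideanCLM (n := Fin N) (𝕜 := ℂ) (Y * Matrix.diagonal c * Y⁻¹)

theorem multiplier_eq (Y : Matrix (Fin N) (Fin N) ℂ) (hY : IsUnit Y) (c : Fin N → ℂ) :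
    multiplier Y c = Matrix.toEuclideanCLM (n := Fin N) (𝕜 := ℂ) (conjDiag Y hY c) := rfl

/-- The source of the condition number κ in the constants: one bound on all eigenvalue multipliers
costs only |Y||Y⁻¹|. -/
theorem norm_multiplier_le (Y : Matrix (Fin N) (Fin N) ℂ) {c : Fin N → ℂ} {C : ℝ} (hC : 0 ≤ C)
    (hc : ∀ j, ‖c j‖ ≤ C) : ‖multiplier Y c‖ ≤ cond Y * C := by
  rw [multiplier, map_mul, map_mul, cond, specNorm, specNorm]
  refine (norm_mul_le _ _).trans ?_
  refine (mul_le_mul_of_nonneg_right (norm_mul_le _ _) (norm_nonneg _)).trans ?_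
  have : ‖Matrix.toEuclideanCLM (n := Fin N) (𝕜 := ℂ) (Matrix.diagonal c)‖ ≤ C := by
    rw [Matrix.l2_opNorm_toEuclideanCLM, Matrix.l2_opNorm_diagonal]
    exact (pi_norm_le_iff_of_nonneg hC).2 hc
  calc _ ≤ ‖Matrix.toEuclideanCLM (n := Fin N) (𝕜 := ℂ) Y‖ * C *
        ‖Matrix.toEuclideanCLM (n := Fin N) (𝕜 := ℂ) Y⁻¹‖ := by gcongr
    _ = _ := by ring

/-- The `j`-th spectral projection. -/
def specProj (Y : Matrix (Fin N) (Fin N) ℂ) (j : Fin N) : CN N →L[ℂ] CN N :=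
  multiplier Y (Pi.single j 1)

theorem specProj_specProj {Y : Matrix (Fin N) (Fin N) ℂ} (hY : IsUnit Y) (i j : Fin N) (x : CN N) :
    specProj Y i (specProj Y j x) = if i = j then specProj Y i x else 0 := by
  change (specProj Y i * specProj Y j) x = _
  rw [specProj, specProj, multiplier_eq Y hY, multiplier_eq Y hY, ← map_mul, ← map_mul]
  split_ifs with h
  · subst h
    congr 3
    rw [← Pi.single_mul, one_mul]
  · have : (Pi.single i 1 : Fin N → ℂ) * Pi.single j 1 = 0 := by
      ext k
      by_cases hk : k = i
      · subst hk
        simp [h]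
      · simp [hk]
    simp [this]

theorem multiplier_eq_sum {Y : Matrix (Fin N) (Fin N) ℂ} (hY : IsUnit Y) (c : Fin N → ℂ) :
    multiplier Y c = ∑ j, c j • specProj Y j := by
  simp only [specProj, multiplier_eq Y hY, ← map_smul, ← map_sum]
  congr 2
  ext j
  simp [Pi.single_apply]

theorem sum_specProj {Y : Matrix (Fin N) (Fin N) ℂ} (hY : IsUnit Y) (x : CN N) :
    ∑ j, specProj Y j x = x := by
  have h := multiplier_eq_sum hY 1
  simp only [Pi.one_apply, one_smul] at h
  rw [← sum_apply, ← h, multiplier_eq Y hY, map_one, map_one]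
  rfl

/-- The scalar heat kernel at time `t` as a function of the distance. -/
def heatCoeff (d : ℕ) (a b : ℂ) (t s : ℝ) : ℂ :=
  (4 * Real.pi * t * a) ^ (-(d : ℂ) / 2) * Complex.exp (-(t * b) - (s ^ 2 : ℝ) * (4 * t * a)⁻¹)

theorem SpectralData.heatKernel_mulVec {A B Y : Matrix (Fin N) (Fin N) ℂ} {a b : Fin N → ℂ}
    (h : SpectralData A B Y a b) {d : ℕ} (S : Matrix (Fin d) (Fin d) ℝ) (x ξ : Rd d) {t : ℝ}
    (ht : 0 < t) (v : CN N) :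
    WithLp.toLp 2 ((heatKernel A B S x ξ t).mulVec v.ofLp) =
      multiplier Y (fun j => heatCoeff d (a j) (b j) t ‖rot S t x - ξ‖) v := by
  have hne : ∀ j, (4 * (t : ℂ)) * a j ≠ 0 := fun j => by
    have h0 : a j ≠ 0 := fun h0 => by simpa [h0] using h.re_pos j
    have : (t : ℂ) ≠ 0 := by exact_mod_cast ht.ne'
    exact mul_ne_zero (mul_ne_zero (by norm_num) this) h0
  have hk : heatKernel A B S x ξ t =
      conjDiag Y h.isUnit (fun j => heatCoeff d (a j) (b j) t ‖rot S t x - ξ‖) := by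
    have hA := h.eq_left
    have hB := h.eq_right
    generalize h.isUnit = hY at hA hB ⊢
    rw [heatKernel, hA, hB, ← map_smul, ← map_smul, ← map_smul, inv_conjDiag _ _ _ (by simpa using hne), matCPow_conjDiag,
      ← map_smul, ← map_neg, ← map_sub, exp_conjDiag, ← map_mul]
    rfl
  rw [hk]
  rfl

end Matrices

/-! ### The one-parameter group of rotations. -/

section Rotation

variable {d : ℕ}

/-- The rotation `e^{tS}` as a continuous linear map. -/
def rotCLM (S : Matrix (Fin d) (Fin d) ℝ) (t : ℝ) : Rd d →L[ℝ] Rd d :=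
  Matrix.toEuclideanCLM (n := Fin d) (𝕜 := ℝ) (NormedSpace.exp (t • S))

theorem rot_eq (S : Matrix (Fin d) (Fin d) ℝ) (t : ℝ) (x : Rd d) : rot S t x = rotCLM S t x := rfl

open scoped Matrix.Norms.L2Operator in
theorem continuous_rotCLM (S : Matrix (Fin d) (Fin d) ℝ) : Continuous (rotCLM S) := by
  let _ : NormedAlgebra ℚ (Matrix (Fin d) (Fin d) ℝ) := NormedAlgebra.restrictScalars ℚ ℝ _
  have h1 : Continuous fun t : ℝ => NormedSpace.exp (t • S) :=
    NormedSpace.exp_continuous.comp (by fun_prop)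
  have h2 : Continuous (Matrix.toEuclideanCLM (n := Fin d) (𝕜 := ℝ)) :=
    LinearMap.continuous_of_finiteDimensional
      (Matrix.toEuclideanCLM (n := Fin d) (𝕜 := ℝ)).toAlgEquiv.toLinearMap
  exact h2.comp h1

theorem continuous_rot (S : Matrix (Fin d) (Fin d) ℝ) :
    Continuous fun p : ℝ × Rd d => rot S p.1 p.2 :=
  ((continuous_rotCLM S).comp continuous_fst).clm_apply continuous_snd

theorem rot_zero (S : Matrix (Fin d) (Fin d) ℝ) (x : Rd d) : rot S 0 x = x := by
  simp [rot_eq, rotCLM]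

theorem rot_add (S : Matrix (Fin d) (Fin d) ℝ) (s t : ℝ) (x : Rd d) :
    rot S (s + t) x = rot S s (rot S t x) := by
  simp only [rot_eq, rotCLM]
  rw [add_smul, Matrix.exp_add_of_commute _ _ ((Commute.refl S).smul_left s |>.smul_right t),
    map_mul]
  rfl

/-- Skew-symmetry makes the adjoint of e^{tS} equal to its inverse e^{-tS}. -/
theorem norm_rot {S : Matrix (Fin d) (Fin d) ℝ} (hS : S.transpose = -S) (t : ℝ) (x : Rd d) :
    ‖rot S t x‖ = ‖x‖ := by
  have h1 : star (NormedSpace.exp (t • S)) = NormedSpace.exp (-(t • S)) := by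
    rw [Matrix.star_eq_conjTranspose, Matrix.conjTranspose_eq_transpose_of_trivial,
      ← Matrix.exp_transpose, Matrix.transpose_smul, hS, smul_neg]
  refine ContinuousLinearMap.norm_map_of_mem_unitary (u := rotCLM S t) ?_ x
  have hdet := (Matrix.isUnit_iff_isUnit_det _).1 (Matrix.isUnit_exp (t • S))
  rw [Unitary.mem_iff, rotCLM, ← map_star, ← map_mul, ← map_mul, h1, Matrix.exp_neg,
    Matrix.nonsing_inv_mul _ hdet, Matrix.mul_nonsing_inv _ hdet, map_one]
  simp

/-- The rotation `e^{tS}` as a linear isometry. -/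
def rotIso {S : Matrix (Fin d) (Fin d) ℝ} (hS : S.transpose = -S) (t : ℝ) : Rd d ≃ₗᵢ[ℝ] Rd d where
  toFun := rot S t
  invFun := rot S (-t)
  map_add' := (rotCLM S t).map_add
  map_smul' := (rotCLM S t).map_smul
  left_inv x := by rw [← rot_add, neg_add_cancel, rot_zero]
  right_inv x := by rw [← rot_add, add_neg_cancel, rot_zero]
  norm_map' := norm_rot hS t

end Rotation

/-! ### C_rub as a Banach space with an action of rigid motions. -/

section Space

open BoundedContinuousFunction

variable {d : ℕ} {E : Type*} [NormedAddCommGroup E]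

/-- The rigid motion action `f ↦ f(e^{tS}x - c)`. -/
def motion (S : Matrix (Fin d) (Fin d) ℝ) (p : ℝ × Rd d) (f : Rd d →ᵇ E) : Rd d →ᵇ E :=
  f.compContinuous ⟨fun x => rot S p.1 x - p.2, ((rotCLM S p.1).continuous).sub continuous_const⟩

theorem motion_apply (S : Matrix (Fin d) (Fin d) ℝ) (p : ℝ × Rd d) (f : Rd d →ᵇ E) (x : Rd d) :
    motion S p f x = f (rot S p.1 x - p.2) := rfl

theorem norm_motion_le (S : Matrix (Fin d) (Fin d) ℝ) (p : ℝ × Rd d) (f : Rd d →ᵇ E) :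
    ‖motion S p f‖ ≤ ‖f‖ := by
  rw [BoundedContinuousFunction.norm_le (norm_nonneg _)]
  exact fun x => f.norm_coe_le_norm _

/-- Composition of motions is again a motion with continuously varying parameters, so motions
preserve C_rub. -/
theorem motion_motion (S : Matrix (Fin d) (Fin d) ℝ) (p q : ℝ × Rd d) (f : Rd d →ᵇ E) :
    motion S p (motion S q f) = motion S (q.1 + p.1, rot S q.1 p.2 + q.2) f := by
  ext x
  simp only [motion_apply, rot_add]
  simp only [rot_eq, map_sub]
  rw [sub_sub]

variable [NormedSpace ℂ E]

/-- The space `C_rub` as a closed subspace of the bounded continuous functions: the functions on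
which rigid motions act strongly continuously. -/
def Crub (S : Matrix (Fin d) (Fin d) ℝ) (E : Type*) [NormedAddCommGroup E] [NormedSpace ℂ E] :
    Submodule ℂ (Rd d →ᵇ E) where
  carrier := {f | Continuous fun p => motion S p f}
  add_mem' {f g} hf hg := by
    have : (fun p => motion S p (f + g)) = fun p => motion S p f + motion S p g := by
      ext p x; rfl
    simp only [Set.mem_ofPred_eq] at *
    rw [this]
    exact hf.add hg
  zero_mem' := by
    have : (fun p => motion S p (0 : Rd d →ᵇ E)) = fun p => 0 := by
      ext p x; rfl
    simp only [Set.mem_ofPred_eq]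
    rw [this]
    exact continuous_const
  smul_mem' c f hf := by
    have : (fun p => motion S p (c • f)) = fun p => c • motion S p f := by
      ext p x; rfl
    simp only [Set.mem_ofPred_eq] at *
    rw [this]
    exact hf.const_smul c

variable {S : Matrix (Fin d) (Fin d) ℝ}

theorem mem_Crub_iff {f : Rd d →ᵇ E} : f ∈ Crub S E ↔ Continuous fun p => motion S p f := Iff.rfl

/-- Motions do not increase the supremum norm, so the orbit map of a limit is a uniform limit of
continuous orbit maps. -/
theorem isClosed_Crub : IsClosed (Crub S E : Set (Rd d →ᵇ E)) := by
  refine isClosed_of_closure_subset fun f hf => ?_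
  rw [Metric.mem_closure_iff] at hf
  refine continuous_of_uniform_approx_of_continuous fun u hu => ?_
  obtain ⟨ε, hε, hεu⟩ := Metric.mem_uniformity_dist.1 hu
  obtain ⟨g, hg, hfg⟩ := hf ε hε
  refine ⟨fun p => motion S p g, hg, fun p => hεu ?_⟩
  refine lt_of_le_of_lt ?_ hfg
  rw [dist_eq_norm, dist_eq_norm]
  exact norm_motion_le S p (f - g)

instance [CompleteSpace E] : CompleteSpace (Crub S E) := isClosed_Crub.completeSpace_coe

/-- Rigid motions as operators on `C_rub`. -/
def motionCLM (S : Matrix (Fin d) (Fin d) ℝ) (p : ℝ × Rd d) : Crub S E →L[ℂ] Crub S E :=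
  LinearMap.mkContinuous
    { toFun := fun f => ⟨motion S p f.1, by
        rw [mem_Crub_iff]
        simp only [motion_motion]
        refine (mem_Crub_iff.1 f.2).comp ((continuous_const.add continuous_fst).prodMk ?_)
        exact (((rotCLM S p.1).continuous).comp continuous_snd).add continuous_const⟩
      map_add' := fun f g => rfl
      map_smul' := fun c f => rfl } 1
    (fun f => by rw [one_mul]; exact norm_motion_le S p f.1)

theorem norm_motionCLM_le (p : ℝ × Rd d) (f : Crub S E) : ‖motionCLM S p f‖ ≤ ‖f‖ :=
  norm_motion_le S p f.1

theorem continuous_motionCLM (f : Crub S E) : Continuous fun p => motionCLM S p f :=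
  Continuous.subtype_mk (mem_Crub_iff.1 f.2) _

/-- Pointwise application of an operator. -/
def postComp (S : Matrix (Fin d) (Fin d) ℝ) (P : E →L[ℂ] E) : Crub S E →L[ℂ] Crub S E :=
  ((P.compLeftContinuousBounded (Rd d)).comp (Crub S E).subtypeL).codRestrict (Crub S E)
    (fun f => by
      rw [mem_Crub_iff]
      exact (P.compLeftContinuousBounded (Rd d)).continuous.comp (mem_Crub_iff.1 f.2))

theorem postComp_apply (P : E →L[ℂ] E) (f : Crub S E) (x : Rd d) :
    (postComp S P f).1 x = P (f.1 x) := rfl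

/-- Evaluation at a point. -/
def evalCLM (S : Matrix (Fin d) (Fin d) ℝ) (E : Type*) [NormedAddCommGroup E] [NormedSpace ℂ E]
    (x : Rd d) : Crub S E →L[ℂ] E :=
  (BoundedContinuousFunction.evalCLM ℂ x).comp (Crub S E).subtypeL

theorem evalCLM_apply (f : Crub S E) (x : Rd d) : evalCLM S E x f = f.1 x := rfl

end Space

/-! ### Agreement of the two descriptions of C_rub. -/

section MemCrub

variable {d N : ℕ} {S : Matrix (Fin d) (Fin d) ℝ}

theorem MemCrub.exists_crub {v : Rd d → CN N} (hv : MemCrub S v) :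
    ∃ f : Crub S (CN N), ∀ x, f.1 x = v x := by
  obtain ⟨⟨⟨hc, M, hM⟩, hu⟩, hr⟩ := hv
  let f : BoundedContinuousFunction (Rd d) (CN N) :=
    BoundedContinuousFunction.ofNormedAddCommGroup v hc M hM
  refine ⟨⟨f, ?_⟩, fun x => rfl⟩
  rw [mem_Crub_iff, continuous_iff_continuousAt]
  rintro ⟨t₀, c₀⟩
  rw [ContinuousAt, BoundedContinuousFunction.tendsto_iff_tendstoUniformly,
    Metric.tendstoUniformly_iff]
  intro ε hε
  obtain ⟨δ, hδ, hδu⟩ := Metric.uniformContinuous_iff.1 hu (ε / 2) (half_pos hε)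
  have hs : Tendsto (fun p : ℝ × Rd d => t₀ - p.1) (𝓝 (t₀, c₀)) (𝓝 0) := by
    have : Continuous fun p : ℝ × Rd d => t₀ - p.1 := by fun_prop
    simpa using this.tendsto (t₀, c₀)
  have h1 := hs.eventually (Metric.tendstoUniformly_iff.1 hr (ε / 2) (half_pos hε))
  have h2 : Tendsto (fun p : ℝ × Rd d => rot S (p.1 - t₀) c₀ - p.2) (𝓝 (t₀, c₀)) (𝓝 0) := by
    have : Continuous fun p : ℝ × Rd d => rot S (p.1 - t₀) c₀ - p.2 :=
      ((continuous_rot S).comp (by fun_prop : Continuous fun p : ℝ × Rd d =>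
        (p.1 - t₀, c₀))).sub continuous_snd
    simpa [rot_zero] using this.tendsto (t₀, c₀)
  filter_upwards [h1, h2.eventually (Metric.ball_mem_nhds 0 hδ)] with p hp1 hp2 x
  set w := rot S t₀ x - c₀ with hw
  -- Relative to the base motion, the nearby motion is a small rotation of w followed by a small
  -- shift; rotational continuity controls the first and uniform continuity the second, both
  -- uniformly in x.
  have e : rot S p.1 x - p.2 = rot S (p.1 - t₀) w + (rot S (p.1 - t₀) c₀ - p.2) := by
    have : rot S p.1 x = rot S (p.1 - t₀) (rot S t₀ x) := by rw [← rot_add, sub_add_cancel]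
    rw [this, hw]
    simp only [rot_eq, map_sub]
    abel
  change dist (v w) (v (rot S p.1 x - p.2)) < ε
  rw [e]
  have h3 := hp1 w
  rw [neg_sub] at h3
  have h4 : dist (v (rot S (p.1 - t₀) w))
      (v (rot S (p.1 - t₀) w + (rot S (p.1 - t₀) c₀ - p.2))) < ε / 2 := by
    refine hδu ?_
    rw [dist_self_add_right]
    simpa using hp2
  calc _ ≤ _ := dist_triangle _ (v (rot S (p.1 - t₀) w)) _
    _ < ε / 2 + ε / 2 := add_lt_add h3 h4
    _ = ε := add_halves ε

/-- Pure translations give uniform continuity and pure rotations give the rotational condition. -/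
theorem memCrub_coe (f : Crub S (CN N)) : MemCrub S (fun x => f.1 x) := by
  have hf := mem_Crub_iff.1 f.2
  have h0 : ∀ ε > 0, ∀ᶠ p in 𝓝 ((0 : ℝ), (0 : Rd d)), ∀ x,
      dist (f.1 x) (f.1 (rot S p.1 x - p.2)) < ε := by
    intro ε hε
    have h1 := hf.tendsto (0, 0)
    rw [BoundedContinuousFunction.tendsto_iff_tendstoUniformly] at h1
    filter_upwards [Metric.tendstoUniformly_iff.1 h1 ε hε] with p hp x
    have := hp x
    simpa [motion_apply, rot_zero] using this
  refine ⟨⟨⟨f.1.continuous, ‖f.1‖, f.1.norm_coe_le_norm⟩, ?_⟩, ?_⟩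
  · rw [Metric.uniformContinuous_iff]
    intro ε hε
    obtain ⟨δ, hδ, h⟩ := Metric.eventually_nhds_iff.1 (h0 ε hε)
    refine ⟨δ, hδ, fun x y hxy => ?_⟩
    have h1 := h (y := ((0 : ℝ), x - y)) (by
      rw [Prod.dist_eq]
      simpa [dist_eq_norm, hδ] using hxy) x
    simpa [rot_zero] using h1
  · rw [Metric.tendstoUniformly_iff]
    intro ε hε
    have h1 : Tendsto (fun t : ℝ => (-t, (0 : Rd d))) (𝓝 0) (𝓝 (0, 0)) := by
      have : Continuous fun t : ℝ => (-t, (0 : Rd d)) := by fun_prop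
      simpa using this.tendsto 0
    filter_upwards [h1.eventually (h0 ε hε)] with t ht x
    simpa using ht x

end MemCrub

/-! ### Complex Gaussians and their convolution. -/

section Gauss

variable {d : ℕ} {α : ℂ}

/-- The complex Gaussian `(4πα)^{-d/2} exp(-|y|²/(4α))`. -/
def gauss (α : ℂ) (y : Rd d) : ℂ :=
  (4 * Real.pi * α) ^ (-(d : ℂ) / 2) * Complex.exp (-(4 * α)⁻¹ * (‖y‖ : ℂ) ^ 2)

theorem continuous_gauss (α : ℂ) : Continuous (gauss α : Rd d → ℂ) := by
  unfold gauss
  fun_prop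

theorem re_inv_four_mul (α : ℂ) : ((4 * α)⁻¹).re = α.re / (4 * ‖α‖ ^ 2) := by
  rw [Complex.inv_re, ← Complex.sq_norm, norm_mul]
  simp only [Complex.mul_re, Complex.re_ofNat, Complex.im_ofNat, zero_mul, sub_zero,
    Complex.norm_ofNat]
  by_cases h : ‖α‖ = 0
  · simp [h]
  · field_simp

theorem norm_gauss (α : ℂ) (y : Rd d) : ‖gauss α y‖ =
    (4 * Real.pi * ‖α‖) ^ (-(d : ℝ) / 2) * Real.exp (-(α.re / (4 * ‖α‖ ^ 2)) * ‖y‖ ^ 2) := by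
  have h1 : (-(d : ℂ) / 2) = ((-(d : ℝ) / 2 : ℝ) : ℂ) := by push_cast; ring
  have h2 : (-(4 * α)⁻¹ * (‖y‖ : ℂ) ^ 2).re = -(α.re / (4 * ‖α‖ ^ 2)) * ‖y‖ ^ 2 := by
    rw [← Complex.ofReal_pow, Complex.re_mul_ofReal, Complex.neg_re, re_inv_four_mul]
  rw [gauss, norm_mul, Complex.norm_exp, h2, h1, Complex.norm_cpow_real]
  simp [abs_of_pos Real.pi_pos]

/-- The decay rate of |G_α| is Re α/(4|α|²), not 1/(4|α|); hence the hypothesis |α|² ≤ K Re α, which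
lets one K serve all eigenvalues. -/
theorem norm_gauss_le {am K : ℝ} (ham : 0 < am) (h1 : am ≤ ‖α‖) (hK : 0 < K)
    (h2 : ‖α‖ ^ 2 ≤ K * α.re) (y : Rd d) : ‖gauss α y‖ ≤
    (4 * Real.pi * am) ^ (-(d : ℝ) / 2) * Real.exp (-‖y‖ ^ 2 / (4 * K)) := by
  have hα : 0 < ‖α‖ := ham.trans_le h1
  have hp := Real.pi_pos
  rw [norm_gauss]
  have e1 : (4 * Real.pi * ‖α‖) ^ (-(d : ℝ) / 2) ≤ (4 * Real.pi * am) ^ (-(d : ℝ) / 2) := by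
    refine Real.rpow_le_rpow_of_nonpos (by positivity) (by gcongr) ?_
    have : (0 : ℝ) ≤ d := d.cast_nonneg
    linarith
  have e2 : 1 / (4 * K) ≤ α.re / (4 * ‖α‖ ^ 2) := by
    rw [div_le_div_iff₀ (by positivity) (by positivity)]
    linarith
  refine mul_le_mul e1 (Real.exp_le_exp.2 ?_) (Real.exp_pos _).le (by positivity)
  have := mul_le_mul_of_nonneg_right e2 (sq_nonneg ‖y‖)
  rw [neg_div]
  have e3 : ‖y‖ ^ 2 / (4 * K) = 1 / (4 * K) * ‖y‖ ^ 2 := by ring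
  rw [e3]
  linarith

theorem norm_pos_of_re_pos (hα : 0 < α.re) : 0 < ‖α‖ :=
  hα.trans_le ((le_abs_self _).trans (Complex.abs_re_le_norm α))

theorem norm_pow_mul_norm_gauss_le (hα : 0 < α.re) (n : ℕ) (y : Rd d) : ‖y‖ ^ n * ‖gauss α y‖ ≤
    (4 * Real.pi * ‖α‖) ^ (-(d : ℝ) / 2) *
      (‖y‖ ^ n * Real.exp (-‖y‖ ^ 2 / (4 * (‖α‖ ^ 2 / α.re)))) := by
  have hn := norm_pos_of_re_pos hα
  have := norm_gauss_le (d := d) (α := α) hn le_rfl (K := ‖α‖ ^ 2 / α.re) (by positivity)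
    (by rw [div_mul_cancel₀ _ hα.ne']) y
  calc _ ≤ ‖y‖ ^ n * ((4 * Real.pi * ‖α‖) ^ (-(d : ℝ) / 2) *
      Real.exp (-‖y‖ ^ 2 / (4 * (‖α‖ ^ 2 / α.re)))) := by gcongr
    _ = _ := by ring

theorem integrable_norm_pow_mul_gauss (hd : 0 < d) (hα : 0 < α.re) (n : ℕ) :
    Integrable fun y : Rd d => ‖y‖ ^ n * ‖gauss α y‖ := by
  have hn := norm_pos_of_re_pos hα
  refine ((integrable_norm_pow_mul_exp hd n (K := ‖α‖ ^ 2 / α.re) (by positivity)).const_mul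
    ((4 * Real.pi * ‖α‖) ^ (-(d : ℝ) / 2))).mono' ?_ (Eventually.of_forall fun y => ?_)
  · have := continuous_gauss (d := d) α
    exact (by fun_prop : Continuous fun y : Rd d => ‖y‖ ^ n * ‖gauss α y‖).aestronglyMeasurable
  · rw [Real.norm_of_nonneg (by positivity)]
    exact norm_pow_mul_norm_gauss_le hα n y

theorem integrable_gauss (hd : 0 < d) (hα : 0 < α.re) : Integrable (gauss α : Rd d → ℂ) := by
  refine (integrable_norm_pow_mul_gauss hd hα 0).mono' (continuous_gauss α).aestronglyMeasurable
    (Eventually.of_forall fun y => ?_)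
  simp

theorem integral_gauss (hα : 0 < α.re) : ∫ y : Rd d, gauss α y = 1 := by
  have h0 : α ≠ 0 := fun h => by simp [h] at hα
  have h1 : 0 < ((4 * α)⁻¹).re := by
    have := norm_pos_of_re_pos hα
    rw [re_inv_four_mul]
    positivity
  have h2 : (Real.pi : ℂ) / (4 * α)⁻¹ = 4 * Real.pi * α := by field_simp
  have h3 : (4 * Real.pi * α : ℂ) ≠ 0 :=
    mul_ne_zero (mul_ne_zero (by norm_num) (by exact_mod_cast Real.pi_ne_zero)) h0
  unfold gauss
  rw [integral_const_mul, GaussianFourier.integral_cexp_neg_mul_sq_norm h1,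
    finrank_euclideanSpace_fin, h2, ← Complex.cpow_add _ _ h3]
  rw [show -(d : ℂ) / 2 + d / 2 = 0 by ring, Complex.cpow_zero]

/-- When κ² = 1 + μ², the form |y|² + |κu - μy|² is symmetric in y and u. This is the algebra behind
Gaussian convolution, with real scalings only. -/
theorem gauss_mul_gauss (α : ℂ) {κ μ : ℝ} (h : κ ^ 2 = 1 + μ ^ 2) (y u : Rd d) :
    gauss α y * gauss α (κ • u - μ • y) = gauss α u * gauss α (κ • y - μ • u) := by
  have e : ‖y‖ ^ 2 + ‖κ • u - μ • y‖ ^ 2 = ‖u‖ ^ 2 + ‖κ • y - μ • u‖ ^ 2 := by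
    rw [norm_sub_sq_real, norm_sub_sq_real, norm_smul, norm_smul, norm_smul, norm_smul,
      real_inner_smul_left, real_inner_smul_left, real_inner_smul_right, real_inner_smul_right,
      real_inner_comm]
    simp only [mul_pow, Real.norm_eq_abs, sq_abs, h]
    ring
  have e' : (‖y‖ : ℂ) ^ 2 + (‖κ • u - μ • y‖ : ℂ) ^ 2 =
      (‖u‖ : ℂ) ^ 2 + (‖κ • y - μ • u‖ : ℂ) ^ 2 := by exact_mod_cast e
  unfold gauss
  rw [mul_mul_mul_comm, ← Complex.exp_add, ← mul_add, e', mul_add, Complex.exp_add,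
    mul_mul_mul_comm]

variable {E : Type*} [NormedAddCommGroup E] [NormedSpace ℝ E]

theorem integral_comp_smul_sub (f : Rd d → E) {κ : ℝ} (hκ : 0 < κ) (v : Rd d) :
    ∫ u, f (κ • u - v) = (κ ^ d)⁻¹ • ∫ z, f z := by
  have h := Measure.integral_comp_smul (volume : Measure (Rd d)) (fun z => f (z - v)) κ
  rw [finrank_euclideanSpace_fin, abs_of_pos (by positivity)] at h
  rw [h, integral_sub_right_eq_self]

variable [NormedSpace ℂ E] [IsScalarTower ℝ ℂ E] [CompleteSpace E]

/-- Substitute z = κu - μy, chosen so that √s y + √t z = √(s+t) u. By the symmetry of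
`gauss_mul_gauss` and Fubini, the y-integral is then that of one Gaussian and equals κ^{-d}, which
cancels the Jacobian. -/
theorem integral_gauss_integral_gauss (hd : 0 < d) (hα : 0 < α.re) {s t : ℝ} (hs : 0 < s)
    (ht : 0 < t) {h : Rd d → E} (hc : Continuous h) {M : ℝ} (hM : ∀ x, ‖h x‖ ≤ M) :
    ∫ y, gauss α y • ∫ z, gauss α z • h (√s • y + √t • z) =
      ∫ u, gauss α u • h (√(s + t) • u) := by
  set κ := √(s + t) / √t with hκ
  set μ := √s / √t with hμ
  have ht' : 0 < √t := Real.sqrt_pos.2 ht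
  have hκ0 : 0 < κ := div_pos (Real.sqrt_pos.2 (by positivity)) ht'
  have hκμ : κ ^ 2 = 1 + μ ^ 2 := by
    rw [hκ, hμ, div_pow, div_pow, Real.sq_sqrt hs.le, Real.sq_sqrt ht.le,
      Real.sq_sqrt (by positivity)]
    field_simp
    ring
  have hg := integrable_gauss hd hα
  have hgc := continuous_gauss (d := d) α
  have step1 : ∀ y : Rd d, gauss α y • ∫ z, gauss α z • h (√s • y + √t • z) =
      (κ ^ d) • ∫ u, (gauss α u * gauss α (κ • y - μ • u)) • h (√(s + t) • u) := by
    intro y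
    have h1 := integral_comp_smul_sub (fun z => gauss α z • h (√s • y + √t • z)) hκ0 (μ • y)
    have h2 : ∫ z, gauss α z • h (√s • y + √t • z) = (κ ^ d) •
        ∫ u, gauss α (κ • u - μ • y) • h (√s • y + √t • (κ • u - μ • y)) := by
      rw [h1, smul_smul, mul_inv_cancel₀ (by positivity), one_smul]
    rw [h2, smul_comm, ← integral_smul]
    congr 2
    ext u
    have e : √s • y + √t • (κ • u - μ • y) = √(s + t) • u := by
      rw [smul_sub, smul_smul, smul_smul, hκ, hμ, mul_div_cancel₀ _ ht'.ne',
        mul_div_cancel₀ _ ht'.ne']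
      abel
    rw [e, smul_smul, gauss_mul_gauss α hκμ]
  have hcont : Continuous fun p : Rd d × Rd d =>
      (gauss α p.2 * gauss α (κ • p.1 - μ • p.2)) • h (√(s + t) • p.2) := by fun_prop
  have hslice : ∀ u : Rd d, Integrable fun y : Rd d => gauss α (κ • y - μ • u) := fun u =>
    (hg.comp_sub_right (μ • u)).comp_smul hκ0.ne'
  have hint : Integrable (fun p : Rd d × Rd d =>
      (gauss α p.2 * gauss α (κ • p.1 - μ • p.2)) • h (√(s + t) • p.2))
      (volume.prod volume) := by
    rw [integrable_prod_iff' hcont.aestronglyMeasurable]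
    refine ⟨Eventually.of_forall fun u => ?_, ?_⟩
    · exact ((hslice u).const_mul (gauss α u)).smul_const (h (√(s + t) • u))
    · have e : ∀ u : Rd d, ∫ y, ‖(gauss α u * gauss α (κ • y - μ • u)) • h (√(s + t) • u)‖ =
          (κ ^ d)⁻¹ * (∫ z : Rd d, ‖gauss α z‖) * (‖gauss α u‖ * ‖h (√(s + t) • u)‖) := by
        intro u
        have h1 := integral_comp_smul_sub (fun z : Rd d => ‖gauss α z‖) hκ0 (μ • u)
        rw [smul_eq_mul] at h1
        rw [← h1, ← integral_mul_const]
        congr 1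
        ext y
        rw [norm_smul, norm_mul]
        ring
      simp only [e]
      refine Integrable.const_mul ?_ _
      refine (hg.norm.mul_const M).mono' ?_ (Eventually.of_forall fun u => ?_)
      · exact (by fun_prop : Continuous fun u : Rd d =>
          ‖gauss α u‖ * ‖h (√(s + t) • u)‖).aestronglyMeasurable
      · rw [Real.norm_of_nonneg (by positivity)]
        exact mul_le_mul_of_nonneg_left (hM _) (norm_nonneg _)
  simp only [step1]
  rw [integral_smul, integral_integral_swap hint, ← integral_smul]
  congr 1
  ext u
  rw [integral_smul_const, integral_const_mul,
    integral_comp_smul_sub (fun z => gauss α z) hκ0 (μ • u), integral_gauss hα, ← smul_assoc]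
  congr 1
  rw [Complex.real_smul, Complex.real_smul]
  push_cast
  have : (κ : ℂ) ^ d ≠ 0 := pow_ne_zero _ (by exact_mod_cast hκ0.ne')
  field_simp

end Gauss

/-! ### Averages of rigid motions against integrable kernels. -/

theorem integrable_smul_of_continuous_bounded {α X : Type*} [TopologicalSpace α]
    [MeasurableSpace α] [OpensMeasurableSpace α] [SecondCountableTopology α] {μ : Measure α}
    [NormedAddCommGroup X] [NormedSpace ℂ X] {k : α → ℂ} (hk : Integrable k μ) {F : α → X}
    (hF : Continuous F) {C : ℝ} (hC : ∀ y, ‖F y‖ ≤ C) : Integrable (fun y => k y • F y) μ := by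
  refine (hk.norm.mul_const C).mono' (hk.aestronglyMeasurable.smul hF.aestronglyMeasurable)
    (Eventually.of_forall fun y => ?_)
  rw [norm_smul]
  exact mul_le_mul_of_nonneg_left (hC y) (norm_nonneg _)

theorem continuous_integral_smul {α X : Type*} [TopologicalSpace α]
    [MeasurableSpace α] [OpensMeasurableSpace α] [SecondCountableTopology α] {μ : Measure α}
    [NormedAddCommGroup X] [NormedSpace ℂ X] [NormedSpace ℝ X] {k : ℝ → α → ℂ}
    (hk : Continuous fun p : ℝ × α => k p.1 p.2)
    (hki : ∀ t, Integrable (k t) μ) {b : α → ℝ} (hb : Integrable b μ) (hkb : ∀ t y, ‖k t y‖ ≤ b y)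
    {F : ℝ → α → X} (hF : Continuous fun p : ℝ × α => F p.1 p.2) {C : ℝ}
    (hC : ∀ t y, ‖F t y‖ ≤ C) : Continuous fun t => ∫ y, k t y • F t y ∂μ := by
  refine continuous_of_dominated (bound := fun y => b y * C)
    (fun t => (integrable_smul_of_continuous_bounded (hki t)
      (hF.comp (Continuous.prodMk_right t)) (hC t)).aestronglyMeasurable)
    (fun t => Eventually.of_forall fun y => ?_) (hb.mul_const _) (Eventually.of_forall fun y => ?_)
  · rw [norm_smul]
    exact mul_le_mul (hkb t y) (hC t y) (norm_nonneg _) ((norm_nonneg _).trans (hkb t y))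
  · exact (hk.comp (Continuous.prodMk_left y)).smul (hF.comp (Continuous.prodMk_left y))

section KernelOp

variable {d : ℕ} {S : Matrix (Fin d) (Fin d) ℝ} {E : Type*} [NormedAddCommGroup E]
  [NormedSpace ℂ E]

theorem continuous_motionCLM_sqrt (f : Crub S E) :
    Continuous fun p : ℝ × Rd d => motionCLM S (p.1, √p.1 • p.2) f :=
  (continuous_motionCLM f).comp (by fun_prop)

theorem integrable_smul_motionCLM {k : Rd d → ℂ} (hk : Integrable k) (t : ℝ) (f : Crub S E) :
    Integrable fun y => k y • motionCLM S (t, √t • y) f :=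
  integrable_smul_of_continuous_bounded hk
    ((continuous_motionCLM f).comp (by fun_prop)) fun y => norm_motionCLM_le _ f

theorem integrable_smul_apply {k : Rd d → ℂ} (hk : Integrable k) (t : ℝ) (f : Crub S E)
    (x : Rd d) : Integrable fun y => k y • f.1 (rot S t x - √t • y) :=
  (evalCLM S E x).integrable_comp (integrable_smul_motionCLM hk t f)

variable [NormedSpace ℝ E] [IsScalarTower ℝ ℂ E]

/-- The operator `f ↦ ∫ k(y) f(e^{tS}x - √t y) dy`. -/
def kernelOp (S : Matrix (Fin d) (Fin d) ℝ) {k : Rd d → ℂ} (hk : Integrable k) (t : ℝ) :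
    Crub S E →L[ℂ] Crub S E :=
  LinearMap.mkContinuous
    { toFun := fun f => ∫ y, k y • motionCLM S (t, √t • y) f
      map_add' := fun f g => by
        rw [← integral_add (integrable_smul_motionCLM hk t f) (integrable_smul_motionCLM hk t g)]
        simp only [map_add, smul_add]
      map_smul' := fun c f => by
        rw [RingHom.id_apply, ← integral_smul]
        simp only [map_smul, smul_comm c] }
    (∫ y, ‖k y‖)
    (fun f => by
      rw [← integral_mul_const]
      refine norm_integral_le_of_norm_le (hk.norm.mul_const ‖f‖) (Eventually.of_forall fun y => ?_)
      rw [norm_smul]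
      exact mul_le_mul_of_nonneg_left (norm_motionCLM_le _ f) (norm_nonneg _))

theorem kernelOp_eq {k : Rd d → ℂ} (hk : Integrable k) (t : ℝ) (f : Crub S E) :
    kernelOp S hk t f = ∫ y, k y • motionCLM S (t, √t • y) f := rfl

theorem norm_kernelOp_le {k : Rd d → ℂ} (hk : Integrable k) (t : ℝ) :
    ‖(kernelOp S hk t : Crub S E →L[ℂ] Crub S E)‖ ≤ ∫ y, ‖k y‖ :=
  LinearMap.mkContinuous_norm_le _ (integral_nonneg fun _ => norm_nonneg _) _

/-- Motions act strongly continuously on C_rub, so dominated convergence for the Bochner integral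
gives continuity in t. -/
theorem continuous_kernelOp {k : ℝ → Rd d → ℂ} (hk : Continuous fun p : ℝ × Rd d => k p.1 p.2)
    (hki : ∀ t, Integrable (k t)) {b : Rd d → ℝ} (hb : Integrable b) (hkb : ∀ t y, ‖k t y‖ ≤ b y)
    (f : Crub S E) : Continuous fun t => kernelOp S (hki t) t f := by
  simp only [kernelOp_eq]
  exact continuous_integral_smul hk hki hb hkb (continuous_motionCLM_sqrt f)
    fun t y => norm_motionCLM_le _ f

variable [CompleteSpace E]

theorem kernelOp_apply {k : Rd d → ℂ} (hk : Integrable k) (t : ℝ) (f : Crub S E) (x : Rd d) :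
    (kernelOp S hk t f).1 x = ∫ y, k y • f.1 (rot S t x - √t • y) := by
  rw [← evalCLM_apply, kernelOp_eq,
    ← ContinuousLinearMap.integral_comp_comm _ (integrable_smul_motionCLM hk t f)]
  rfl

theorem kernelOp_postComp {k : Rd d → ℂ} (hk : Integrable k) (t : ℝ) (P : E →L[ℂ] E)
    (f : Crub S E) : kernelOp S hk t (postComp S P f) = postComp S P (kernelOp S hk t f) := by
  rw [kernelOp_eq, kernelOp_eq,
    ← ContinuousLinearMap.integral_comp_comm _ (integrable_smul_motionCLM hk t f)]
  congr 1
  ext y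
  rw [map_smul]
  rfl

end KernelOp

/-! ### The scalar Ornstein-Uhlenbeck semigroup. -/

section HeatOp

variable {d : ℕ} {S : Matrix (Fin d) (Fin d) ℝ} {E : Type*} [NormedAddCommGroup E]
  [NormedSpace ℝ E] [NormedSpace ℂ E] [IsScalarTower ℝ ℂ E]

/-- The scalar Ornstein-Uhlenbeck semigroup with diffusion coefficient `α` and potential `β`. -/
def heatOp (S : Matrix (Fin d) (Fin d) ℝ) {α : ℂ} (hg : Integrable (gauss α : Rd d → ℂ)) (β : ℂ)
    (t : ℝ) : Crub S E →L[ℂ] Crub S E :=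
  Complex.exp (-(t * β)) • kernelOp S hg t

variable [CompleteSpace E]

theorem heatOp_apply {α : ℂ} (hg : Integrable (gauss α : Rd d → ℂ)) (β : ℂ) (t : ℝ)
    (f : Crub S E) (x : Rd d) : (heatOp S hg β t f).1 x =
      Complex.exp (-(t * β)) • ∫ y, gauss α y • f.1 (rot S t x - √t • y) := by
  rw [← kernelOp_apply hg]
  rfl

theorem heatOp_zero {α : ℂ} (hα : 0 < α.re) (hg : Integrable (gauss α : Rd d → ℂ)) (β : ℂ)
    (f : Crub S E) : heatOp S hg β 0 f = f := by
  ext x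
  rw [heatOp_apply]
  simp only [Complex.ofReal_zero, zero_mul, neg_zero, Complex.exp_zero, one_smul, rot_zero,
    Real.sqrt_zero, zero_smul, sub_zero]
  rw [integral_smul_const, integral_gauss hα, one_smul]

/-- The iterated average has shift √s e^{tS}y + √t z; rotation invariance of the Gaussian removes
e^{tS}, and the convolution identity merges the two integrals. -/
theorem heatOp_add (hd : 0 < d) (hS : S.transpose = -S) {α : ℂ} (hα : 0 < α.re)
    (hg : Integrable (gauss α : Rd d → ℂ)) (β : ℂ) {s t : ℝ} (hs : 0 ≤ s) (ht : 0 ≤ t)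
    (f : Crub S E) : heatOp S hg β (s + t) f = heatOp S hg β s (heatOp S hg β t f) := by
  rcases hs.eq_or_lt with rfl | hs
  · rw [heatOp_zero hα, zero_add]
  rcases ht.eq_or_lt with rfl | ht
  · rw [heatOp_zero hα, add_zero]
  ext x
  have key := integral_gauss_integral_gauss hd hα hs ht
    (h := fun e => f.1 (rot S (s + t) x - e)) (by fun_prop) (fun e => f.1.norm_coe_le_norm _)
  -- Change of variables y ↦ e^{tS}y, which preserves Lebesgue measure.
  have hrot := (rotIso hS t).measurePreserving.integral_comp
    (rotIso hS t).toHomeomorph.measurableEmbedding (fun y => gauss α y • ∫ z, gauss α z •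
      f.1 (rot S (s + t) x - (√s • y + √t • z)))
  rw [heatOp_apply, heatOp_apply]
  simp only [heatOp_apply]
  rw [← key, ← hrot, show ((s + t : ℝ) : ℂ) * β = s * β + t * β by push_cast; ring, neg_add,
    Complex.exp_add, mul_smul, ← integral_smul]
  congr 2
  ext y
  rw [smul_comm]
  have e1 : gauss α (rotIso hS t y) = gauss α y := by
    unfold gauss
    rw [LinearIsometryEquiv.norm_map]
  rw [e1]
  congr 3
  ext z
  congr 2
  rw [add_comm s t, rot_add]
  change _ - (√s • rotCLM S t y + _) = rotCLM S t (rot S s x - √s • y) - _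
  rw [map_sub, map_smul, sub_sub]
  rfl

theorem heatOp_expSemigroup (hd : 0 < d) (hS : S.transpose = -S) {α : ℂ} (hα : 0 < α.re)
    (hg : Integrable (gauss α : Rd d → ℂ)) (β : ℂ) :
    ExpSemigroup (heatOp S hg β : ℝ → Crub S E →L[ℂ] Crub S E) (∫ y : Rd d, ‖gauss α y‖)
      (-β.re) where
  zero := heatOp_zero hα hg β
  add s t hs ht := heatOp_add hd hS hα hg β hs ht
  bound t ht := by
    rw [heatOp, norm_smul, Complex.norm_exp, mul_comm]
    refine mul_le_mul (norm_kernelOp_le hg t) (le_of_eq ?_) (Real.exp_pos _).le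
      (integral_nonneg fun _ => norm_nonneg _)
    congr 1
    simp
    ring
  cont f := by
    have h1 : Continuous fun t => kernelOp S hg t f :=
      continuous_kernelOp (k := fun _ => gauss α)
        ((continuous_gauss α).comp continuous_snd) (fun _ => hg) hg.norm (fun _ _ => le_rfl) f
    have h2 : Continuous fun t : ℝ => heatOp S hg β t f :=
      (by fun_prop : Continuous fun t : ℝ => Complex.exp (-(t * β))).smul h1
    exact h2.comp (by fun_prop)

end HeatOp

/-! ### From scalar semigroups to the matrix semigroup. -/

section Diagonal

/-- A semigroup assembled from semigroups on the ranges of commuting projections. -/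
theorem expSemigroup_sum {X ι : Type*} [Fintype ι] [DecidableEq ι] [NormedAddCommGroup X]
    [NormedSpace ℂ X] {T : ι → ℝ → X →L[ℂ] X} {M w : ι → ℝ} {ω : ℝ} {Q : ι → X →L[ℂ] X}
    (hT : ∀ i, ExpSemigroup (T i) (M i) (w i)) (hw : ∀ i, w i ≤ ω)
    (hcomm : ∀ i j t f, T i t (Q j f) = Q j (T i t f))
    (hQ : ∀ i j f, Q i (Q j f) = if i = j then Q i f else 0) (hQ1 : ∀ f, ∑ i, Q i f = f) :
    ExpSemigroup (fun t => ∑ i, (Q i).comp (T i t)) (∑ i, ‖Q i‖ * M i) ω where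
  zero f := by simp [sum_apply, (hT _).zero, hQ1]
  add s t hs ht f := by
    simp only [sum_apply, ContinuousLinearMap.comp_apply, map_sum, hcomm, hQ,
      (hT _).add s t hs ht]
    rw [Finset.sum_comm]
    simp only [Finset.sum_ite_eq, Finset.mem_univ, if_true]
  bound t ht := by
    rw [Finset.sum_mul]
    refine (norm_sum_le _ _).trans (Finset.sum_le_sum fun i _ => ?_)
    refine (ContinuousLinearMap.opNorm_comp_le _ _).trans ?_
    rw [mul_assoc]
    refine mul_le_mul_of_nonneg_left (((hT i).bound t ht).trans ?_) (norm_nonneg _)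
    have hM : 0 ≤ M i := by
      have := (hT i).bound 0 le_rfl
      rw [mul_zero, Real.exp_zero, mul_one] at this
      exact (norm_nonneg _).trans this
    have := hw i
    gcongr
  cont f := by
    simp only [sum_apply, ContinuousLinearMap.comp_apply]
    exact continuous_finsetSum _ fun i _ => (Q i).continuous.comp ((hT i).cont f)

variable {d N : ℕ} {S : Matrix (Fin d) (Fin d) ℝ}

/-- The operator with matrix kernel `Y * diag(k) * Y⁻¹`. -/
def matrixOp (S : Matrix (Fin d) (Fin d) ℝ) (Y : Matrix (Fin N) (Fin N) ℂ)
    {k : Fin N → Rd d → ℂ} (hk : ∀ j, Integrable (k j)) (t : ℝ) :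
    Crub S (CN N) →L[ℂ] Crub S (CN N) :=
  ∑ j, (postComp S (specProj Y j)).comp (kernelOp S (hk j) t)

theorem matrixOp_apply {Y : Matrix (Fin N) (Fin N) ℂ} (hY : IsUnit Y)
    {k : Fin N → Rd d → ℂ} (hk : ∀ j, Integrable (k j)) (t : ℝ) (f : Crub S (CN N)) (x : Rd d) :
    (matrixOp S Y hk t f).1 x =
      ∫ y, multiplier Y (fun j => k j y) (f.1 (rot S t x - √t • y)) := by
  have h1 : (matrixOp S Y hk t f).1 x = ∑ j, specProj Y j ((kernelOp S (hk j) t f).1 x) := by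
    rw [← evalCLM_apply, matrixOp, sum_apply, map_sum]
    rfl
  simp only [multiplier_eq_sum hY, sum_apply, smul_apply]
  rw [h1, integral_finsetSum]
  · refine Finset.sum_congr rfl fun j _ => ?_
    rw [kernelOp_apply, ← ContinuousLinearMap.integral_comp_comm _
      (integrable_smul_apply (hk j) t f x)]
    simp only [map_smul]
  · intro j _
    have := (specProj Y j).integrable_comp (integrable_smul_apply (hk j) t f x)
    simpa only [map_smul] using this

/-- The kernel `e^{-β t} (4πα)^{-d/2} exp(-|y|²/(4α))`. -/
def heatFun (a b : Fin N → ℂ) (t : ℝ) (j : Fin N) (y : Rd d) : ℂ :=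
  Complex.exp (-(t * b j)) * gauss (a j) y

theorem integrable_heatFun (hd : 0 < d) {a : Fin N → ℂ} (ha : ∀ j, 0 < (a j).re) (b : Fin N → ℂ)
    (t : ℝ) (j : Fin N) : Integrable (heatFun a b t j : Rd d → ℂ) :=
  (integrable_gauss hd (ha j)).const_mul _

/-- The Ornstein-Uhlenbeck semigroup on `C_rub`. -/
def ouOp (hd : 0 < d) (S : Matrix (Fin d) (Fin d) ℝ) (Y : Matrix (Fin N) (Fin N) ℂ)
    {a : Fin N → ℂ} (ha : ∀ j, 0 < (a j).re) (b : Fin N → ℂ) (t : ℝ) :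
    Crub S (CN N) →L[ℂ] Crub S (CN N) :=
  matrixOp S Y (integrable_heatFun hd ha b t) t

theorem ouOp_eq_sum (hd : 0 < d) (Y : Matrix (Fin N) (Fin N) ℂ) {a : Fin N → ℂ}
    (ha : ∀ j, 0 < (a j).re) (b : Fin N → ℂ) (t : ℝ) :
    ouOp hd S Y ha b t = ∑ j, (postComp S (specProj Y j)).comp
      (heatOp S (integrable_gauss hd (ha j)) (b j) t) := by
  rw [ouOp, matrixOp]
  refine Finset.sum_congr rfl fun j _ => ?_
  congr 1
  ext f : 1
  rw [heatOp, smul_apply, kernelOp_eq, kernelOp_eq, ← integral_smul]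
  congr 1
  ext y : 1
  rw [heatFun, mul_smul]

theorem ouOp_expSemigroup (hd : 0 < d) (hS : S.transpose = -S) {Y : Matrix (Fin N) (Fin N) ℂ}
    (hY : IsUnit Y) {a : Fin N → ℂ} (ha : ∀ j, 0 < (a j).re) {b : Fin N → ℂ} {ω : ℝ}
    (hb : ∀ j, -(b j).re ≤ ω) : ∃ M, ExpSemigroup (ouOp hd S Y ha b) M ω := by
  have := expSemigroup_sum (X := Crub S (CN N))
    (T := fun j => heatOp S (integrable_gauss hd (ha j)) (b j))
    (Q := fun j => postComp S (specProj Y j))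
    (fun j => heatOp_expSemigroup hd hS (ha j) (integrable_gauss hd (ha j)) (b j)) hb
    (fun i j t f => by
      simp only [heatOp, smul_apply, kernelOp_postComp, map_smul])
    (fun i j f => by
      ext x : 2
      simp only [postComp_apply, specProj_specProj hY]
      split_ifs <;> rfl)
    (fun f => by
      ext x : 2
      rw [← evalCLM_apply, map_sum]
      exact sum_specProj hY _)
  rw [← show ouOp hd S Y ha b = fun t => _ from funext fun t => ouOp_eq_sum hd Y ha b t] at this
  exact ⟨_, this⟩

/-- A positive factor does not change the argument, so the principal power splits without a branch
correction. -/
theorem cpow_ofReal_mul {t : ℝ} (ht : 0 < t) (z s : ℂ) :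
    ((t : ℂ) * z) ^ s = (t : ℂ) ^ s * z ^ s := by
  have ht' : (t : ℂ) ≠ 0 := by exact_mod_cast ht.ne'
  rcases eq_or_ne z 0 with rfl | hz
  · rcases eq_or_ne s 0 with rfl | hs
    · simp
    · simp [Complex.zero_cpow hs]
  rw [Complex.cpow_def_of_ne_zero (mul_ne_zero ht' hz), Complex.cpow_def_of_ne_zero ht',
    Complex.cpow_def_of_ne_zero hz, Complex.log_ofReal_mul ht hz, ← Complex.exp_add,
    ← Complex.ofReal_log ht.le]
  ring_nf

/-- Parabolic scaling: after y ↦ √t y and its Jacobian, the Gaussian no longer depends on t. -/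
theorem heatCoeff_sqrt_mul {α : ℂ} (β : ℂ) {t : ℝ} (ht : 0 < t) (y : Rd d) :
    ((√t ^ d : ℝ) : ℂ) * heatCoeff d α β t ‖√t • y‖ =
      Complex.exp (-(t * β)) * gauss α y := by
  have hp := Real.pi_pos
  have hpow : (4 * Real.pi * t * α : ℂ) ^ (-(d : ℂ) / 2) =
      ((√t ^ d : ℝ) : ℂ)⁻¹ * (4 * Real.pi * α) ^ (-(d : ℂ) / 2) := by
    have e1 : (4 * Real.pi * t * α : ℂ) = (t : ℂ) * (4 * Real.pi * α) := by ring
    have e2 : (-(d : ℂ) / 2) = ((-(d : ℝ) / 2 : ℝ) : ℂ) := by push_cast; ring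
    have e3 : (√t ^ d)⁻¹ = t ^ (-(d : ℝ) / 2) := by
      rw [neg_div, Real.rpow_neg ht.le, ← Real.rpow_natCast, Real.sqrt_eq_rpow,
        ← Real.rpow_mul ht.le]
      congr 2
      ring
    have e4 : (4 * Real.pi * α : ℂ) = ((4 * Real.pi : ℝ) : ℂ) * α := by push_cast; ring
    rw [← Complex.ofReal_inv, e3, Complex.ofReal_cpow ht.le, ← e2, e1,
      cpow_ofReal_mul ht]
  have hsq : (((‖√t • y‖ ^ 2 : ℝ) : ℂ)) = t * (‖y‖ : ℂ) ^ 2 := by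
    rw [norm_smul, mul_pow, Real.norm_eq_abs, sq_abs, Real.sq_sqrt ht.le]
    push_cast
    ring
  have ht' : (t : ℂ) ≠ 0 := by exact_mod_cast ht.ne'
  have hs : ((√t ^ d : ℝ) : ℂ) ≠ 0 := by exact_mod_cast (by positivity : √t ^ d ≠ 0)
  have e5 : -(t * β : ℂ) - t * (‖y‖ : ℂ) ^ 2 * (4 * t * α)⁻¹ =
      -(t * β) + -(4 * α)⁻¹ * (‖y‖ : ℂ) ^ 2 := by
    rw [show (4 * t * α : ℂ) = t * (4 * α) by ring, mul_inv]
    field_simp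
    ring
  rw [heatCoeff, hpow, hsq, e5, Complex.exp_add, gauss]
  field_simp

/-- The substitution is made in two moves: reflection and translation z = e^{tS}x - ξ, then dilation
z = √t y. -/
theorem SpectralData.semigroup_eq (hd : 0 < d) {A B Y : Matrix (Fin N) (Fin N) ℂ} {a b : Fin N → ℂ}
    (h : SpectralData A B Y a b) {t : ℝ} (ht : 0 < t) (f : Crub S (CN N)) (x : Rd d) :
    semigroup A B S t f.1 x = (ouOp hd S Y h.re_pos b t f).1 x := by
  rw [semigroup, if_pos ht, ouOp, matrixOp_apply h.isUnit]
  simp only [h.heatKernel_mulVec S x _ ht]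
  have h1 := integral_sub_left_eq_self (fun ξ : Rd d => multiplier Y
    (fun j => heatCoeff d (a j) (b j) t ‖rot S t x - ξ‖) (f.1 ξ)) volume (rot S t x)
  rw [← h1]
  simp only [sub_sub_cancel]
  have h2 := Measure.integral_comp_smul (volume : Measure (Rd d)) (fun z : Rd d => multiplier Y
    (fun j => heatCoeff d (a j) (b j) t ‖z‖) (f.1 (rot S t x - z))) √t
  have hs : 0 < √t ^ d := by positivity
  rw [finrank_euclideanSpace_fin, abs_of_pos (by positivity)] at h2
  rw [← one_smul ℝ (∫ z : Rd d, _), ← mul_inv_cancel₀ hs.ne', mul_smul, ← h2, ← integral_smul]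
  congr 1
  ext y : 1
  have e : (fun j => heatFun a b t j y) =
      ((√t ^ d : ℝ) : ℂ) • fun j => heatCoeff d (a j) (b j) t ‖√t • y‖ := by
    ext j
    rw [Pi.smul_apply, smul_eq_mul, heatCoeff_sqrt_mul _ ht, heatFun]
  rw [e, multiplier_eq Y h.isUnit, multiplier_eq Y h.isUnit, map_smul, map_smul, smul_apply,
    Complex.coe_smul]

end Diagonal

/-! ### Differentiating Gaussian averages. -/

section GaussDeriv

variable {d : ℕ} {α : ℂ}

/-- The derivative of the complex Gaussian. -/
def dgauss (α : ℂ) (y : Rd d) : Rd d →L[ℝ] ℂ :=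
  (-(2 * α)⁻¹ * gauss α y) • Complex.ofRealCLM.comp (innerSL ℝ y)

theorem dgauss_apply (α : ℂ) (y e : Rd d) :
    dgauss α y e = -(2 * α)⁻¹ * gauss α y * (inner ℝ y e : ℝ) := rfl

theorem continuous_dgauss (α : ℂ) : Continuous (dgauss α : Rd d → Rd d →L[ℝ] ℂ) := by
  have := continuous_gauss (d := d) α
  unfold dgauss
  have h : Continuous fun y : Rd d => Complex.ofRealCLM.comp (innerSL ℝ y) :=
    continuous_const.clm_comp (innerSL ℝ).continuous
  exact (by fun_prop : Continuous fun y : Rd d => -(2 * α)⁻¹ * gauss α y).smul h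

theorem hasFDerivAt_gauss (α : ℂ) (y : Rd d) : HasFDerivAt (gauss α) (dgauss α y) y := by
  have h1 : HasFDerivAt (fun y : Rd d => ((‖y‖ : ℂ)) ^ 2)
      (Complex.ofRealCLM.comp (2 • innerSL ℝ y)) y := by
    have := Complex.ofRealCLM.hasFDerivAt.comp y (hasStrictFDerivAt_norm_sq y).hasFDerivAt
    refine this.congr_of_eventuallyEq (Eventually.of_forall fun z => ?_)
    simp
  have h2 := ((h1.const_mul (-(4 * α)⁻¹)).cexp).const_mul ((4 * Real.pi * α) ^ (-(d : ℂ) / 2))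
  refine h2.congr_fderiv ?_
  ext e
  simp [dgauss_apply, gauss]
  ring

theorem norm_dgauss_apply_le (α : ℂ) (y e : Rd d) :
    ‖dgauss α y e‖ ≤ (2 * ‖α‖)⁻¹ * ‖e‖ * (‖y‖ * ‖gauss α y‖) := by
  rw [dgauss_apply, norm_mul, norm_mul, norm_neg, norm_inv, norm_mul, Complex.norm_ofNat,
    Complex.norm_real]
  calc _ ≤ (2 * ‖α‖)⁻¹ * ‖gauss α y‖ * (‖y‖ * ‖e‖) := by
        gcongr
        exact norm_inner_le_norm y e
    _ = _ := by ring

theorem norm_dgauss_le (α : ℂ) (y : Rd d) :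
    ‖dgauss α y‖ ≤ (2 * ‖α‖)⁻¹ * (‖y‖ * ‖gauss α y‖) := by
  refine ContinuousLinearMap.opNorm_le_bound _ (by positivity) fun e => ?_
  refine (norm_dgauss_apply_le α y e).trans (le_of_eq ?_)
  ring

theorem integrable_dgauss_apply (hd : 0 < d) (hα : 0 < α.re) (e : Rd d) :
    Integrable fun y : Rd d => dgauss α y e := by
  refine ((integrable_norm_pow_mul_gauss hd hα 1).const_mul ((2 * ‖α‖)⁻¹ * ‖e‖)).mono'
    ((continuous_dgauss α).clm_apply continuous_const).aestronglyMeasurable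
    (Eventually.of_forall fun y => ?_)
  simpa using norm_dgauss_apply_le α y e

/-- An integrable majorant that is uniform over a unit ball, as differentiation under the integral
requires. Moving the centre costs a doubling of K, through |w|² ≤ 2|y|² + 2. -/
theorem norm_dgauss_le_of_dist_lt_one (hα : 0 < α.re) {y w : Rd d} (h : ‖y - w‖ ≤ 1) :
    ‖dgauss α y‖ ≤ (2 * ‖α‖)⁻¹ * ((4 * Real.pi * ‖α‖) ^ (-(d : ℝ) / 2)) *
      Real.exp (1 / (2 * (‖α‖ ^ 2 / α.re))) *
      (‖w‖ ^ 1 * Real.exp (-‖w‖ ^ 2 / (4 * (2 * (‖α‖ ^ 2 / α.re)))) +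
        ‖w‖ ^ 0 * Real.exp (-‖w‖ ^ 2 / (4 * (2 * (‖α‖ ^ 2 / α.re))))) := by
  have hn := norm_pos_of_re_pos hα
  have hpi := Real.pi_pos
  set K := ‖α‖ ^ 2 / α.re with hK
  have hK0 : 0 < K := by positivity
  have h1 : ‖y‖ ≤ ‖w‖ + 1 := by
    have := norm_add_le w (y - w)
    rw [add_sub_cancel] at this
    linarith
  have h2 : ‖w‖ ^ 2 ≤ 2 * ‖y‖ ^ 2 + 2 := by
    have : ‖w‖ ≤ ‖y‖ + 1 := by
      have := norm_sub_le y (y - w)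
      rw [sub_sub_cancel] at this
      linarith
    have h0 := norm_nonneg w
    nlinarith [sq_nonneg (‖y‖ - 1)]
  have h3 : Real.exp (-‖y‖ ^ 2 / (4 * K)) ≤
      Real.exp (1 / (2 * K)) * Real.exp (-‖w‖ ^ 2 / (4 * (2 * K))) := by
    rw [← Real.exp_add]
    refine Real.exp_le_exp.2 ?_
    have e : 1 / (2 * K) + -‖w‖ ^ 2 / (4 * (2 * K)) = (4 - ‖w‖ ^ 2) / (4 * (2 * K)) := by
      field_simp
      ring
    rw [e, div_le_div_iff₀ (by positivity) (by positivity)]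
    nlinarith
  have h4 := norm_gauss_le (d := d) (α := α) hn le_rfl hK0
    (by rw [hK, div_mul_cancel₀ _ hα.ne']) y
  calc _ ≤ (2 * ‖α‖)⁻¹ * (‖y‖ * ‖gauss α y‖) := norm_dgauss_le α y
    _ ≤ (2 * ‖α‖)⁻¹ * ((‖w‖ + 1) * ((4 * Real.pi * ‖α‖) ^ (-(d : ℝ) / 2) *
        (Real.exp (1 / (2 * K)) * Real.exp (-‖w‖ ^ 2 / (4 * (2 * K)))))) := by
      gcongr
      exact h4.trans (by gcongr)
    _ = _ := by ring

variable {E : Type*} [NormedAddCommGroup E] [NormedSpace ℝ E] [NormedSpace ℂ E]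
  [IsScalarTower ℝ ℂ E]

/-- The real-linear map `e ↦ φ(e) • v`. -/
def smulRightC (φ : Rd d →L[ℝ] ℂ) (v : E) : Rd d →L[ℝ] E :=
  ((ContinuousLinearMap.lsmul ℝ ℂ).flip v).comp φ

theorem smulRightC_apply (φ : Rd d →L[ℝ] ℂ) (v : E) (e : Rd d) : smulRightC φ v e = φ e • v := rfl

theorem norm_smulRightC_le (φ : Rd d →L[ℝ] ℂ) (v : E) : ‖smulRightC φ v‖ ≤ ‖φ‖ * ‖v‖ := by
  refine ContinuousLinearMap.opNorm_le_bound _ (by positivity) fun e => ?_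
  rw [smulRightC_apply, norm_smul, mul_right_comm]
  exact mul_le_mul_of_nonneg_right (φ.le_opNorm e) (norm_nonneg _)

theorem hasFDerivAt_integral_gauss (hd : 0 < d) (hα : 0 < α.re) {h : Rd d → E} (hc : Continuous h)
    {M : ℝ} (hM : ∀ x, ‖h x‖ ≤ M) (z : Rd d) : ∃ L : Rd d →L[ℝ] E,
    HasFDerivAt (fun z => ∫ y, gauss α y • h (z - y)) L z ∧
      ∀ e, L e = ∫ y, dgauss α y e • h (z - y) := by
  -- Moving z onto the Gaussian makes the integral differentiable although h is only continuous.
  have hflip : ∀ z : Rd d, ∫ y, gauss α y • h (z - y) = ∫ y, gauss α (z - y) • h y := by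
    intro z
    rw [← integral_sub_left_eq_self _ volume z]
    simp only [sub_sub_cancel]
  have hn := norm_pos_of_re_pos hα
  have hg := continuous_gauss (d := d) α
  have hdg := continuous_dgauss (d := d) α
  set K := ‖α‖ ^ 2 / α.re with hK
  have hK0 : 0 < K := by positivity
  have hbound : Integrable fun y : Rd d => (2 * ‖α‖)⁻¹ * ((4 * Real.pi * ‖α‖) ^ (-(d : ℝ) / 2)) *
      Real.exp (1 / (2 * K)) *
      (‖z - y‖ ^ 1 * Real.exp (-‖z - y‖ ^ 2 / (4 * (2 * K))) +
        ‖z - y‖ ^ 0 * Real.exp (-‖z - y‖ ^ 2 / (4 * (2 * K)))) * M := by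
    refine (Integrable.const_mul (Integrable.add ?_ ?_) _).mul_const M
    · exact (integrable_norm_pow_mul_exp hd 1 (by positivity : 0 < 2 * K)).comp_sub_left z
    · exact (integrable_norm_pow_mul_exp hd 0 (by positivity : 0 < 2 * K)).comp_sub_left z
  have hcont : Continuous fun y => smulRightC (dgauss α (z - y)) (h y) := by
    have h1 : Continuous fun y => dgauss α (z - y) := hdg.comp (by fun_prop)
    exact ((ContinuousLinearMap.lsmul ℝ ℂ).flip.continuous.comp hc).clm_comp h1
  have hnorm : ∀ x ∈ Metric.ball z 1, ∀ y, ‖smulRightC (dgauss α (x - y)) (h y)‖ ≤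
      (2 * ‖α‖)⁻¹ * ((4 * Real.pi * ‖α‖) ^ (-(d : ℝ) / 2)) *
      Real.exp (1 / (2 * K)) *
      (‖z - y‖ ^ 1 * Real.exp (-‖z - y‖ ^ 2 / (4 * (2 * K))) +
        ‖z - y‖ ^ 0 * Real.exp (-‖z - y‖ ^ 2 / (4 * (2 * K)))) * M := by
    intro x hx y
    refine (norm_smulRightC_le _ _).trans ?_
    refine mul_le_mul (norm_dgauss_le_of_dist_lt_one hα ?_) (hM y) (norm_nonneg _) (by positivity)
    rw [sub_sub_sub_cancel_right, ← dist_eq_norm]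
    exact (Metric.mem_ball.1 hx).le
  have key := hasFDerivAt_integral_of_dominated_of_fderiv_le (μ := (volume : Measure (Rd d)))
    (F := fun z y => gauss α (z - y) • h y)
    (F' := fun z y => smulRightC (dgauss α (z - y)) (h y)) (x₀ := z) (s := Metric.ball z 1)
    (Metric.ball_mem_nhds z one_pos)
    (Eventually.of_forall fun x =>
      (by fun_prop : Continuous fun y => gauss α (x - y) • h y).aestronglyMeasurable)
    (integrable_smul_of_continuous_bounded ((integrable_gauss hd hα).comp_sub_left z) hc hM)
    hcont.aestronglyMeasurable (Eventually.of_forall fun y x hx => hnorm x hx y) hbound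
    (Eventually.of_forall fun y x _ => by
      have h1 : HasFDerivAt (fun x => gauss α (x - y)) (dgauss α (x - y)) x :=
        (hasFDerivAt_comp_sub y).2 (hasFDerivAt_gauss α (x - y))
      exact ((ContinuousLinearMap.lsmul ℝ ℂ).flip (h y)).hasFDerivAt.comp x h1)
  refine ⟨∫ y, smulRightC (dgauss α (z - y)) (h y), ?_, fun e => ?_⟩
  · simp only [hflip]
    exact key
  · have hi : Integrable fun y => smulRightC (dgauss α (z - y)) (h y) :=
      hbound.mono' hcont.aestronglyMeasurable
        (Eventually.of_forall fun y => hnorm z (Metric.mem_ball_self one_pos) y)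
    rw [ContinuousLinearMap.integral_apply hi, ← integral_sub_left_eq_self _ volume z]
    simp [smulRightC_apply]

end GaussDeriv

section Gradient

variable {d : ℕ} {S : Matrix (Fin d) (Fin d) ℝ} {E : Type*} [NormedAddCommGroup E]
  [NormedSpace ℝ E] [NormedSpace ℂ E] [IsScalarTower ℝ ℂ E] [CompleteSpace E]

/-- With h = f(√t ·) evaluated around e^{tS}x/√t this is a plain convolution; the chain rule
produces t^{-1/2} and rotates the direction e. -/
theorem hasFDerivAt_kernelOp_gauss (hd : 0 < d) {α : ℂ} (hα : 0 < α.re)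
    (hg : Integrable (gauss α : Rd d → ℂ)) {t : ℝ} (ht : 0 < t) (f : Crub S E) (x : Rd d) :
    ∃ L : Rd d →L[ℝ] E, HasFDerivAt (fun x => (kernelOp S hg t f).1 x) L x ∧
      ∀ e, L e = (√t)⁻¹ • (kernelOp S (integrable_dgauss_apply hd hα (rot S t e)) t f).1 x := by
  have hs : √t ≠ 0 := (Real.sqrt_pos.2 ht).ne'
  obtain ⟨L, hL, hLe⟩ := hasFDerivAt_integral_gauss hd hα (h := fun y => f.1 (√t • y))
    (by fun_prop) (fun y => f.1.norm_coe_le_norm _) ((√t)⁻¹ • rot S t x)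
  have hR : HasFDerivAt (fun x => (√t)⁻¹ • rot S t x) ((√t)⁻¹ • rotCLM S t) x :=
    ((√t)⁻¹ • rotCLM S t).hasFDerivAt
  have hpt : ∀ x y, √t • ((√t)⁻¹ • rot S t x - y) = rot S t x - √t • y := by
    intro x y
    rw [smul_sub, smul_inv_smul₀ hs]
  refine ⟨L.comp ((√t)⁻¹ • rotCLM S t), ?_, fun e => ?_⟩
  · refine (hL.comp x hR).congr_of_eventuallyEq (Eventually.of_forall fun z => ?_)
    simp only [Function.comp, kernelOp_apply, hpt]
  · rw [ContinuousLinearMap.comp_apply, smul_apply, map_smul, ← rot_eq, hLe, kernelOp_apply]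
    simp only [hpt]

end Gradient

section MatrixGradient

theorem norm_sum_comp_le {ι X : Type*} [Fintype ι] [NormedAddCommGroup X] [NormedSpace ℂ X]
    (Q T : ι → X →L[ℂ] X) : ‖∑ i, (Q i).comp (T i)‖ ≤ ∑ i, ‖Q i‖ * ‖T i‖ :=
  norm_sum_le_of_le _ fun _ _ => ContinuousLinearMap.opNorm_comp_le _ _

theorem continuousOn_sum_smul {ι X : Type*} [Fintype ι] [NormedAddCommGroup X] [NormedSpace ℂ X]
    {Q : ι → X →L[ℂ] X} {c : ι → ℝ → ℂ} {F : ι → ℝ → X} {s : Set ℝ}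
    (hc : ∀ i, ContinuousOn (c i) s) (hF : ∀ i, Continuous (F i)) :
    ContinuousOn (fun t => ∑ i, Q i (c i t • F i t)) s :=
  continuousOn_finsetSum _ fun i _ =>
    (Q i).continuous.comp_continuousOn ((hc i).smul (hF i).continuousOn)

variable {d N : ℕ} {S : Matrix (Fin d) (Fin d) ℝ}

/-- The kernels of the directional derivative `D_e T(t)`. -/
def gradFun (S : Matrix (Fin d) (Fin d) ℝ) (a b : Fin N → ℂ) (e : Rd d) (t : ℝ) (j : Fin N)
    (y : Rd d) : ℂ :=
  ((√t)⁻¹ : ℝ) * Complex.exp (-(t * b j)) * dgauss (a j) y (rot S t e)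

theorem integrable_gradFun (hd : 0 < d) {a : Fin N → ℂ} (ha : ∀ j, 0 < (a j).re) (b : Fin N → ℂ)
    (e : Rd d) (t : ℝ) (j : Fin N) : Integrable (gradFun S a b e t j) :=
  (integrable_dgauss_apply hd (ha j) (rot S t e)).const_mul _

/-- The directional derivative `D_e T(t)` as an operator on `C_rub`. -/
def gradOp (hd : 0 < d) (S : Matrix (Fin d) (Fin d) ℝ) (Y : Matrix (Fin N) (Fin N) ℂ)
    {a : Fin N → ℂ} (ha : ∀ j, 0 < (a j).re) (b : Fin N → ℂ) (e : Rd d) (t : ℝ) :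
    Crub S (CN N) →L[ℂ] Crub S (CN N) :=
  matrixOp S Y (integrable_gradFun (S := S) hd ha b e t) t

theorem gradOp_eq_sum (hd : 0 < d) (Y : Matrix (Fin N) (Fin N) ℂ) {a : Fin N → ℂ}
    (ha : ∀ j, 0 < (a j).re) (b : Fin N → ℂ) (e : Rd d) (t : ℝ) :
    gradOp hd S Y ha b e t = ∑ j, (postComp S (specProj Y j)).comp
      ((((√t)⁻¹ : ℝ) * Complex.exp (-(t * b j))) •
        kernelOp S (integrable_dgauss_apply hd (ha j) (rot S t e)) t) := by
  rw [gradOp, matrixOp]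
  refine Finset.sum_congr rfl fun j _ => ?_
  congr 1
  ext f : 1
  rw [smul_apply, kernelOp_eq, kernelOp_eq, ← integral_smul]
  congr 1
  ext y : 1
  rw [gradFun, mul_smul]

theorem hasFDerivAt_ouOp (hd : 0 < d) (Y : Matrix (Fin N) (Fin N) ℂ) {a : Fin N → ℂ}
    (ha : ∀ j, 0 < (a j).re) (b : Fin N → ℂ) {t : ℝ} (ht : 0 < t) (f : Crub S (CN N)) (x : Rd d) :
    ∃ L : Rd d →L[ℝ] CN N, HasFDerivAt (fun x => (ouOp hd S Y ha b t f).1 x) L x ∧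
      ∀ e, L e = (gradOp hd S Y ha b e t f).1 x := by
  have h := fun j => hasFDerivAt_kernelOp_gauss hd (ha j) (integrable_gauss hd (ha j)) ht f x
  choose L hL hLe using h
  let P : Fin N → (CN N →L[ℝ] CN N) := fun j =>
    (Complex.exp (-(t * b j)) • specProj Y j).restrictScalars ℝ
  refine ⟨∑ j, (P j).comp (L j), ?_, fun e => ?_⟩
  · have hs := HasFDerivAt.sum (u := Finset.univ) fun j (_ : j ∈ Finset.univ) =>
      (P j).hasFDerivAt.comp x (hL j)
    refine hs.congr_of_eventuallyEq (Eventually.of_forall fun z => ?_)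
    simp only [Finset.sum_apply]
    rw [← evalCLM_apply, ouOp_eq_sum, sum_apply, map_sum]
    refine Finset.sum_congr rfl fun j _ => ?_
    simp only [ContinuousLinearMap.comp_apply, heatOp, smul_apply, map_smul, evalCLM_apply,
      postComp_apply]
    rfl
  · rw [← evalCLM_apply, gradOp_eq_sum, sum_apply, sum_apply, map_sum]
    refine Finset.sum_congr rfl fun j _ => ?_
    simp only [ContinuousLinearMap.comp_apply, smul_apply, map_smul, evalCLM_apply, postComp_apply,
      hLe]
    rw [mul_smul, Complex.coe_smul]
    rfl

/-- The t^{-1/2} singularity comes with a first absolute moment of the Gaussian, which is finite. -/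
theorem norm_gradOp_le (hd : 0 < d) (hS : S.transpose = -S) (Y : Matrix (Fin N) (Fin N) ℂ)
    {a : Fin N → ℂ} (ha : ∀ j, 0 < (a j).re) {b : Fin N → ℂ} {ω : ℝ} (hb : ∀ j, -(b j).re ≤ ω)
    (e : Rd d) : ∃ M, ∀ t, 0 < t → ‖gradOp hd S Y ha b e t‖ ≤ M * ((√t)⁻¹ * Real.exp (ω * t)) := by
  refine ⟨∑ j, ‖(postComp S (specProj Y j) : Crub S (CN N) →L[ℂ] Crub S (CN N))‖ *
    ((2 * ‖a j‖)⁻¹ * ‖e‖ * ∫ y : Rd d, ‖y‖ ^ 1 * ‖gauss (a j) y‖), fun t ht => ?_⟩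
  rw [gradOp_eq_sum, Finset.sum_mul]
  refine (norm_sum_comp_le _ _).trans (Finset.sum_le_sum fun j _ => ?_)
  rw [mul_assoc]
  refine mul_le_mul_of_nonneg_left ?_ (norm_nonneg _)
  rw [norm_smul, mul_comm]
  refine mul_le_mul ?_ ?_ (norm_nonneg _) ?_
  · refine (norm_kernelOp_le _ t).trans ?_
    rw [← integral_const_mul]
    refine integral_mono (integrable_dgauss_apply hd (ha j) _).norm
      ((integrable_norm_pow_mul_gauss hd (ha j) 1).const_mul _) fun y => ?_
    simpa [norm_rot hS] using norm_dgauss_apply_le (a j) y (rot S t e)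
  · rw [norm_mul, Complex.norm_real, Complex.norm_exp, Real.norm_of_nonneg (by positivity)]
    refine mul_le_mul_of_nonneg_left (Real.exp_le_exp.2 ?_) (by positivity)
    have := mul_le_mul_of_nonneg_right (hb j) ht.le
    simp only [Complex.neg_re, Complex.re_ofReal_mul]
    linarith
  · have : 0 ≤ ∫ y : Rd d, ‖y‖ ^ 1 * ‖gauss (a j) y‖ := integral_nonneg fun y => by positivity
    positivity

theorem continuousOn_gradOp (hd : 0 < d) (hS : S.transpose = -S) (Y : Matrix (Fin N) (Fin N) ℂ)
    {a : Fin N → ℂ} (ha : ∀ j, 0 < (a j).re) (b : Fin N → ℂ) (e : Rd d) (f : Crub S (CN N)) :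
    ContinuousOn (fun t => gradOp hd S Y ha b e t f) (Set.Ioi 0) := by
  simp only [gradOp_eq_sum, sum_apply, ContinuousLinearMap.comp_apply, smul_apply]
  refine continuousOn_sum_smul (Q := fun j => postComp S (specProj Y j))
    (c := fun j t => ((√t)⁻¹ : ℝ) * Complex.exp (-(t * b j)))
    (F := fun j t => kernelOp S (integrable_dgauss_apply hd (ha j) (rot S t e)) t f)
    (fun j => ?_) fun j => ?_
  · have h1 : ContinuousOn (fun t : ℝ => (((√t)⁻¹ : ℝ) : ℂ)) (Set.Ioi 0) :=
      Complex.continuous_ofReal.comp_continuousOn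
        (Real.continuous_sqrt.continuousOn.inv₀ fun t ht => (Real.sqrt_pos.2 ht).ne')
    exact h1.mul (by fun_prop : Continuous fun t : ℝ => Complex.exp (-(t * b j))).continuousOn
  · refine continuous_kernelOp (k := fun t y => dgauss (a j) y (rot S t e)) ?_
      (fun t => integrable_dgauss_apply hd (ha j) (rot S t e))
      ((integrable_norm_pow_mul_gauss hd (ha j) 1).const_mul ((2 * ‖a j‖)⁻¹ * ‖e‖)) ?_ f
    · refine ((continuous_dgauss (a j)).comp continuous_snd).clm_apply ?_
      exact (continuous_rot S).comp (by fun_prop : Continuous fun p : ℝ × Rd d => (p.1, e))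
    · intro t y
      simpa [norm_rot hS] using norm_dgauss_apply_le (a j) y (rot S t e)

end MatrixGradient

/-! ### Total derivatives from partial derivatives, and derivatives of the resolvent. -/

section Assemble

variable {d : ℕ} {E : Type*} [NormedAddCommGroup E] [NormedSpace ℝ E]

/-- The linear map with prescribed partial derivatives `w`. -/
def assembleL (w : Fin d → E) : Rd d →L[ℝ] E :=
  ∑ i, (EuclideanSpace.proj i : Rd d →L[ℝ] ℝ).smulRight (w i)

theorem assembleL_apply (w : Fin d → E) (x : Rd d) : assembleL w x = ∑ i, x i • w i := by
  simp [assembleL, sum_apply]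

theorem assembleL_single (w : Fin d → E) (i : Fin d) :
    assembleL w (EuclideanSpace.single i 1) = w i := by
  rw [assembleL_apply]
  simp

theorem eq_assembleL (L : Rd d →L[ℝ] E) :
    L = assembleL fun i => L (EuclideanSpace.single i 1) := by
  ext x
  rw [assembleL_apply]
  conv_lhs => rw [← (EuclideanSpace.basisFun (Fin d) ℝ).sum_repr x]
  simp [map_sum]

theorem norm_assembleL_le (w : Fin d → E) : ‖assembleL w‖ ≤ ∑ i, ‖w i‖ := by
  refine ContinuousLinearMap.opNorm_le_bound _ (by positivity) fun x => ?_
  rw [assembleL_apply, Finset.sum_mul]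
  refine norm_sum_le_of_le _ fun i _ => ?_
  rw [norm_smul, mul_comm]
  exact mul_le_mul_of_nonneg_left (PiLp.norm_apply_le x i) (norm_nonneg _)

/-- `assembleL` is a continuous linear function of the partial derivatives. -/
def assembleCLM (d : ℕ) (E : Type*) [NormedAddCommGroup E] [NormedSpace ℝ E] :
    (Fin d → E) →L[ℝ] (Rd d →L[ℝ] E) :=
  ∑ i, (ContinuousLinearMap.smulRightL ℝ (Rd d) E (EuclideanSpace.proj i)).comp
    (ContinuousLinearMap.proj i)

theorem assembleCLM_apply (w : Fin d → E) : assembleCLM d E w = assembleL w := by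
  rw [assembleCLM, assembleL, sum_apply]
  rfl

theorem contDiff_one_of_assembleL {v : Rd d → E} {w : Fin d → Rd d → E}
    (hw : ∀ i, Continuous (w i)) (h : ∀ x, HasFDerivAt v (assembleL fun i => w i x) x) :
    ContDiff ℝ 1 v := by
  rw [contDiff_one_iff_fderiv]
  refine ⟨fun x => (h x).differentiableAt, ?_⟩
  have : fderiv ℝ v = fun x => assembleCLM d E fun i => w i x :=
    funext fun x => by rw [(h x).fderiv, assembleCLM_apply]
  rw [this]
  exact (assembleCLM d E).continuous.comp (continuous_pi hw)

end Assemble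

section Derivative

variable {d : ℕ} {S : Matrix (Fin d) (Fin d) ℝ} {E : Type*} [NormedAddCommGroup E]
  [NormedSpace ℂ E]

theorem integrable_crub_apply {μ : Measure ℝ} {F : ℝ → Crub S E} (hF : Integrable F μ) (x : Rd d) :
    Integrable (fun t => (F t).1 x) μ :=
  (evalCLM S E x).integrable_comp hF

variable [NormedSpace ℝ E] [IsScalarTower ℝ ℂ E] [CompleteSpace E]

theorem integral_crub_apply {μ : Measure ℝ} {F : ℝ → Crub S E} (hF : Integrable F μ) (x : Rd d) :
    (∫ t, F t ∂μ).1 x = ∫ t, (F t).1 x ∂μ := by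
  rw [← evalCLM_apply, ← ContinuousLinearMap.integral_comp_comm _ hF]
  rfl

/-- The supremum norms of the partial derivatives dominate them at every x, so differentiation under
the integral needs no localization. -/
theorem hasFDerivAt_integral_crub {μ : Measure ℝ} {F : ℝ → Crub S E} {G : Fin d → ℝ → Crub S E}
    (hF : Integrable F μ) (hG : ∀ i, Integrable (G i) μ)
    (h : ∀ᵐ t ∂μ, ∀ x, HasFDerivAt (fun x => (F t).1 x) (assembleL fun i => (G i t).1 x) x)
    (x : Rd d) :
    HasFDerivAt (fun x => (∫ t, F t ∂μ).1 x) (assembleL fun i => (∫ t, G i t ∂μ).1 x) x := by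
  have hGx : Integrable (fun t => fun i => (G i t).1 x) μ :=
    Integrable.of_eval fun i => integrable_crub_apply (hG i) x
  have key := hasFDerivAt_integral_of_dominated_of_fderiv_le (𝕜 := ℝ) (μ := μ)
    (F := fun x t => (F t).1 x) (F' := fun x t => assembleL fun i => (G i t).1 x)
    (bound := fun t => ∑ i, ‖G i t‖) (x₀ := x) univ_mem
    (Eventually.of_forall fun x => (integrable_crub_apply hF x).aestronglyMeasurable)
    (integrable_crub_apply hF x) ?_
    (Eventually.of_forall fun t x _ => (norm_assembleL_le _).trans
      (Finset.sum_le_sum fun i _ => (G i t).1.norm_coe_le_norm x))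
    (integrable_finsetSum _ fun i _ => (hG i).norm) (h.mono fun t ht x _ => ht x)
  · simp only [← integral_crub_apply hF] at key
    have e : (assembleL fun i => (∫ t, G i t ∂μ).1 x) =
        ∫ t, assembleL (fun i => (G i t).1 x) ∂μ := by
      simp only [← assembleCLM_apply]
      rw [ContinuousLinearMap.integral_comp_comm _ hGx]
      congr 1
      ext i : 1
      rw [eval_integral fun i => integrable_crub_apply (hG i) x, integral_crub_apply (hG i)]
    rwa [e]
  · simp only [← assembleCLM_apply]
    exact ((assembleCLM d E).integrable_comp hGx).aestronglyMeasurable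

end Derivative

section LaplaceDerivative

variable {d N : ℕ} {S : Matrix (Fin d) (Fin d) ℝ}

/-- The integrand of the derivative `D_e` of the resolvent. -/
def gradOrbit (hd : 0 < d) (S : Matrix (Fin d) (Fin d) ℝ) (Y : Matrix (Fin N) (Fin N) ℂ)
    {a : Fin N → ℂ} (ha : ∀ j, 0 < (a j).re) (b : Fin N → ℂ) (lam : ℂ) (g : Crub S (CN N))
    (i : Fin d) (t : ℝ) : Crub S (CN N) :=
  Complex.exp (-(lam * t)) • gradOp hd S Y ha b (EuclideanSpace.single i 1) t g

/-- The majorant is the integrand of Γ(1/2), rescaled by Re λ - ω. -/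
theorem integrableOn_smul_of_norm_le {X : Type*} [NormedAddCommGroup X] [NormedSpace ℂ X]
    {lam : ℂ} {ω M : ℝ} (hlam : ω < lam.re) {F : ℝ → X} (hF : ContinuousOn F (Set.Ioi 0))
    (hM : ∀ t, 0 < t → ‖F t‖ ≤ M * ((√t)⁻¹ * Real.exp (ω * t))) :
    IntegrableOn (fun t : ℝ => Complex.exp (-(lam * t)) • F t) (Set.Ioi 0) := by
  have hc : ContinuousOn (fun t : ℝ => Complex.exp (-(lam * t)) • F t) (Set.Ioi 0) :=
    (by fun_prop : Continuous fun t : ℝ => Complex.exp (-(lam * t))).continuousOn.smul hF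
  refine Integrable.mono' ((integrableOn_rpow_mul_exp_neg (a := 1 / 2) (by norm_num)
    (sub_pos.2 hlam)).const_mul M) (hc.aestronglyMeasurable measurableSet_Ioi)
    ((ae_restrict_mem measurableSet_Ioi).mono fun t ht => ?_)
  have ht : 0 < t := ht
  have h1 : (-(lam * t)).re = -(lam.re * t) := by simp
  rw [norm_smul, Complex.norm_exp, h1]
  refine (mul_le_mul_of_nonneg_left (hM t ht) (Real.exp_pos _).le).trans (le_of_eq ?_)
  have h2 : (√t)⁻¹ = t ^ ((1 : ℝ) / 2 - 1) := by
    rw [Real.sqrt_eq_rpow, ← Real.rpow_neg ht.le]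
    norm_num
  rw [h2, show -((lam.re - ω) * t) = -(lam.re * t) + ω * t by ring, Real.exp_add]
  ring

theorem integrableOn_gradOrbit (hd : 0 < d) (hS : S.transpose = -S) (Y : Matrix (Fin N) (Fin N) ℂ)
    {a : Fin N → ℂ} (ha : ∀ j, 0 < (a j).re) {b : Fin N → ℂ} {ω : ℝ} (hb : ∀ j, -(b j).re ≤ ω)
    {lam : ℂ} (hlam : ω < lam.re) (g : Crub S (CN N)) (i : Fin d) :
    IntegrableOn (gradOrbit hd S Y ha b lam g i) (Set.Ioi 0) := by
  obtain ⟨M, hM⟩ := norm_gradOp_le hd hS Y ha hb (EuclideanSpace.single i 1)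
  refine integrableOn_smul_of_norm_le (M := M * ‖g‖) hlam
    (continuousOn_gradOp hd hS Y ha b (EuclideanSpace.single i 1) g) fun t ht => ?_
  refine (ContinuousLinearMap.le_of_opNorm_le _ (hM t ht) g).trans (le_of_eq ?_)
  ring

theorem hasFDerivAt_laplace (hd : 0 < d) (hS : S.transpose = -S) {Y : Matrix (Fin N) (Fin N) ℂ}
    (hY : IsUnit Y) {a : Fin N → ℂ} (ha : ∀ j, 0 < (a j).re) {b : Fin N → ℂ} {ω : ℝ}
    (hb : ∀ j, -(b j).re ≤ ω) {lam : ℂ} (hlam : ω < lam.re) (g : Crub S (CN N)) (x : Rd d) :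
    HasFDerivAt (fun x => (laplace (ouOp hd S Y ha b) lam g).1 x)
      (assembleL fun i => (∫ t in Set.Ioi 0, gradOrbit hd S Y ha b lam g i t).1 x) x := by
  obtain ⟨M, hM⟩ := ouOp_expSemigroup hd hS hY ha hb
  refine hasFDerivAt_integral_crub (hM.integrableOn_laplaceOrbit hlam g)
    (integrableOn_gradOrbit hd hS Y ha hb hlam g)
    ((ae_restrict_mem measurableSet_Ioi).mono fun t ht x => ?_) x
  have ht : 0 < t := ht
  obtain ⟨L, hL, hLe⟩ := hasFDerivAt_ouOp hd Y ha b ht g x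
  have h1 := hL.const_smul (Complex.exp (-(lam * t)))
  have h2 : (Complex.exp (-(lam * t)) • L) =
      assembleL fun i => (gradOrbit hd S Y ha b lam g i t).1 x := by
    rw [eq_assembleL (Complex.exp (-(lam * t)) • L)]
    congr 1
    ext i : 1
    rw [smul_apply, hLe]
    rfl
  rw [← h2]
  refine h1.congr_of_eventuallyEq (Eventually.of_forall fun z => ?_)
  simp only [laplaceOrbit, max_eq_left ht.le]
  rfl

end LaplaceDerivative

/-! ### The weighted resolvent estimate. -/

section Weight

variable {d N : ℕ} {S : Matrix (Fin d) (Fin d) ℝ}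

theorem cond_nonneg (Y : Matrix (Fin N) (Fin N) ℂ) : 0 ≤ cond Y :=
  mul_nonneg (norm_nonneg _) (norm_nonneg _)

/-- Radiality gives θ(x) = θ(e^{tS}x); the growth bound is then applied to the shift √t y. -/
theorem IsRadialWeight.le_mul_exp (hS : S.transpose = -S) {θ : Rd d → ℝ} {η Cθ : ℝ}
    (hθ : IsRadialWeight θ η Cθ) (t : ℝ) (x y : Rd d) :
    θ x ≤ Cθ * θ (rot S t x - √t • y) * Real.exp (η * (√t * ‖y‖)) := by
  obtain ⟨φ, hφ⟩ := hθ.radial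
  have h1 : θ x = θ (rot S t x) := by
    rw [hφ, hφ]
    congr 1
    ext
    exact (norm_rot hS t x).symm
  have h2 := hθ.growth (rot S t x - √t • y) (√t • y)
  rwa [sub_add_cancel, ← h1, norm_smul, Real.norm_of_nonneg (Real.sqrt_nonneg t)] at h2

/-- Weighted estimate for the Laplace transform of a family of integral operators with
Gaussian kernel bounds. -/
theorem norm_integral_multiplier_le {m : ℕ} (hd : 0 < d) (hS : S.transpose = -S)
    {θ : Rd d → ℝ} {η Cθ : ℝ} (hθ : IsRadialWeight θ η Cθ) (Y : Matrix (Fin N) (Fin N) ℂ)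
    {k : ℝ → Fin N → Rd d → ℂ} {c r ω K ϑ s G : ℝ} {lam : ℂ} (hc : 0 ≤ c)
    (hk : ∀ t, 0 < t → ∀ j y, ‖k t j y‖ ≤
      c * (t ^ (r - 1) * Real.exp (ω * t) * (‖y‖ ^ m * Real.exp (-‖y‖ ^ 2 / (4 * K)))))
    (hlam : ω < lam.re) (hK : 0 < K) (hη : η ^ 2 * K ≤ ϑ * (lam.re - ω)) (hϑ : 0 < ϑ) (hr : 0 < r)
    (hs : HasSum (fun n : ℕ => 2 ^ n * ϑ ^ ((n : ℝ) / 2) * Real.Gamma (r + n / 2) *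
        Real.Gamma (((d : ℝ) + m) / 2 + n / 2) / n.factorial) s)
    {g : Rd d → CN N} (hg : ∀ x, θ x * ‖g x‖ ≤ G) (x : Rd d) :
    ‖∫ t in Set.Ioi (0 : ℝ), Complex.exp (-(lam * t)) •
        ∫ y : Rd d, multiplier Y (fun j => k t j y) (g (rot S t x - √t • y))‖ ≤
      cond Y * c * Cθ * G / θ x * ((1 / (lam.re - ω)) ^ r * Real.pi ^ ((d : ℝ) / 2) *
        (4 * K) ^ (((d : ℝ) + m) / 2) / Real.Gamma ((d : ℝ) / 2) * s) := by
  have hθx := hθ.pos x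
  have hw := sub_pos.2 hlam
  have hCθ := hθ.const_pos
  have hY := cond_nonneg Y
  have hG : 0 ≤ G := (mul_nonneg hθx.le (norm_nonneg _)).trans (hg x)
  have hd' : (0 : ℝ) < d := by exact_mod_cast hd
  have hs0 : 0 ≤ s := hs.nonneg fun n => by
    have := Real.Gamma_pos_of_pos (show 0 < r + (n : ℝ) / 2 by positivity)
    have := Real.Gamma_pos_of_pos (show 0 < ((d : ℝ) + m) / 2 + (n : ℝ) / 2 by positivity)
    positivity
  have hΓ := Real.Gamma_pos_of_pos (show 0 < (d : ℝ) / 2 by positivity)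
  set D := cond Y * c * Cθ * G / θ x with hD
  have hD0 : 0 ≤ D := by positivity
  have hpt : ∀ t : ℝ, 0 < t → ∀ y, ‖Complex.exp (-(lam * t)) •
      multiplier Y (fun j => k t j y) (g (rot S t x - √t • y))‖ ≤
      D * (t ^ (r - 1) * Real.exp (-((lam.re - ω) * t)) *
        (‖y‖ ^ m * Real.exp (η * (√t * ‖y‖)) * Real.exp (-‖y‖ ^ 2 / (4 * K)))) := by
    intro t ht y
    have h1 : (-(lam * t)).re = -(lam.re * t) := by simp
    have h2 := norm_multiplier_le Y (by positivity) fun j => hk t ht j y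
    have h3 : ‖g (rot S t x - √t • y)‖ ≤ Cθ * G / θ x * Real.exp (η * (√t * ‖y‖)) := by
      rw [div_mul_eq_mul_div, le_div_iff₀ hθx]
      calc _ ≤ ‖g (rot S t x - √t • y)‖ *
            (Cθ * θ (rot S t x - √t • y) * Real.exp (η * (√t * ‖y‖))) :=
            mul_le_mul_of_nonneg_left (hθ.le_mul_exp hS t x y) (norm_nonneg _)
        _ = Cθ * (θ (rot S t x - √t • y) * ‖g (rot S t x - √t • y)‖) *
            Real.exp (η * (√t * ‖y‖)) := by ring
        _ ≤ _ := by
            gcongr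
            exact hg _
    rw [norm_smul, Complex.norm_exp, h1]
    calc _ ≤ Real.exp (-(lam.re * t)) * (cond Y * (c * (t ^ (r - 1) * Real.exp (ω * t) *
          (‖y‖ ^ m * Real.exp (-‖y‖ ^ 2 / (4 * K))))) *
          (Cθ * G / θ x * Real.exp (η * (√t * ‖y‖)))) := by
          refine mul_le_mul_of_nonneg_left ?_ (Real.exp_pos _).le
          refine (ContinuousLinearMap.le_opNorm _ _).trans ?_
          exact mul_le_mul h2 h3 (norm_nonneg _) (by positivity)
      _ = _ := by
          rw [show -((lam.re - ω) * t) = -(lam.re * t) + ω * t by ring, Real.exp_add, hD]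
          ring
  -- Passing to lower Lebesgue integrals bounds the norm without separate integrability checks on
  -- the iterated integral.
  have key : ‖∫ t in Set.Ioi (0 : ℝ), Complex.exp (-(lam * t)) •
        ∫ y : Rd d, multiplier Y (fun j => k t j y) (g (rot S t x - √t • y))‖ₑ ≤
      ENNReal.ofReal D * ∫⁻ t in Set.Ioi (0 : ℝ), ∫⁻ y : Rd d, ENNReal.ofReal (t ^ (r - 1) *
        Real.exp (-((lam.re - ω) * t)) *
        (‖y‖ ^ m * Real.exp (η * (√t * ‖y‖)) * Real.exp (-‖y‖ ^ 2 / (4 * K)))) := by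
    rw [← lintegral_const_mul' _ _ ENNReal.ofReal_ne_top]
    refine (enorm_integral_le_lintegral_enorm _).trans ?_
    refine setLIntegral_mono' measurableSet_Ioi fun t ht => ?_
    rw [← integral_smul, ← lintegral_const_mul' _ _ ENNReal.ofReal_ne_top]
    refine (enorm_integral_le_lintegral_enorm _).trans (lintegral_mono fun y => ?_)
    rw [← ENNReal.ofReal_mul hD0, ← ofReal_norm]
    exact ENNReal.ofReal_le_ofReal (hpt t ht y)
  have h4 := key.trans (mul_le_mul_right (lintegral_weight_le hd hK hw hθ.rate_nonneg hη hϑ hr hs) _)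
  rw [← ENNReal.ofReal_mul hD0, ← ofReal_norm] at h4
  exact (ENNReal.ofReal_le_ofReal_iff (by positivity)).1 h4

end Weight

/-! ### Uniform bounds on the eigenvalue kernels. -/

section Kernels

variable {d N : ℕ} {S : Matrix (Fin d) (Fin d) ℝ} {a b : Fin N → ℂ} {am K ω : ℝ}

theorem norm_exp_potential_le (hb : ∀ j, -(b j).re ≤ ω) {t : ℝ} (ht : 0 < t) (j : Fin N) :
    ‖Complex.exp (-(t * b j))‖ ≤ Real.exp (ω * t) := by
  rw [Complex.norm_exp]
  refine Real.exp_le_exp.2 ?_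
  have := mul_le_mul_of_nonneg_right (hb j) ht.le
  simp only [Complex.neg_re, Complex.re_ofReal_mul]
  linarith

/-- The trivial factors t^{1-1} and |y|⁰ put the bound in the form of the weighted estimate with r =
1, m = 0. -/
theorem norm_heatFun_le (ham : 0 < am) (hK : 0 < K) (h1 : ∀ j, am ≤ ‖a j‖)
    (h2 : ∀ j, ‖a j‖ ^ 2 ≤ K * (a j).re) (hb : ∀ j, -(b j).re ≤ ω) {t : ℝ} (ht : 0 < t) (j : Fin N)
    (y : Rd d) : ‖heatFun a b t j y‖ ≤ (4 * Real.pi * am) ^ (-(d : ℝ) / 2) *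
      (t ^ ((1 : ℝ) - 1) * Real.exp (ω * t) * (‖y‖ ^ 0 * Real.exp (-‖y‖ ^ 2 / (4 * K)))) := by
  rw [heatFun, norm_mul]
  refine (mul_le_mul (norm_exp_potential_le hb ht j) (norm_gauss_le ham (h1 j) hK (h2 j) y)
    (norm_nonneg _) (Real.exp_pos _).le).trans (le_of_eq ?_)
  rw [sub_self, Real.rpow_zero]
  ring

/-- The weighted estimate is applied to this bound with r = 1/2 from the factor t^{-1/2} and m = 1
from the derivative of the Gaussian. -/
theorem norm_gradFun_le (hS : S.transpose = -S) (ham : 0 < am) (hK : 0 < K)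
    (h1 : ∀ j, am ≤ ‖a j‖) (h2 : ∀ j, ‖a j‖ ^ 2 ≤ K * (a j).re) (hb : ∀ j, -(b j).re ≤ ω)
    {e : Rd d} (he : ‖e‖ = 1) {t : ℝ} (ht : 0 < t) (j : Fin N) (y : Rd d) :
    ‖gradFun S a b e t j y‖ ≤ (2 * am)⁻¹ * (4 * Real.pi * am) ^ (-(d : ℝ) / 2) *
      (t ^ ((1 : ℝ) / 2 - 1) * Real.exp (ω * t) *
        (‖y‖ ^ 1 * Real.exp (-‖y‖ ^ 2 / (4 * K)))) := by
  have hs : (√t)⁻¹ = t ^ ((1 : ℝ) / 2 - 1) := by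
    rw [Real.sqrt_eq_rpow, ← Real.rpow_neg ht.le]
    norm_num
  have h3 := norm_dgauss_apply_le (a j) y (rot S t e)
  rw [norm_rot hS, he, mul_one] at h3
  have h4 : (2 * ‖a j‖)⁻¹ ≤ (2 * am)⁻¹ :=
    inv_anti₀ (by positivity) (mul_le_mul_of_nonneg_left (h1 j) (by norm_num))
  rw [gradFun, norm_mul, norm_mul, Complex.norm_real, Real.norm_of_nonneg (by positivity), hs]
  calc _ ≤ t ^ ((1 : ℝ) / 2 - 1) * Real.exp (ω * t) * ((2 * am)⁻¹ *
        (‖y‖ * ((4 * Real.pi * am) ^ (-(d : ℝ) / 2) * Real.exp (-‖y‖ ^ 2 / (4 * K))))) := by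
        have h5 := norm_exp_potential_le hb ht j
        have h6 := norm_gauss_le ham (h1 j) hK (h2 j) y
        have h7 := h3.trans (mul_le_mul h4 (mul_le_mul_of_nonneg_left h6 (norm_nonneg y))
          (by positivity) (by positivity))
        exact mul_le_mul (mul_le_mul_of_nonneg_left h5 (by positivity)) h7 (norm_nonneg _)
          (by positivity)
    _ = _ := by rw [pow_one]; ring

end Kernels

/-! ### Identification of the constants. -/

section Constants

/-- All powers of 4 and π cancel; with K = a_max²/a_0 and a_min, the quotient that remains is a_1.
-/
theorem rpow_prefactor {am K : ℝ} (ham : 0 < am) (hK : 0 < K) (p : ℝ) :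
    (4 * Real.pi * am) ^ (-p) * Real.pi ^ p * (4 * K) ^ p = (K / am) ^ p := by
  have hp := Real.pi_pos
  rw [Real.rpow_neg (by positivity), Real.mul_rpow (by positivity) ham.le,
    Real.mul_rpow (by norm_num) hp.le, Real.mul_rpow (by norm_num) hK.le,
    Real.div_rpow hK.le ham.le]
  have h1 := Real.rpow_pos_of_pos ham p
  have h2 := Real.rpow_pos_of_pos hp p
  have h3 := Real.rpow_pos_of_pos (show (0 : ℝ) < 4 by norm_num) p
  field_simp

/-- The extra half power of 4K cancels the 2 of the gradient and one half power of a_min, leaving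
a_min^{-1/2}. -/
theorem rpow_prefactor_half {am K : ℝ} (ham : 0 < am) (hK : 0 < K) (p : ℝ) :
    (2 * am)⁻¹ * ((4 * Real.pi * am) ^ (-p) * Real.pi ^ p * (4 * K) ^ (p + 1 / 2)) =
      (K / am) ^ (p + 1 / 2) / am ^ ((1 : ℝ) / 2) := by
  have h4 : (4 : ℝ) ^ ((1 : ℝ) / 2) = 2 := by
    rw [← Real.sqrt_eq_rpow, show (4 : ℝ) = 2 ^ 2 by norm_num, Real.sqrt_sq (by norm_num)]
  rw [Real.rpow_add (by positivity), ← mul_assoc ((4 * Real.pi * am) ^ (-p) * Real.pi ^ p),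
    rpow_prefactor ham hK, Real.rpow_add (by positivity), Real.mul_rpow (by norm_num) hK.le, h4,
    Real.div_rpow hK.le ham.le ((1 : ℝ) / 2)]
  have h1 := Real.rpow_pos_of_pos ham ((1 : ℝ) / 2)
  have h2 : am = am ^ ((1 : ℝ) / 2) * am ^ ((1 : ℝ) / 2) := by
    rw [← Real.rpow_add ham]
    norm_num
  nth_rw 1 [h2]
  field_simp

variable {d N : ℕ}

theorem aOne_eq (A : Matrix (Fin N) (Fin N) ℂ) : aOne A = aMax A ^ 2 / aZero A / aMin A := by
  rw [aOne, div_div, mul_comm]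

theorem constC7_eq (hd : 0 < d) {A : Matrix (Fin N) (Fin N) ℂ} (Y : Matrix (Fin N) (Fin N) ℂ)
    (hmin : 0 < aMin A) (hmax : 0 < aMax A) (hzero : 0 < aZero A) {ϑ w : ℝ} (hϑ : 0 < ϑ)
    (hϑ1 : ϑ < 1) (Cθ : ℝ) : ∃ s, HasSum (fun n : ℕ => 2 ^ n * ϑ ^ ((n : ℝ) / 2) *
        Real.Gamma (1 + n / 2) * Real.Gamma (((d : ℝ) + (0 : ℕ)) / 2 + n / 2) / n.factorial) s ∧
      cond Y * (4 * Real.pi * aMin A) ^ (-(d : ℝ) / 2) * Cθ * ((1 / w) ^ (1 : ℝ) *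
        Real.pi ^ ((d : ℝ) / 2) * (4 * (aMax A ^ 2 / aZero A)) ^ (((d : ℝ) + (0 : ℕ)) / 2) /
        Real.Gamma ((d : ℝ) / 2) * s) = constC7 d A Y ϑ Cθ / w := by
  have hd' : (0 : ℝ) < d := by exact_mod_cast hd
  have h1ϑ := sub_pos.2 hϑ1
  refine ⟨_, hasSum_Gamma_mul_Gamma (((d : ℝ) + (0 : ℕ)) / 2) 1 (by positivity) one_pos hϑ hϑ1, ?_⟩
  have hΓ := Real.Gamma_pos_of_pos (show 0 < (d : ℝ) / 2 by positivity)
  have hpre := rpow_prefactor hmin (by positivity : 0 < aMax A ^ 2 / aZero A) ((d : ℝ) / 2)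
  rw [← neg_div, ← aOne_eq] at hpre
  -- The π^{1/2} of C_7 comes from Γ(3/2).
  have h32 : Real.Gamma (1 + 1 / 2) = Real.pi ^ ((1 : ℝ) / 2) / 2 := by
    rw [add_comm, Real.Gamma_add_one (by norm_num), Real.Gamma_one_half_eq, Real.sqrt_eq_rpow]
    ring
  have hpow : (1 / (1 - ϑ)) ^ ((1 : ℝ) + 1 / 2) = 1 / (1 - ϑ) * (1 / (1 - ϑ)) ^ ((1 : ℝ) / 2) := by
    rw [Real.rpow_add (by positivity), Real.rpow_one]
  -- The odd part carries an extra (1/(1-ϑ))^{1/2}, which joins ϑ^{1/2} to form q^{1/2}.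
  have hq : (ϑ / (1 - ϑ)) ^ ((1 : ℝ) / 2) = ϑ ^ ((1 : ℝ) / 2) * (1 / (1 - ϑ)) ^ ((1 : ℝ) / 2) := by
    rw [← Real.mul_rpow hϑ.le (by positivity), mul_one_div]
  rw [Nat.cast_zero, add_zero, constC7, h32, hpow, hq, Real.Gamma_one, Real.rpow_one, Real.rpow_one,
    show (1 : ℝ) / 2 - d / 2 = -((d : ℝ) - 1) / 2 by ring,
    show (1 : ℝ) - d / 2 = -((d : ℝ) - 2) / 2 by ring,
    show (1 : ℝ) + 1 / 2 = 3 / 2 by norm_num, show (d : ℝ) / 2 + 1 / 2 = ((d : ℝ) + 1) / 2 by ring,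
    ← hpre]
  field_simp

theorem constC8_eq (hd : 0 < d) {A : Matrix (Fin N) (Fin N) ℂ} (Y : Matrix (Fin N) (Fin N) ℂ)
    (hmin : 0 < aMin A) (hmax : 0 < aMax A) (hzero : 0 < aZero A) {ϑ w : ℝ} (hw : 0 < w)
    (hϑ : 0 < ϑ) (hϑ1 : ϑ < 1) (Cθ : ℝ) : ∃ s, HasSum (fun n : ℕ => 2 ^ n * ϑ ^ ((n : ℝ) / 2) *
        Real.Gamma (1 / 2 + n / 2) * Real.Gamma (((d : ℝ) + (1 : ℕ)) / 2 + n / 2) / n.factorial) s ∧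
      cond Y * ((2 * aMin A)⁻¹ * (4 * Real.pi * aMin A) ^ (-(d : ℝ) / 2)) * Cθ *
        ((1 / w) ^ ((1 : ℝ) / 2) *
        Real.pi ^ ((d : ℝ) / 2) * (4 * (aMax A ^ 2 / aZero A)) ^ (((d : ℝ) + (1 : ℕ)) / 2) /
        Real.Gamma ((d : ℝ) / 2) * s) = constC8 d A Y ϑ Cθ / w ^ ((1 : ℝ) / 2) := by
  have hd' : (0 : ℝ) < d := by exact_mod_cast hd
  have h1ϑ := sub_pos.2 hϑ1
  refine ⟨_, hasSum_Gamma_mul_Gamma (((d : ℝ) + (1 : ℕ)) / 2) (1 / 2) (by positivity)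
    (by norm_num) hϑ hϑ1, ?_⟩
  have hΓ := Real.Gamma_pos_of_pos (show 0 < (d : ℝ) / 2 by positivity)
  have hΓ' := Real.Gamma_pos_of_pos (show 0 < (1 : ℝ) / 2 by norm_num)
  have hpre := rpow_prefactor_half hmin (by positivity : 0 < aMax A ^ 2 / aZero A) ((d : ℝ) / 2)
  rw [← neg_div, ← aOne_eq, ← add_div] at hpre
  have hpow : (1 / (1 - ϑ)) ^ ((1 : ℝ) / 2 + 1 / 2) =
      (1 / (1 - ϑ)) ^ ((1 : ℝ) / 2) * (1 / (1 - ϑ)) ^ ((1 : ℝ) / 2) :=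
    Real.rpow_add (by positivity) _ _
  have hq : (ϑ / (1 - ϑ)) ^ ((1 : ℝ) / 2) = ϑ ^ ((1 : ℝ) / 2) * (1 / (1 - ϑ)) ^ ((1 : ℝ) / 2) := by
    rw [← Real.mul_rpow hϑ.le (by positivity), mul_one_div]
  have hw2 : (1 / w) ^ ((1 : ℝ) / 2) = (w ^ ((1 : ℝ) / 2))⁻¹ := by
    rw [one_div, Real.inv_rpow hw.le]
  have hw3 := Real.rpow_pos_of_pos hw ((1 : ℝ) / 2)
  have ham := Real.rpow_pos_of_pos hmin ((1 : ℝ) / 2)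
  have hC : constC8 d A Y ϑ Cθ = Cθ * cond Y *
      (aOne A ^ (((d : ℝ) + 1) / 2) / aMin A ^ ((1 : ℝ) / 2)) * Real.Gamma (1 / 2) *
      (1 / (1 - ϑ)) ^ ((1 : ℝ) / 2) * (Real.Gamma (((d : ℝ) + 1) / 2) / Real.Gamma ((d : ℝ) / 2) *
        hyp2F1 (-(d : ℝ) / 2) (1 / 2) (1 / 2) (-(ϑ / (1 - ϑ))) +
      2 * (Real.Gamma (((d : ℝ) + 2) / 2) / (Real.Gamma (1 / 2) * Real.Gamma ((d : ℝ) / 2))) *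
        (ϑ / (1 - ϑ)) ^ ((1 : ℝ) / 2) *
        hyp2F1 (-((d : ℝ) - 1) / 2) 1 (3 / 2) (-(ϑ / (1 - ϑ)))) := by
    rw [constC8]
    ring
  rw [hC, Nat.cast_one, hpow, hq, hw2, ← hpre,
    show (1 : ℝ) / 2 - ((d : ℝ) + 1) / 2 = -(d : ℝ) / 2 by ring,
    show (1 : ℝ) - ((d : ℝ) + 1) / 2 = -((d : ℝ) - 1) / 2 by ring,
    show (1 : ℝ) / 2 + 1 / 2 = 1 by norm_num,
    show ((d : ℝ) + 1) / 2 + 1 / 2 = ((d : ℝ) + 2) / 2 by ring, Real.Gamma_one]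
  field_simp

end Constants

/-! ### The resolvent equation and the final bounds. -/

section Final

variable {d N : ℕ} {S : Matrix (Fin d) (Fin d) ℝ}

theorem MemCbW.mul_norm_le {θ : Rd d → ℝ} (hθ : ∀ x, 0 < θ x) {g : Rd d → CN N} (hg : MemCbW θ g)
    (x : Rd d) : θ x * ‖g x‖ ≤ normCbW θ g := by
  have := le_ciSup hg.2 x
  rwa [norm_smul, Real.norm_of_nonneg (hθ x).le] at this

theorem norm_smul_le_of_le_div {θ : Rd d → ℝ} (hθ : ∀ x, 0 < θ x) {v : Rd d → CN N} {C G : ℝ}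
    (h : ∀ x, ‖v x‖ ≤ C * (1 / θ x) * G) (x : Rd d) : ‖θ x • v x‖ ≤ C * G := by
  have hx := hθ x
  rw [norm_smul, Real.norm_of_nonneg hx.le]
  refine (mul_le_mul_of_nonneg_left (h x) hx.le).trans (le_of_eq ?_)
  field_simp

theorem memCbW_of_le_div {θ : Rd d → ℝ} (hθ : ∀ x, 0 < θ x) {v : Rd d → CN N} (hv : Continuous v)
    {C G : ℝ} (h : ∀ x, ‖v x‖ ≤ C * (1 / θ x) * G) : MemCbW θ v :=
  ⟨hv, C * G, Set.forall_mem_range.2 fun x => norm_smul_le_of_le_div hθ h x⟩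

theorem normCbW_le_of_le_div {θ : Rd d → ℝ} (hθ : ∀ x, 0 < θ x) {v : Rd d → CN N} {C G : ℝ}
    (h : ∀ x, ‖v x‖ ≤ C * (1 / θ x) * G) : normCbW θ v ≤ C * G :=
  ciSup_le fun x => norm_smul_le_of_le_div hθ h x

theorem SpectralData.tendsto_iff_tendstoUniformly (hd : 0 < d) {A B Y : Matrix (Fin N) (Fin N) ℂ}
    {a b : Fin N → ℂ} (h : SpectralData A B Y a b) (v w : Crub S (CN N)) :
    Tendsto (fun t : ℝ => t⁻¹ • (ouOp hd S Y h.re_pos b t v - v)) (𝓝[>] 0) (𝓝 w) ↔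
      TendstoUniformly (fun (t : ℝ) (x : Rd d) => t⁻¹ • (semigroup A B S t v.1 x - v.1 x)) w.1
        (𝓝[>] 0) := by
  rw [tendsto_subtype_rng, BoundedContinuousFunction.tendsto_iff_tendstoUniformly]
  refine tendstoUniformly_congr ?_
  filter_upwards [self_mem_nhdsWithin] with t ht
  ext1 x
  rw [h.semigroup_eq hd ht]
  rfl

theorem SpectralData.neg_re_le {A B Y : Matrix (Fin N) (Fin N) ℂ} {a b : Fin N → ℂ}
    (h : SpectralData A B Y a b) (j : Fin N) : -(b j).re ≤ omegaB B :=
  neg_le_neg (h.bZero_le j)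

/-- This fixes K = a_max²/a_0: |aⱼ|² ≤ a_max² = K a_0 ≤ K Re aⱼ. -/
theorem SpectralData.sq_norm_le {A B Y : Matrix (Fin N) (Fin N) ℂ} {a b : Fin N → ℂ}
    (h : SpectralData A B Y a b) (j : Fin N) : ‖a j‖ ^ 2 ≤ aMax A ^ 2 / aZero A * (a j).re := by
  have h0 := h.aZero_pos
  have h1 : ‖a j‖ ^ 2 ≤ aMax A ^ 2 := pow_le_pow_left₀ (norm_nonneg _) (h.le_aMax j) 2
  rw [div_mul_eq_mul_div, le_div_iff₀ h0]
  exact mul_le_mul h1 (h.aZero_le j) h0.le (sq_nonneg _)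

theorem laplace_ouOp_apply (hd : 0 < d) (hS : S.transpose = -S) {Y : Matrix (Fin N) (Fin N) ℂ}
    (hY : IsUnit Y) {a : Fin N → ℂ} (ha : ∀ j, 0 < (a j).re) {b : Fin N → ℂ} {ω : ℝ}
    (hb : ∀ j, -(b j).re ≤ ω) {lam : ℂ} (hlam : ω < lam.re) (g : Crub S (CN N)) (x : Rd d) :
    (laplace (ouOp hd S Y ha b) lam g).1 x = ∫ t in Set.Ioi (0 : ℝ), Complex.exp (-(lam * t)) •
      ∫ y : Rd d, multiplier Y (fun j => heatFun a b t j y) (g.1 (rot S t x - √t • y)) := by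
  obtain ⟨M, hT⟩ := ouOp_expSemigroup hd hS hY ha hb
  rw [laplace, integral_crub_apply (hT.integrableOn_laplaceOrbit hlam g)]
  refine setIntegral_congr_fun measurableSet_Ioi fun t ht => ?_
  have ht : 0 < t := ht
  simp only [laplaceOrbit, max_eq_left ht.le]
  rw [← matrixOp_apply hY (integrable_heatFun hd ha b t)]
  rfl

theorem integral_gradOrbit_apply (hd : 0 < d) (hS : S.transpose = -S)
    {Y : Matrix (Fin N) (Fin N) ℂ} (hY : IsUnit Y) {a : Fin N → ℂ} (ha : ∀ j, 0 < (a j).re)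
    {b : Fin N → ℂ} {ω : ℝ} (hb : ∀ j, -(b j).re ≤ ω) {lam : ℂ} (hlam : ω < lam.re)
    (g : Crub S (CN N)) (i : Fin d) (x : Rd d) :
    (∫ t in Set.Ioi (0 : ℝ), gradOrbit hd S Y ha b lam g i t).1 x =
      ∫ t in Set.Ioi (0 : ℝ), Complex.exp (-(lam * t)) • ∫ y : Rd d,
        multiplier Y (fun j => gradFun S a b (EuclideanSpace.single i 1) t j y)
          (g.1 (rot S t x - √t • y)) := by
  rw [integral_crub_apply (integrableOn_gradOrbit hd hS Y ha hb hlam g i)]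
  refine setIntegral_congr_fun measurableSet_Ioi fun t _ => ?_
  rw [← matrixOp_apply hY (integrable_gradFun (S := S) hd ha b (EuclideanSpace.single i 1) t)]
  rfl

theorem SpectralData.solvesResolvent_laplace (hd : 0 < d) (hS : S.transpose = -S)
    {A B Y : Matrix (Fin N) (Fin N) ℂ} {a b : Fin N → ℂ} (h : SpectralData A B Y a b) {lam : ℂ}
    (hlam : omegaB B < lam.re) (g : Crub S (CN N)) :
    SolvesResolvent A B S lam g.1 (laplace (ouOp hd S Y h.re_pos b) lam g).1 := by
  obtain ⟨M, hT⟩ := ouOp_expSemigroup hd hS h.isUnit h.re_pos h.neg_re_le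
  refine ⟨_, ⟨memCrub_coe _, memCrub_coe _,
    (h.tendsto_iff_tendstoUniformly hd _ _).1 (hT.tendsto_laplace hlam g)⟩, fun x => ?_⟩
  exact sub_sub_cancel _ _

theorem SpectralData.eq_laplace_of_solvesResolvent (hd : 0 < d) (hS : S.transpose = -S)
    {A B Y : Matrix (Fin N) (Fin N) ℂ} {a b : Fin N → ℂ} (h : SpectralData A B Y a b) {lam : ℂ}
    (hlam : omegaB B < lam.re) (g : Crub S (CN N)) {u : Rd d → CN N}
    (hu : SolvesResolvent A B S lam g.1 u) : u = (laplace (ouOp hd S Y h.re_pos b) lam g).1 := by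
  obtain ⟨M, hT⟩ := ouOp_expSemigroup hd hS h.isUnit h.re_pos h.neg_re_le
  obtain ⟨w, ⟨hu1, -, hlim⟩, heq⟩ := hu
  obtain ⟨U, hU⟩ := hu1.exists_crub
  obtain rfl : U.1 = u := funext hU
  have hw : w = (lam • U - g).1 := by
    ext1 x
    change w x = lam • U.1 x - g.1 x
    rw [← heq x, sub_sub_cancel]
  rw [hw] at hlim
  rw [← hT.eq_laplace hlam g U ((h.tendsto_iff_tendstoUniformly hd _ _).2 hlim)]

theorem SpectralData.norm_laplace_le (hd : 0 < d) (hS : S.transpose = -S)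
    {A B Y : Matrix (Fin N) (Fin N) ℂ} {a b : Fin N → ℂ} (h : SpectralData A B Y a b) {lam : ℂ}
    (hlam : omegaB B < lam.re) {ϑ η Cθ : ℝ} (hϑ0 : 0 < ϑ) (hϑ1 : ϑ < 1) {θ : Rd d → ℝ}
    (hθ : IsRadialWeight θ η Cθ) (hη : η ^ 2 * (aMax A ^ 2 / aZero A) ≤ ϑ * (lam.re - omegaB B))
    (g : Crub S (CN N)) (hg : MemCbW θ g.1) (x : Rd d) :
    ‖(laplace (ouOp hd S Y h.re_pos b) lam g).1 x‖ ≤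
      constC7 d A Y ϑ Cθ / (lam.re - omegaB B) * (1 / θ x) * normCbW θ g.1 := by
  have h0 := h.aZero_pos
  have h1 := h.aMax_pos
  have h2 := h.aMin_pos
  obtain ⟨s, hs, hC⟩ := constC7_eq hd Y h2 h1 h0 (w := lam.re - omegaB B) hϑ0 hϑ1 Cθ
  rw [laplace_ouOp_apply hd hS h.isUnit h.re_pos h.neg_re_le hlam]
  refine (norm_integral_multiplier_le hd hS hθ Y (by positivity)
    (fun t ht j y => norm_heatFun_le h2 (by positivity) h.aMin_le h.sq_norm_le h.neg_re_le ht j y)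
    hlam (by positivity) hη hϑ0 one_pos hs (hg.mul_norm_le hθ.pos) x).trans (le_of_eq ?_)
  rw [← hC]
  ring

theorem SpectralData.norm_integral_gradOrbit_le (hd : 0 < d) (hS : S.transpose = -S)
    {A B Y : Matrix (Fin N) (Fin N) ℂ} {a b : Fin N → ℂ} (h : SpectralData A B Y a b) {lam : ℂ}
    (hlam : omegaB B < lam.re) {ϑ η Cθ : ℝ} (hϑ0 : 0 < ϑ) (hϑ1 : ϑ < 1) {θ : Rd d → ℝ}
    (hθ : IsRadialWeight θ η Cθ) (hη : η ^ 2 * (aMax A ^ 2 / aZero A) ≤ ϑ * (lam.re - omegaB B))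
    (g : Crub S (CN N)) (hg : MemCbW θ g.1) (i : Fin d) (x : Rd d) :
    ‖(∫ t in Set.Ioi (0 : ℝ), gradOrbit hd S Y h.re_pos b lam g i t).1 x‖ ≤
      constC8 d A Y ϑ Cθ / (lam.re - omegaB B) ^ ((1 : ℝ) / 2) * (1 / θ x) * normCbW θ g.1 := by
  have h0 := h.aZero_pos
  have h1 := h.aMax_pos
  have h2 := h.aMin_pos
  obtain ⟨s, hs, hC⟩ := constC8_eq hd Y h2 h1 h0 (sub_pos.2 hlam) hϑ0 hϑ1 Cθ
  rw [integral_gradOrbit_apply hd hS h.isUnit h.re_pos h.neg_re_le hlam]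
  refine (norm_integral_multiplier_le hd hS hθ Y (by positivity)
    (fun t ht j y => norm_gradFun_le hS h2 (by positivity) h.aMin_le h.sq_norm_le h.neg_re_le
      (by simp) ht j y)
    hlam (by positivity) hη hϑ0 one_half_pos hs (hg.mul_norm_le hθ.pos) x).trans (le_of_eq ?_)
  rw [← hC]
  ring

end Final

end OU

end

theorem theorem6p5 {d N : ℕ} (hd : 2 ≤ d) (hN : 1 ≤ N)
    (A B Y : Matrix (Fin N) (Fin N) ℂ) (S : Matrix (Fin d) (Fin d) ℝ)
    (hABY : OU.SimDiagonalizable A B Y)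
    (hA : ∀ z ∈ spectrum ℂ A, 0 < z.re)
    (hS : S.transpose = -S)
    (ϑ : ℝ) (hϑ0 : 0 < ϑ) (hϑ1 : ϑ < 1)
    (lam : ℂ) (hlam : OU.omegaB B < lam.re)
    (θ : OU.Rd d → ℝ) (η Cθ : ℝ) (hθ : OU.IsRadialWeight θ η Cθ)
    (hη : η ^ 2 ≤ ϑ * (OU.aZero A * (lam.re - OU.omegaB B) / OU.aMax A ^ 2))
    (hθlow : ∃ C : ℝ, 0 < C ∧ ∀ x, C ≤ θ x)
    (g : OU.Rd d → OU.CN N) (hg : OU.MemCrub S g) :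
    ∃ v : OU.Rd d → OU.CN N,
      OU.SolvesResolvent A B S lam g v ∧
      (∀ u, OU.SolvesResolvent A B S lam g u → u = v) ∧
      OU.MemCrub S v ∧ OU.MemC1ub v ∧
      (OU.MemCbW θ g →
        OU.MemC1bW θ v ∧
        OU.normCbW θ v ≤
          OU.constC7 d A Y ϑ Cθ / (lam.re - OU.omegaB B) * OU.normCbW θ g ∧
        (∀ i : Fin d, OU.normCbW θ (OU.partialD i v) ≤
          OU.constC8 d A Y ϑ Cθ / (lam.re - OU.omegaB B) ^ ((1 : ℝ) / 2) * OU.normCbW θ g) ∧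
        (∀ x, ‖v x‖ ≤
          OU.constC7 d A Y ϑ Cθ / (lam.re - OU.omegaB B) * (1 / θ x) * OU.normCbW θ g) ∧
        (∀ (i : Fin d) (x), ‖OU.partialD i v x‖ ≤
          OU.constC8 d A Y ϑ Cθ / (lam.re - OU.omegaB B) ^ ((1 : ℝ) / 2) * (1 / θ x) *
            OU.normCbW θ g)) := by
  have hd0 : 0 < d := by omega
  obtain ⟨a, b, h⟩ := OU.exists_spectralData hN hABY hA
  obtain ⟨f, hf⟩ := hg.exists_crub
  obtain rfl : f.1 = g := funext hf
  have hη' : η ^ 2 * (OU.aMax A ^ 2 / OU.aZero A) ≤ ϑ * (lam.re - OU.omegaB B) := by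
    have h0 := h.aZero_pos
    have h1 := h.aMax_pos
    refine (mul_le_mul_of_nonneg_right hη (by positivity)).trans (le_of_eq ?_)
    field_simp
  have hder := OU.hasFDerivAt_laplace hd0 hS h.isUnit h.re_pos h.neg_re_le hlam f
  set V := OU.laplace (OU.ouOp hd0 S Y h.re_pos b) lam f with hV
  let W : Fin d → OU.Crub S (OU.CN N) := fun i =>
    ∫ t in Set.Ioi (0 : ℝ), OU.gradOrbit hd0 S Y h.re_pos b lam f i t
  -- Each partial derivative is itself an element of C_rub, which gives its boundedness and uniform
  -- continuity at once.
  have hpart : ∀ i, OU.partialD i V.1 = (W i).1 := by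
    intro i
    ext1 x
    rw [OU.partialD]
    refine (DFunLike.congr_fun (hder x).fderiv _).trans ?_
    exact OU.assembleL_single _ i
  have hcont : ∀ i, Continuous (OU.partialD i V.1) := fun i => by
    rw [hpart]
    exact (W i).1.continuous
  have hC1 : ContDiff ℝ 1 V.1 := OU.contDiff_one_of_assembleL (fun i => (W i).1.continuous) hder
  have hVm : OU.MemCrub S V.1 := OU.memCrub_coe V
  refine ⟨V.1, h.solvesResolvent_laplace hd0 hS hlam f,
    fun u hu => h.eq_laplace_of_solvesResolvent hd0 hS hlam f hu, hVm, ⟨hC1, hVm.1, fun i => ?_⟩,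
    fun hgθ => ?_⟩
  · rw [hpart]
    exact (OU.memCrub_coe (W i)).1
  have hb0 := h.norm_laplace_le hd0 hS hlam hϑ0 hϑ1 hθ hη' f hgθ
  have hb1 : ∀ i x, ‖OU.partialD i V.1 x‖ ≤ OU.constC8 d A Y ϑ Cθ /
      (lam.re - OU.omegaB B) ^ ((1 : ℝ) / 2) * (1 / θ x) * OU.normCbW θ f.1 := fun i x => by
    rw [hpart]
    exact h.norm_integral_gradOrbit_le hd0 hS hlam hϑ0 hϑ1 hθ hη' f hgθ i x
  exact ⟨⟨hC1, OU.memCbW_of_le_div hθ.pos V.1.continuous hb0,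
    fun i => OU.memCbW_of_le_div hθ.pos (hcont i) (hb1 i)⟩, OU.normCbW_le_of_le_div hθ.pos hb0,
    fun i => OU.normCbW_le_of_le_div hθ.pos (hb1 i), hb0, hb1⟩
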